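/- Let $(\Omega,\mathcal F,\mathbb P)$ be a probability space with an increasing sequence $(\mathcal F_n)_{n\ge 0}$ of purely atomic sub-$\sigma$-algebras of $\mathcal F$: each $\mathcal F_n$ is generated by a countable partition $\mathscr A_n$ of $\Omega$ into sets of positive probability (its atoms), $\mathcal F_0=\{\emptyset,\Omega\}$, and $\mathcal F=\sigma\left(\bigcup_n\mathcal F_n\right)$. Call $(\Omega,\mathcal F,(\mathcal F_n),\mathbb P)$ a filtered probability space. For $1<p\le 2$, a Banach space $X$ and a constant $C>0$ consider the upper $\ell^p$ estimate $$\|f\|_{L^p(\Omega,X)}\le C\left(\|\mathbb E f\|_X^p+\sum_{n=1}^\infty\left\|\mathbb E(f|\mathcal F_n)-\mathbb E(f|\mathcal F_{n-1})\right\|_{L^p(\Omega,X)}^p\right)^{1/p}\qquad\text{for all } f\in L^p(\Omega,\mathcal F,\mathbb P;X).\tag{$*$}$$ A Banach space $X$ is of martingale type $p$ if there is one constant $C$ such that $(*)$ holds on every filtered probability space. For every $n$ and every $A\in\mathscr A_n$ choose a child of $A$ (an atom $B\in\mathscr A_{n+1}$ with $B\subseteq A$) of largest probability, denoted $A^*$.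 Let $\mathscr E$ be the collection consisting of $\Omega$ and of all sets $B\ne A^*$ that are children of some $A\in\mathscr A_n$, $n\ge 0$. Its Carleson constant is $$[\![\mathscr E]\!]=\sup_{I\in\mathscr E}\frac1{\mathbb P(I)}\sum_{J\in\mathscr E,\,J\subseteq I}\mathbb P(J)\in[1,\infty].$$ Theorem. Let $1<p\le 2$ and fix a filtered probability space $(\Omega,\mathcal F,(\mathcal F_n),\mathbb P)$. Exactly one of the following two statements holds: (a) there exists $C>0$ such that $(*)$ holds for this filtered probability space with the constant $C$ for every Banach space $X$; (b) every Banach space $X$ for which $(*)$ holds for this filtered probability space with some constant $C>0$ is of martingale type $p$. Moreover, for any choice of the largest children $A^*$, (a) holds if and only if $[\![\mathscr E]\!]<\infty$, and (b) holds if and only if $[\![\mathscr E]\!]=\infty$. -/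

import Mathlib

open MeasureTheory
open scoped ENNReal NNReal

/-- A filtered probability space with purely atomic `σ`-algebras over the measurable space `(Ω, m)`
with measure `P` (which is assumed to be a probability measure wherever this is used):
an increasing sequence of sub-`σ`-algebras `seq n` of `m`, each generated by a countable partition
`atoms n` of `Ω` into sets of positive measure, which starts with the trivial `σ`-algebra (so that
the martingale differences `E(f | seq n) - E(f | seq (n - 1))`, `n ≥ 1`, start from `E f`)
and generates `m`. -/
structure AtomicFiltration {Ω : Type*} [m : MeasurableSpace Ω] (P : Measure Ω)
    extends Filtration ℕ m where
  /-- the atoms of the `n`-th `σ`-algebra -/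
  atoms : ℕ → Set (Set Ω)
  countable_atoms : ∀ n, (atoms n).Countable
  pairwiseDisjoint_atoms : ∀ n, (atoms n).PairwiseDisjoint id
  sUnion_atoms : ∀ n, ⋃₀ atoms n = Set.univ
  measure_atoms_pos : ∀ n, ∀ A ∈ atoms n, 0 < P A
  seq_eq_generateFrom : ∀ n, seq n = MeasurableSpace.generateFrom (atoms n)
  atoms_zero : atoms 0 = {Set.univ}
  iSup_seq : ⨆ n, seq n = m

namespace AtomicFiltration

variable {Ω : Type*} [m : MeasurableSpace Ω] {P : Measure Ω}

/-- The children of a level-`n` atom `A`: the atoms of level `n + 1` contained in `A`. -/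
def children (F : AtomicFiltration P) (n : ℕ) (A : Set Ω) : Set (Set Ω) :=
  {B | B ∈ F.atoms (n + 1) ∧ B ⊆ A}

/-- `star` picks, for every `n` and every atom `A` of level `n`, a child of `A` of largest measure
(ties being broken arbitrarily). -/
def IsLargestChildSelection (F : AtomicFiltration P) (star : ℕ → Set Ω → Set Ω) : Prop :=
  ∀ n, ∀ A ∈ F.atoms n, star n A ∈ F.children n A ∧ ∀ B ∈ F.children n A, P B ≤ P (star n A)

/-- The collection `𝓔` consisting of `Ω` and of all atoms which, as a child of an atom of the
preceding level, are not the selected largest child. -/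
def nonLargest (F : AtomicFiltration P) (star : ℕ → Set Ω → Set Ω) : Set (Set Ω) :=
  {Set.univ} ∪ {B | ∃ n, ∃ A ∈ F.atoms n, B ∈ F.children n A ∧ B ≠ star n A}

/-- The upper `ℓ^p` estimate with constant `C` for all `f ∈ L^p(Ω, m, P; X)`:
`‖f‖_p ≤ C (‖E f‖^p + ∑_{n ≥ 1} ‖E(f | F_n) - E(f | F_{n-1})‖_p^p)^{1/p}`,
an inequality in `[0, ∞]`. -/
def UpperEstimate (F : AtomicFiltration P) (p : ℝ) (X : Type*) [NormedAddCommGroup X]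
    [NormedSpace ℝ X] [CompleteSpace X] (C : ℝ≥0) : Prop :=
  ∀ f : Ω → X, MemLp f (ENNReal.ofReal p) P →
    eLpNorm f (ENNReal.ofReal p) P ≤
      (C : ℝ≥0∞) * (‖∫ ω, f ω ∂P‖ₑ ^ p +
        ∑' n : ℕ, eLpNorm (P[f | F.seq (n + 1)] - P[f | F.seq n]) (ENNReal.ofReal p) P ^ p)
          ^ (1 / p)

end AtomicFiltration

/-- The Carleson constant `sup_{I ∈ R} P(I)⁻¹ ∑_{J ∈ R, J ⊆ I} P(J)`, with values in `[0, ∞]`. -/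
noncomputable def carlesonConstant {Ω : Type*} [MeasurableSpace Ω] (P : Measure Ω)
    (R : Set (Set Ω)) : ℝ≥0∞ :=
  ⨆ I ∈ R, (P I)⁻¹ * ∑' J : {J : Set Ω // J ∈ R ∧ J ⊆ I}, P J.1

/-- `X` has martingale type `p`: the upper `ℓ^p` estimate holds with one constant on all filtered
probability spaces with purely atomic `σ`-algebras. -/
def HasMartingaleType.{w, v} (p : ℝ) (X : Type v) [NormedAddCommGroup X] [NormedSpace ℝ X]
    [CompleteSpace X] : Prop :=
  ∃ C : ℝ≥0, 0 < C ∧ ∀ (Ω : Type w) [MeasurableSpace Ω] (P : Measure Ω) [IsProbabilityMeasure P]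
    (F : AtomicFiltration P), F.UpperEstimate p X C

/-- On the given filtered probability space, the upper `ℓ^p` estimate holds with one constant for
all Banach spaces. -/
def EstimateForAll.{v, u} {Ω : Type u} [MeasurableSpace Ω] {P : Measure Ω}
    (F : AtomicFiltration P) (p : ℝ) : Prop :=
  ∃ C : ℝ≥0, 0 < C ∧ ∀ (X : Type v) [NormedAddCommGroup X] [NormedSpace ℝ X] [CompleteSpace X],
    F.UpperEstimate p X C

/-- Every Banach space for which the upper `ℓ^p` estimate holds (with some constant) on the given
filtered probability space has martingale type `p`. -/
def DeterminesMartingaleType.{w, v, u} {Ω : Type u} [MeasurableSpace Ω] {P : Measure Ω}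
    (F : AtomicFiltration P) (p : ℝ) : Prop :=
  ∀ (X : Type v) [NormedAddCommGroup X] [NormedSpace ℝ X] [CompleteSpace X],
    (∃ C : ℝ≥0, 0 < C ∧ F.UpperEstimate p X C) → HasMartingaleType.{w, v} p X

namespace AtomicFiltration

variable {Ω : Type*} [m : MeasurableSpace Ω] {P : Measure Ω}

/-- A selection of largest children exists. -/
theorem exists_isLargestChildSelection [IsProbabilityMeasure P] (F : AtomicFiltration P) :
    ∃ star, F.IsLargestChildSelection star := by
  have key : ∀ n, ∀ A ∈ F.atoms n, ∃ S ∈ F.children n A, ∀ B ∈ F.children n A, P B ≤ P S := by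
    intro n A hA
    have hmeas : ∀ k, ∀ B ∈ F.atoms k, MeasurableSet B := by
      intro k B hB
      refine F.le' k B ?_
      rw [F.seq_eq_generateFrom]
      exact MeasurableSpace.measurableSet_generateFrom hB
    have hdich : ∀ k, ∀ B ∈ F.atoms k, ∀ S, MeasurableSet[F.seq k] S → B ⊆ S ∨ Disjoint B S := by
      intro k B hB S hS
      rw [F.seq_eq_generateFrom] at hS
      induction S, hS using MeasurableSpace.generateFrom_induction with
      | hC t ht _ =>
        by_cases h : B = t
        · exact Or.inl h.le
        · exact Or.inr (F.pairwiseDisjoint_atoms k hB ht h)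
      | empty => exact Or.inr (Set.disjoint_empty B)
      | compl t _ ih =>
        rcases ih with ih | ih
        · exact Or.inr (Set.disjoint_compl_right_iff_subset.2 ih)
        · exact Or.inl (Set.subset_compl_iff_disjoint_right.2 ih)
      | iUnion s _ ih =>
        by_cases h : ∃ i, B ⊆ s i
        · obtain ⟨i, hi⟩ := h
          exact Or.inl (hi.trans (Set.subset_iUnion s i))
        · push Not at h
          refine Or.inr (Set.disjoint_iUnion_right.2 fun i => ?_)
          exact (ih i).resolve_left (h i)
    have hne : ∃ B₀, B₀ ∈ F.children n A := by
      obtain ⟨ω, hω⟩ := nonempty_of_measure_ne_zero (F.measure_atoms_pos n A hA).ne'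
      have h1 : ω ∈ ⋃₀ F.atoms (n + 1) := by rw [F.sUnion_atoms]; trivial
      obtain ⟨B, hB, hωB⟩ := h1
      have hAm : MeasurableSet[F.seq (n + 1)] A := by
        refine F.mono' (Nat.le_succ n) A ?_
        rw [F.seq_eq_generateFrom]
        exact MeasurableSpace.measurableSet_generateFrom hA
      refine ⟨B, hB, ?_⟩
      rcases hdich _ B hB A hAm with h | h
      · exact h
      · exact absurd hω (Set.disjoint_left.1 h hωB)
    obtain ⟨B₀, hB₀⟩ := hne
    have hfin : {B : F.atoms (n + 1) | P B₀ ≤ P B.1}.Finite := by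
      refine Measure.finite_const_le_meas_of_disjoint_iUnion P
        (F.measure_atoms_pos _ B₀ hB₀.1) (As := fun B : F.atoms (n + 1) => B.1)
        (fun B => hmeas _ _ B.2) ?_ (measure_ne_top P _)
      intro B C hBC
      exact F.pairwiseDisjoint_atoms _ B.2 C.2 (fun h => hBC (Subtype.ext h))
    have hfin' : {B | B ∈ F.children n A ∧ P B₀ ≤ P B}.Finite := by
      refine (hfin.image Subtype.val).subset ?_
      rintro B ⟨hB, hle⟩
      exact ⟨⟨B, hB.1⟩, hle, rfl⟩
    obtain ⟨S, hS, hmax⟩ := Set.exists_max_image _ P hfin' ⟨B₀, hB₀, le_rfl⟩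
    refine ⟨S, hS.1, fun B hB => ?_⟩
    rcases le_total (P B₀) (P B) with h | h
    · exact hmax B ⟨hB, h⟩
    · exact h.trans hS.2
  choose! star h1 h2 using key
  exact ⟨star, fun n A hA => ⟨h1 n A hA, h2 n A hA⟩⟩

end AtomicFiltration

universe u v w

open Filter Topology

/-!
Suppose that the Carleson constant is finite. The estimate follows from a potential: a function of
an atom `A` and a vector `x` that dominates `‖x‖ ^ p` and increases, from an atom to its children,
by at most a multiple of the `p`-th moment of the martingale difference. The potential is `‖x‖ ^ p`
times a weight between `1` and `2`, affine in the relative mass of the members of `𝓔` properly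
inside `A`, so that on `A` the weight exceeds its mean over the children by a multiple of
`P (A \ A*) / P A`. Since a martingale difference has mean zero on `A`, its value on `A*` is
controlled by its values off `A*`, and the excess of the weight absorbs the remaining terms.

Suppose that the Carleson constant is infinite. Call a member of `𝓔` inside `A` an exit of `A` if it
is a child of a member of the chain `A, A*, A**, ...`. Then for every `N` some atom is almost filled
by `N` successive generations of exits. In such an atom `A`, a subset of relative measure between
`1 / 3` and `2 / 3` that respects the exits can be split off by a mean zero function of energy at
most `2 P A`, and a dyadic martingale of length `N` can be imitated step by step. Hence the upper
estimate on the given space bounds, for all dyadic martingales started at `x`, the `p`-th moment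
minus a multiple of the energy. The supremum of these functionals is a convex function of `x` that
satisfies a two-point inequality, which makes it a potential on every filtered probability space;
thus `X` has martingale type `p`.

The two alternatives exclude each other because `ℓ¹` does not have martingale type `p > 1`.
-/

section PowerInequalities

variable {p : ℝ}

lemma add_rpow_le_one_add_mul_rpow (hp1 : 1 ≤ p) (hp2 : p ≤ 2) {ε : ℝ≥0} (hε : 0 < ε)
    (hε1 : ε ≤ 1) (s d : ℝ≥0) :
    (s + d) ^ p ≤ (1 + ε) * s ^ p + 2 * ε ^ (1 - p) * d ^ p := by
  have hweight : ∀ {w : ℝ≥0}, 0 < w → w⁻¹ * w ^ p = w ^ (p - 1) := fun {w} hw => by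
    rw [NNReal.rpow_sub_one hw.ne', div_eq_inv_mul]
  have hsplit : s + d = (1 + ε)⁻¹ * ((1 + ε) * s) + ((1 + ε) / ε)⁻¹ * ((1 + ε) / ε * d) := by
    field_simp
  have hleft : (1 + ε) ^ (p - 1) ≤ 1 + ε := by
    simpa using NNReal.rpow_le_rpow_of_exponent_le (x := 1 + ε) le_self_add
      (by linarith : p - 1 ≤ 1)
  have hright : ((1 + ε) / ε) ^ (p - 1) ≤ 2 * ε ^ (1 - p) := by
    rw [NNReal.div_rpow, div_eq_mul_inv, ← NNReal.rpow_neg, neg_sub]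
    gcongr
    calc (1 + ε) ^ (p - 1) ≤ 1 + ε := hleft
      _ ≤ 1 + 1 := by gcongr
      _ = 2 := one_add_one_eq_two
  calc (s + d) ^ p
      ≤ (1 + ε)⁻¹ * ((1 + ε) * s) ^ p + ((1 + ε) / ε)⁻¹ * ((1 + ε) / ε * d) ^ p := by
        rw [hsplit]
        exact NNReal.rpow_arith_mean_le_arith_mean2_rpow _ _ _ _ (by field_simp) hp1
    _ = (1 + ε) ^ (p - 1) * s ^ p + ((1 + ε) / ε) ^ (p - 1) * d ^ p := by
        rw [NNReal.mul_rpow, NNReal.mul_rpow, ← mul_assoc, ← mul_assoc, hweight (by positivity),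
          hweight (by positivity)]
    _ ≤ _ := by gcongr

lemma rpow_one_sub_le_inv (hp2 : p ≤ 2) {c : ℝ≥0} (hc : 0 < c) (hc1 : c ≤ 1) :
    c ^ (1 - p) ≤ c⁻¹ := by
  rw [← NNReal.rpow_neg_one]
  exact NNReal.rpow_le_rpow_of_exponent_ge hc hc1 (by linarith)

-- The parameter of `add_rpow_le_one_add_mul_rpow` is `c * min 1 (b / a)`.
lemma mul_add_rpow_le_of_mul_rpow_le (hp1 : 1 < p) (hp2 : p ≤ 2) {a b c s y D : ℝ≥0}
    (hc : 0 < c) (hc1 : c ≤ 1) (ha : 0 < a)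
    (h₁ : (a * y) ^ p ≤ D * b ^ (p - 1)) (h₂ : a * y ^ p ≤ D) :
    a * (s + y) ^ p ≤ (a + c * b) * s ^ p + 2 * c⁻¹ * D := by
  have hp0 : 0 < p := by linarith
  have hcp := rpow_one_sub_le_inv hp2 hc hc1
  rcases eq_zero_or_pos b with rfl | hb
  · rw [NNReal.zero_rpow (by linarith), mul_zero, nonpos_iff_eq_zero,
      NNReal.rpow_eq_zero hp0.ne', mul_eq_zero, or_iff_right ha.ne'] at h₁
    simp [h₁]
  rcases le_total a b with hab | hba
  · calc a * (s + y) ^ p ≤ a * ((1 + c) * s ^ p + 2 * c ^ (1 - p) * y ^ p) := by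
          gcongr
          exact add_rpow_le_one_add_mul_rpow hp1.le hp2 hc hc1 s y
      _ = (a + c * a) * s ^ p + 2 * c ^ (1 - p) * (a * y ^ p) := by ring
      _ ≤ _ := by gcongr
  · have hu : b / a ≤ 1 := div_le_one_of_le₀ hba a.2
    have hD : a * ((b / a) ^ (1 - p) * y ^ p) ≤ D := by
      calc a * ((b / a) ^ (1 - p) * y ^ p) = (a * y) ^ p / b ^ (p - 1) := by
            rw [NNReal.div_rpow, NNReal.mul_rpow, ← neg_sub p 1, NNReal.rpow_neg, NNReal.rpow_neg,
              NNReal.rpow_sub_one ha.ne']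
            field_simp
        _ ≤ D := div_le_of_le_mul₀ (by positivity) (by positivity) h₁
    calc a * (s + y) ^ p
        ≤ a * ((1 + c * (b / a)) * s ^ p + 2 * (c * (b / a)) ^ (1 - p) * y ^ p) := by
          gcongr
          exact add_rpow_le_one_add_mul_rpow hp1.le hp2 (by positivity)
            (mul_le_one₀ hc1 (by positivity) hu) s y
      _ = (a + c * b) * s ^ p + 2 * c ^ (1 - p) * (a * ((b / a) ^ (1 - p) * y ^ p)) := by
          rw [NNReal.mul_rpow]
          field_simp
      _ ≤ _ := by gcongr

lemma enorm_add_rpow_le {X : Type*} [SeminormedAddCommGroup X] (hp1 : 1 ≤ p) (hp2 : p ≤ 2)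
    {c : ℝ≥0} (hc : 0 < c) (hc1 : c ≤ 1) (x y : X) :
    ‖x + y‖ₑ ^ p ≤ (1 + c) * ‖x‖ₑ ^ p + 2 * (c⁻¹ : ℝ≥0) * ‖y‖ₑ ^ p := by
  have hp0 : 0 ≤ p := by linarith
  have h : ‖x + y‖₊ ^ p ≤ (1 + c) * ‖x‖₊ ^ p + 2 * c⁻¹ * ‖y‖₊ ^ p :=
    calc ‖x + y‖₊ ^ p ≤ (‖x‖₊ + ‖y‖₊) ^ p := by
          gcongr
          exact nnnorm_add_le x y
      _ ≤ (1 + c) * ‖x‖₊ ^ p + 2 * c ^ (1 - p) * ‖y‖₊ ^ p :=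
          add_rpow_le_one_add_mul_rpow hp1 hp2 hc hc1 _ _
      _ ≤ _ := by
          gcongr
          exact rpow_one_sub_le_inv hp2 hc hc1
  simp only [enorm_eq_nnnorm, ← ENNReal.coe_rpow_of_nonneg _ hp0]
  exact_mod_cast h

end PowerInequalities

section Moments

variable {Ω : Type*} {m0 : MeasurableSpace Ω} {μ : Measure Ω}
  {X : Type*} [NormedAddCommGroup X] {p : ℝ}

lemma eLpNorm_ofReal_rpow_eq_lintegral (hp : 0 < p) (f : Ω → X) :
    eLpNorm f (ENNReal.ofReal p) μ ^ p = ∫⁻ ω, ‖f ω‖ₑ ^ p ∂μ := by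
  lift p to ℝ≥0 using hp.le
  rw [ENNReal.ofReal_coe_nnreal]
  exact eLpNorm_nnreal_pow_eq_lintegral (by exact_mod_cast hp.ne')

lemma lintegral_rpow_le_lintegral_rpow_mul_measure_univ (hp : 1 ≤ p) {f : Ω → X}
    (hf : AEStronglyMeasurable f μ) :
    (∫⁻ ω, ‖f ω‖ₑ ∂μ) ^ p ≤ (∫⁻ ω, ‖f ω‖ₑ ^ p ∂μ) * μ Set.univ ^ (p - 1) := by
  have hp0 : 0 < p := by linarith
  have h := eLpNorm_le_eLpNorm_mul_rpow_measure_univ (p := 1) (q := ENNReal.ofReal p)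
    (by simpa using hp) hf
  rw [eLpNorm_one_eq_lintegral_enorm, ENNReal.toReal_one, ENNReal.toReal_ofReal hp0.le] at h
  calc (∫⁻ ω, ‖f ω‖ₑ ∂μ) ^ p
      ≤ (eLpNorm f (ENNReal.ofReal p) μ * μ Set.univ ^ (1 / 1 - 1 / p)) ^ p := by gcongr
    _ = (∫⁻ ω, ‖f ω‖ₑ ^ p ∂μ) * μ Set.univ ^ (p - 1) := by
        rw [ENNReal.mul_rpow_of_nonneg _ _ hp0.le, eLpNorm_ofReal_rpow_eq_lintegral hp0,
          ← ENNReal.rpow_mul]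
        congr 2
        field_simp

end Moments

section ClosedMartingale

variable {Ω : Type*} {m m0 : MeasurableSpace Ω} {μ : Measure Ω}
  {X : Type*} [NormedAddCommGroup X] [NormedSpace ℝ X] [CompleteSpace X] {f g : Ω → X}

lemma eLpNorm_condExp_sub_le (hf : Integrable f μ) (hg : Integrable g μ) :
    eLpNorm (μ[f | m] - f) 1 μ ≤ 2 * eLpNorm (f - g) 1 μ + eLpNorm (μ[g | m] - g) 1 μ := by
  have hcond : Integrable (μ[f - g | m]) μ := integrable_condExp
  have hdecomp : μ[f | m] - f =ᵐ[μ] μ[f - g | m] + (g - f) + (μ[g | m] - g) := by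
    filter_upwards [condExp_sub hf hg m] with ω hω
    simp only [Pi.add_apply, Pi.sub_apply, hω]
    abel
  calc eLpNorm (μ[f | m] - f) 1 μ
      = eLpNorm (μ[f - g | m] + (g - f) + (μ[g | m] - g)) 1 μ := eLpNorm_congr_ae hdecomp
    _ ≤ eLpNorm (μ[f - g | m]) 1 μ + eLpNorm (g - f) 1 μ + eLpNorm (μ[g | m] - g) 1 μ := by
        refine (eLpNorm_add_le (hcond.add (hg.sub hf)).aestronglyMeasurable
          (integrable_condExp.sub hg).aestronglyMeasurable le_rfl).trans ?_
        gcongr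
        exact eLpNorm_add_le hcond.aestronglyMeasurable (hg.sub hf).aestronglyMeasurable le_rfl
    _ ≤ eLpNorm (f - g) 1 μ + eLpNorm (f - g) 1 μ + eLpNorm (μ[g | m] - g) 1 μ := by
        gcongr
        · exact eLpNorm_condExp_le_eLpNorm _ le_rfl
        · rw [eLpNorm_sub_comm]
    _ = _ := by rw [two_mul]

variable [IsFiniteMeasure μ] {ℱ : Filtration ℕ m0} (hℱ : ⨆ n, ℱ n = m0)
include hℱ

lemma tendsto_eLpNorm_condExp_indicator_sub {s : Set Ω} (hs : MeasurableSet s) (c : X) :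
    Tendsto (fun n => eLpNorm (μ[s.indicator fun _ => c | ℱ n] - s.indicator fun _ => c) 1 μ)
      atTop (𝓝 0) := by
  set r : Ω → ℝ := s.indicator fun _ => 1 with hr_def
  have hr : Integrable r μ := (integrable_const 1).indicator hs
  have hlim := hr.tendsto_eLpNorm_condExp (ℱ := ℱ)
    (by rw [hℱ]; exact stronglyMeasurable_const.indicator hs)
  have hcomp : (s.indicator fun _ => c) = ContinuousLinearMap.toSpanSingleton ℝ c ∘ r := by
    ext ω
    by_cases hω : ω ∈ s <;> simp [hr_def, hω]
  have hlim' : Tendsto (fun n => ‖c‖ₑ * eLpNorm (μ[r | ℱ n] - r) 1 μ) atTop (𝓝 0) := by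
    simpa using ENNReal.Tendsto.const_mul hlim (Or.inr (enorm_ne_top (x := c)))
  refine tendsto_of_tendsto_of_tendsto_of_le_of_le tendsto_const_nhds hlim' (fun _ => zero_le)
    fun n => eLpNorm_le_mul_eLpNorm_of_ae_le_mul'' 1
      (integrable_condExp.sub hr).aestronglyMeasurable ?_
  rw [hcomp]
  filter_upwards [(ContinuousLinearMap.toSpanSingleton ℝ c).comp_condExp_comm (m := ℱ n) hr]
    with ω hω
  rw [Pi.sub_apply, ← hω]
  simp only [Function.comp_apply, ContinuousLinearMap.toSpanSingleton_apply, ← sub_smul,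
    enorm_smul, Pi.sub_apply, mul_comm, le_refl]

lemma tendsto_eLpNorm_condExp_sub (hf : Integrable f μ) :
    Tendsto (fun n => eLpNorm (μ[f | ℱ n] - f) 1 μ) atTop (𝓝 0) := by
  let Q : (Ω → X) → Prop := fun g =>
    Integrable g μ ∧ Tendsto (fun n => eLpNorm (μ[g | ℱ n] - g) 1 μ) atTop (𝓝 0)
  have hadd : ∀ f g, Q f → Q g → Q (f + g) := by
    rintro f g ⟨hf, hf'⟩ ⟨hg, hg'⟩
    refine ⟨hf.add hg, tendsto_of_tendsto_of_tendsto_of_le_of_le tendsto_const_nhds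
      (by simpa using hf'.add hg') (fun _ => zero_le) fun n => ?_⟩
    have hsum : μ[f + g | ℱ n] - (f + g) =ᵐ[μ] (μ[f | ℱ n] - f) + (μ[g | ℱ n] - g) := by
      filter_upwards [condExp_add hf hg (ℱ n)] with ω hω
      simp only [Pi.sub_apply, Pi.add_apply, hω]
      abel
    dsimp only
    rw [eLpNorm_congr_ae hsum]
    exact eLpNorm_add_le (integrable_condExp.sub hf).aestronglyMeasurable
      (integrable_condExp.sub hg).aestronglyMeasurable le_rfl
  refine ENNReal.tendsto_nhds_zero.2 fun ε hε => ?_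
  have hε3 : ε / 3 ≠ 0 := (ENNReal.div_pos hε.ne' (by simp)).ne'
  obtain ⟨g, hfg, hg, hg'⟩ := (memLp_one_iff_integrable.2 hf).induction_dense (by simp) Q
    (fun c s hs _ ε _ => ⟨s.indicator fun _ => c, by simp, (integrable_const c).indicator hs,
      tendsto_eLpNorm_condExp_indicator_sub hℱ hs c⟩) hadd
    (fun f hf => hf.1.aestronglyMeasurable) hε3
  filter_upwards [ENNReal.tendsto_nhds_zero.1 hg' (ε / 3) (pos_iff_ne_zero.2 hε3)] with n hn
  calc eLpNorm (μ[f | ℱ n] - f) 1 μ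
      ≤ 2 * eLpNorm (f - g) 1 μ + eLpNorm (μ[g | ℱ n] - g) 1 μ := eLpNorm_condExp_sub_le hf hg
    _ ≤ 2 * (ε / 3) + ε / 3 := by gcongr
    _ = ε := by rw [two_mul, ENNReal.add_thirds]

lemma lintegral_rpow_le_of_forall_condExp {p : ℝ} (hf : Integrable f μ) {b : ℝ≥0∞}
    (h : ∀ n, ∫⁻ ω, ‖(μ[f | ℱ n]) ω‖ₑ ^ p ∂μ ≤ b) : ∫⁻ ω, ‖f ω‖ₑ ^ p ∂μ ≤ b := by
  have hmeas := tendstoInMeasure_of_tendsto_eLpNorm (p := 1) one_ne_zero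
    (fun n => (integrable_condExp (m := ℱ n) (f := f) (μ := μ)).aestronglyMeasurable)
    hf.aestronglyMeasurable (tendsto_eLpNorm_condExp_sub hℱ hf)
  obtain ⟨ns, _, hns⟩ := hmeas.exists_seq_tendsto_ae
  calc ∫⁻ ω, ‖f ω‖ₑ ^ p ∂μ
      = ∫⁻ ω, liminf (fun i => ‖(μ[f | ℱ (ns i)]) ω‖ₑ ^ p) atTop ∂μ := by
        refine lintegral_congr_ae (hns.mono fun ω hω => ?_)
        exact (((ENNReal.continuous_rpow_const (y := p)).tendsto _).comp hω.enorm).liminf_eq.symm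
    _ ≤ liminf (fun i => ∫⁻ ω, ‖(μ[f | ℱ (ns i)]) ω‖ₑ ^ p ∂μ) atTop :=
        lintegral_liminf_le' fun i => integrable_condExp.aestronglyMeasurable.enorm.pow_const p
    _ ≤ b := liminf_le_of_le (by isBoundedDefault) fun c hc => by
        obtain ⟨i, hi⟩ := hc.exists
        exact hi.trans (h _)

end ClosedMartingale

namespace AtomicFiltration

section Atoms

variable {Ω : Type*} [m : MeasurableSpace Ω] {P : Measure Ω} (F : AtomicFiltration P)
variable {n k l : ℕ} {A B : Set Ω} {ω ω' : Ω}

lemma measurableSet_seq_of_mem_atoms (hA : A ∈ F.atoms n) : MeasurableSet[F.seq n] A := by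
  rw [F.seq_eq_generateFrom]
  exact MeasurableSpace.measurableSet_generateFrom hA

lemma measurableSet_of_mem_atoms (hA : A ∈ F.atoms n) : MeasurableSet A :=
  F.le' n A (F.measurableSet_seq_of_mem_atoms hA)

lemma nonempty_of_mem_atoms (hA : A ∈ F.atoms n) : A.Nonempty :=
  nonempty_of_measure_ne_zero (F.measure_atoms_pos n A hA).ne'

lemma univ_mem_atoms_zero : Set.univ ∈ F.atoms 0 := by
  rw [F.atoms_zero]; rfl

lemma subset_or_disjoint_of_measurableSet (hB : B ∈ F.atoms k) {S : Set Ω}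
    (hS : MeasurableSet[F.seq k] S) : B ⊆ S ∨ Disjoint B S := by
  rw [F.seq_eq_generateFrom] at hS
  induction S, hS using MeasurableSpace.generateFrom_induction with
  | hC t ht _ =>
    by_cases h : B = t
    · exact Or.inl h.le
    · exact Or.inr (F.pairwiseDisjoint_atoms k hB ht h)
  | empty => exact Or.inr (Set.disjoint_empty B)
  | compl t _ ih =>
    rcases ih with ih | ih
    · exact Or.inr (Set.disjoint_compl_right_iff_subset.2 ih)
    · exact Or.inl (Set.subset_compl_iff_disjoint_right.2 ih)
  | iUnion s _ ih =>
    by_cases h : ∃ i, B ⊆ s i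
    · obtain ⟨i, hi⟩ := h
      exact Or.inl (hi.trans (Set.subset_iUnion s i))
    · push Not at h
      exact Or.inr (Set.disjoint_iUnion_right.2 fun i => (ih i).resolve_left (h i))

lemma subset_or_disjoint (hkl : k ≤ l) (hA : A ∈ F.atoms k) (hB : B ∈ F.atoms l) :
    B ⊆ A ∨ Disjoint B A :=
  F.subset_or_disjoint_of_measurableSet hB (F.mono' hkl A (F.measurableSet_seq_of_mem_atoms hA))

lemma subset_of_mem_of_mem (hkl : k ≤ l) (hA : A ∈ F.atoms k) (hB : B ∈ F.atoms l)
    (h1 : ω ∈ A) (h2 : ω ∈ B) : B ⊆ A :=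
  (F.subset_or_disjoint hkl hA hB).resolve_right fun h => Set.disjoint_left.1 h h2 h1

lemma eq_of_mem_of_mem (hA : A ∈ F.atoms n) (hB : B ∈ F.atoms n) (h1 : ω ∈ A) (h2 : ω ∈ B) :
    A = B :=
  (F.subset_of_mem_of_mem le_rfl hB hA h2 h1).antisymm (F.subset_of_mem_of_mem le_rfl hA hB h1 h2)

lemma exists_mem_atoms (n : ℕ) (ω : Ω) : ∃ A ∈ F.atoms n, ω ∈ A := by
  have h : ω ∈ ⋃₀ F.atoms n := by rw [F.sUnion_atoms]; trivial
  exact h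

/-- The atom of level `n` that contains `ω`. -/
noncomputable def atomAt (n : ℕ) (ω : Ω) : Set Ω := (F.exists_mem_atoms n ω).choose

lemma atomAt_mem (n : ℕ) (ω : Ω) : F.atomAt n ω ∈ F.atoms n :=
  (F.exists_mem_atoms n ω).choose_spec.1

lemma mem_atomAt (n : ℕ) (ω : Ω) : ω ∈ F.atomAt n ω :=
  (F.exists_mem_atoms n ω).choose_spec.2

lemma atomAt_eq (hA : A ∈ F.atoms n) (hω : ω ∈ A) : F.atomAt n ω = A :=
  F.eq_of_mem_of_mem (F.atomAt_mem n ω) hA (F.mem_atomAt n ω) hω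

lemma atomAt_subset (hkl : k ≤ l) (ω : Ω) : F.atomAt l ω ⊆ F.atomAt k ω :=
  F.subset_of_mem_of_mem hkl (F.atomAt_mem k ω) (F.atomAt_mem l ω) (F.mem_atomAt k ω)
    (F.mem_atomAt l ω)

lemma children_countable (n : ℕ) (A : Set Ω) : (F.children n A).Countable :=
  (F.countable_atoms (n + 1)).mono fun _ h => h.1

lemma children_pairwiseDisjoint (n : ℕ) (A : Set Ω) : (F.children n A).PairwiseDisjoint id :=
  (F.pairwiseDisjoint_atoms (n + 1)).subset fun _ h => h.1

lemma atomAt_succ_mem_children (hA : A ∈ F.atoms n) (hω : ω ∈ A) :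
    F.atomAt (n + 1) ω ∈ F.children n A :=
  ⟨F.atomAt_mem _ _, F.subset_of_mem_of_mem n.le_succ hA (F.atomAt_mem _ _) hω (F.mem_atomAt _ _)⟩

lemma biUnion_children (hA : A ∈ F.atoms n) : ⋃ B ∈ F.children n A, B = A := by
  refine Set.Subset.antisymm (Set.iUnion₂_subset fun _ hB => hB.2) fun _ hω => ?_
  exact Set.mem_iUnion₂.2 ⟨_, F.atomAt_succ_mem_children hA hω, F.mem_atomAt _ _⟩

lemma setLIntegral_eq_tsum_children (hA : A ∈ F.atoms n) (g : Ω → ℝ≥0∞) :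
    ∫⁻ ω in A, g ω ∂P = ∑' B : F.children n A, ∫⁻ ω in B.1, g ω ∂P := by
  conv_lhs => rw [← F.biUnion_children hA]
  exact lintegral_biUnion (s := fun B : Set Ω => B) (F.children_countable n A)
    (fun B hB => F.measurableSet_of_mem_atoms hB.1) (F.children_pairwiseDisjoint n A) g

lemma measure_inter_eq_tsum_children (hA : A ∈ F.atoms n) (S : Set Ω) :
    P (A ∩ S) = ∑' B : F.children n A, P (B.1 ∩ S) := by
  have h : ∀ B, MeasurableSet B → P (B ∩ S) = ∫⁻ _ in B, 1 ∂(P.restrict S) := fun B hB => by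
    simp [Measure.restrict_apply hB]
  rw [h A (F.measurableSet_of_mem_atoms hA)]
  conv_lhs => rw [← F.biUnion_children hA]
  rw [lintegral_biUnion (s := fun B : Set Ω => B) (F.children_countable n A)
    (fun B hB => F.measurableSet_of_mem_atoms hB.1) (F.children_pairwiseDisjoint n A)]
  exact tsum_congr fun B => (h B.1 (F.measurableSet_of_mem_atoms B.2.1)).symm

lemma measure_eq_tsum_children (hA : A ∈ F.atoms n) : P A = ∑' B : F.children n A, P B.1 := by
  simpa using F.measure_inter_eq_tsum_children hA Set.univ

lemma lintegral_eq_tsum_atoms (n : ℕ) (g : Ω → ℝ≥0∞) :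
    ∫⁻ ω, g ω ∂P = ∑' A : F.atoms n, ∫⁻ ω in A.1, g ω ∂P := by
  rw [← lintegral_biUnion (s := fun B : Set Ω => B) (F.countable_atoms n)
    (fun B hB => F.measurableSet_of_mem_atoms hB) (F.pairwiseDisjoint_atoms n),
    ← Set.sUnion_eq_biUnion, F.sUnion_atoms, Measure.restrict_univ]

lemma eq_of_stronglyMeasurable {Y : Type*} [TopologicalSpace Y] [TopologicalSpace.MetrizableSpace Y]
    {g : Ω → Y} (hg : StronglyMeasurable[F.seq n] g) (hA : A ∈ F.atoms n) (h1 : ω ∈ A)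
    (h2 : ω' ∈ A) : g ω' = g ω := by
  have hS : MeasurableSet[F.seq n] {x | g x = g ω} :=
    hg.measurableSet_eq_fun stronglyMeasurable_const
  rcases F.subset_or_disjoint_of_measurableSet hA hS with h | h
  · exact h h2
  · exact absurd rfl (Set.disjoint_left.1 h h1)

end Atoms

section CondExp

variable {Ω : Type*} [m : MeasurableSpace Ω] {P : Measure Ω} (F : AtomicFiltration P)
variable {n k : ℕ} {A : Set Ω} {ω : Ω}

lemma measureReal_pos [IsFiniteMeasure P] (hA : A ∈ F.atoms n) : 0 < P.real A :=
  ENNReal.toReal_pos (F.measure_atoms_pos n A hA).ne' (measure_ne_top P A)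

variable {X : Type*} [NormedAddCommGroup X] [NormedSpace ℝ X] [CompleteSpace X] {f : Ω → X}

section IsFiniteMeasure

variable [IsFiniteMeasure P]

lemma condExp_eq_setAverage (hf : Integrable f P) (hA : A ∈ F.atoms n) (hω : ω ∈ A) :
    (P[f | F.seq n]) ω = ⨍ x in A, f x ∂P := by
  have hconst : ∫ x in A, (P[f | F.seq n]) x ∂P = P.real A • (P[f | F.seq n]) ω := by
    rw [← setIntegral_const]
    exact setIntegral_congr_fun (F.measurableSet_of_mem_atoms hA) fun _ hx =>
      F.eq_of_stronglyMeasurable stronglyMeasurable_condExp hA hω hx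
  rw [setAverage_eq, ← setIntegral_condExp (F.le' n) hf (F.measurableSet_seq_of_mem_atoms hA),
    hconst, inv_smul_smul₀ (F.measureReal_pos hA).ne']

lemma condExp_eq_const (hf : Integrable f P) (hA : A ∈ F.atoms n) (hω : ω ∈ A) {x : X}
    (h : ∀ ω ∈ A, f ω = x) : (P[f | F.seq n]) ω = x := by
  rw [F.condExp_eq_setAverage hf hA hω, setAverage_eq,
    setIntegral_congr_fun (F.measurableSet_of_mem_atoms hA) h, setIntegral_const,
    inv_smul_smul₀ (F.measureReal_pos hA).ne']

lemma condExp_eq_zero (hf : Integrable f P) (hA : A ∈ F.atoms n) (hω : ω ∈ A)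
    (h : ∫ x in A, f x ∂P = 0) : (P[f | F.seq n]) ω = 0 := by
  rw [F.condExp_eq_setAverage hf hA hω, setAverage_eq, h, smul_zero]

lemma condExp_add_apply {g : Ω → X} (hf : Integrable f P) (hg : Integrable g P) (n : ℕ) (ω : Ω) :
    (P[f + g | F.seq n]) ω = (P[f | F.seq n]) ω + (P[g | F.seq n]) ω := by
  have hA := F.atomAt_mem n ω
  have hω := F.mem_atomAt n ω
  rw [F.condExp_eq_setAverage hf hA hω, F.condExp_eq_setAverage hg hA hω,
    F.condExp_eq_setAverage (hf.add hg) hA hω]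
  simp only [setAverage_eq, Pi.add_apply]
  rw [integral_add hf.integrableOn hg.integrableOn, smul_add]

lemma setAverage_condExp (hf : Integrable f P) (hA : A ∈ F.atoms n) (hkn : n ≤ k) :
    ⨍ x in A, (P[f | F.seq k]) x ∂P = ⨍ x in A, f x ∂P := by
  rw [setAverage_eq, setAverage_eq, setIntegral_condExp (F.le' k) hf
    (F.mono' hkn A (F.measurableSet_seq_of_mem_atoms hA))]

end IsFiniteMeasure

lemma condExp_zero_eq [IsProbabilityMeasure P] (hf : Integrable f P) (ω : Ω) :
    (P[f | F.seq 0]) ω = ∫ x, f x ∂P := by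
  rw [F.condExp_eq_setAverage hf F.univ_mem_atoms_zero (Set.mem_univ ω), setAverage_eq]
  simp

end CondExp

section Potential

variable {Ω : Type*} [m : MeasurableSpace Ω] {P : Measure Ω} (F : AtomicFiltration P)
  {X : Type*} [NormedAddCommGroup X] [NormedSpace ℝ X] [CompleteSpace X] {p : ℝ}

/-- The `p`-energy of a function: the sum of the `p`-th moments of its martingale differences. -/
noncomputable def energy (p : ℝ) (f : Ω → X) : ℝ≥0∞ :=
  ∑' n : ℕ, ∫⁻ ω, ‖(P[f | F.seq (n + 1)]) ω - (P[f | F.seq n]) ω‖ₑ ^ p ∂P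

lemma upperEstimate_iff (hp : 0 < p) (C : ℝ≥0) : F.UpperEstimate p X C ↔
    ∀ f : Ω → X, MemLp f (ENNReal.ofReal p) P →
      ∫⁻ ω, ‖f ω‖ₑ ^ p ∂P ≤ (C : ℝ≥0∞) ^ p * (‖∫ ω, f ω ∂P‖ₑ ^ p + F.energy p f) := by
  refine forall₂_congr fun f _ => ?_
  simp only [eLpNorm_ofReal_rpow_eq_lintegral hp, Pi.sub_apply]
  rw [← eLpNorm_ofReal_rpow_eq_lintegral hp f, ← ENNReal.rpow_le_rpow_iff hp,
    ENNReal.mul_rpow_of_nonneg _ _ hp.le, one_div, ENNReal.rpow_inv_rpow hp.ne']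
  rfl

/-- A potential for the upper `ℓ^p` estimate: a function `W n A x` of atoms `A` of level `n` and
vectors `x` that dominates `‖x‖ ^ p`, is controlled by it at the root, and grows along one step of a
martingale by at most `K` times the `p`-th moment of the increment. -/
structure IsPotential (p : ℝ) (K : ℝ≥0) (W : ℕ → Set Ω → X → ℝ≥0∞) : Prop where
  enorm_rpow_le : ∀ n, ∀ A ∈ F.atoms n, ∀ x, ‖x‖ₑ ^ p ≤ W n A x
  root_le : ∀ x, W 0 Set.univ x ≤ K * ‖x‖ₑ ^ p
  step_le : ∀ n, ∀ A ∈ F.atoms n, ∀ g : Ω → X, MemLp g (ENNReal.ofReal p) P →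
    StronglyMeasurable[F.seq (n + 1)] g →
    ∫⁻ ω in A, W (n + 1) (F.atomAt (n + 1) ω) (g ω) ∂P ≤
      P A * W n A (⨍ ω in A, g ω ∂P) + K * ∫⁻ ω in A, ‖g ω - ⨍ ω in A, g ω ∂P‖ₑ ^ p ∂P

namespace IsPotential

variable {F} {K : ℝ≥0} {W : ℕ → Set Ω → X → ℝ≥0∞} {f : Ω → X}

lemma lintegral_condExp_succ_le [IsFiniteMeasure P] (hW : F.IsPotential p K W) (hp : 1 ≤ p)
    (hf : MemLp f (ENNReal.ofReal p) P) (n : ℕ) :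
    ∫⁻ ω, W (n + 1) (F.atomAt (n + 1) ω) ((P[f | F.seq (n + 1)]) ω) ∂P ≤
      ∫⁻ ω, W n (F.atomAt n ω) ((P[f | F.seq n]) ω) ∂P +
        K * ∫⁻ ω, ‖(P[f | F.seq (n + 1)]) ω - (P[f | F.seq n]) ω‖ₑ ^ p ∂P := by
  have hp' : 1 ≤ ENNReal.ofReal p := by simpa using hp
  have hfi : Integrable f P := hf.integrable hp'
  rw [F.lintegral_eq_tsum_atoms n, F.lintegral_eq_tsum_atoms n, F.lintegral_eq_tsum_atoms n,
    ← ENNReal.tsum_mul_left, ← ENNReal.tsum_add]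
  refine ENNReal.tsum_le_tsum fun A => ?_
  have hA := F.measurableSet_of_mem_atoms A.2
  have hav := F.setAverage_condExp hfi A.2 n.le_succ
  have hmemLp : MemLp (P[f | F.seq (n + 1)]) (ENNReal.ofReal p) P :=
    ⟨integrable_condExp.aestronglyMeasurable,
      (eLpNorm_condExp_le_eLpNorm f hp').trans_lt hf.2⟩
  have hpotential : ∫⁻ ω in A, W n (F.atomAt n ω) ((P[f | F.seq n]) ω) ∂P =
      P A * W n A (⨍ ω in A, f ω ∂P) := by
    rw [mul_comm, ← setLIntegral_const]
    exact setLIntegral_congr_fun hA fun ω hω => by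
      simp only [F.atomAt_eq A.2 hω, F.condExp_eq_setAverage hfi A.2 hω]
  have hincrement : ∫⁻ ω in A, ‖(P[f | F.seq (n + 1)]) ω - (P[f | F.seq n]) ω‖ₑ ^ p ∂P =
      ∫⁻ ω in A, ‖(P[f | F.seq (n + 1)]) ω - ⨍ ω in A, f ω ∂P‖ₑ ^ p ∂P :=
    setLIntegral_congr_fun hA fun ω hω => by simp only [F.condExp_eq_setAverage hfi A.2 hω]
  rw [hpotential, hincrement, ← hav]
  exact hW.step_le n A A.2 _ hmemLp stronglyMeasurable_condExp

lemma lintegral_condExp_le [IsProbabilityMeasure P] (hW : F.IsPotential p K W) (hp : 1 ≤ p)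
    (hf : MemLp f (ENNReal.ofReal p) P) (n : ℕ) :
    ∫⁻ ω, W n (F.atomAt n ω) ((P[f | F.seq n]) ω) ∂P ≤
      K * (‖∫ ω, f ω ∂P‖ₑ ^ p + ∑ i ∈ Finset.range n,
        ∫⁻ ω, ‖(P[f | F.seq (i + 1)]) ω - (P[f | F.seq i]) ω‖ₑ ^ p ∂P) := by
  induction n with
  | zero =>
    have hroot : ∀ ω, W 0 (F.atomAt 0 ω) ((P[f | F.seq 0]) ω) = W 0 Set.univ (∫ ω, f ω ∂P) :=
      fun ω => by
        rw [F.condExp_zero_eq (hf.integrable (by simpa using hp)),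
          F.atomAt_eq F.univ_mem_atoms_zero (Set.mem_univ ω)]
    simpa [hroot] using hW.root_le (∫ ω, f ω ∂P)
  | succ n ih =>
    rw [Finset.sum_range_succ, ← add_assoc, mul_add]
    exact (hW.lintegral_condExp_succ_le hp hf n).trans (add_le_add_left ih _)

theorem upperEstimate [IsProbabilityMeasure P] (hW : F.IsPotential p K W) (hp : 1 ≤ p) :
    F.UpperEstimate p X (K ^ (1 / p)) := by
  have hp0 : 0 < p := by linarith
  rw [F.upperEstimate_iff hp0]
  intro f hf
  rw [ENNReal.coe_rpow_of_nonneg _ (by positivity), one_div, ENNReal.rpow_inv_rpow hp0.ne']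
  refine lintegral_rpow_le_of_forall_condExp F.iSup_seq (hf.integrable (by simpa using hp))
    fun n => ?_
  calc ∫⁻ ω, ‖(P[f | F.seq n]) ω‖ₑ ^ p ∂P
      ≤ ∫⁻ ω, W n (F.atomAt n ω) ((P[f | F.seq n]) ω) ∂P :=
        lintegral_mono fun ω => hW.enorm_rpow_le n _ (F.atomAt_mem n ω) _
    _ ≤ _ := hW.lintegral_condExp_le hp hf n
    _ ≤ K * (‖∫ ω, f ω ∂P‖ₑ ^ p + F.energy p f) := by
        gcongr
        exact ENNReal.sum_le_tsum _

end IsPotential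

end Potential

end AtomicFiltration

namespace AtomicFiltration

section NonLargest

variable {Ω : Type*} [m : MeasurableSpace Ω] {P : Measure Ω} (F : AtomicFiltration P)
  (star : ℕ → Set Ω → Set Ω)
variable {n k l : ℕ} {A B I J : Set Ω} {ω : Ω}

/-- The members of the collection `nonLargest` that appear at level `k`. -/
def nonLargestAt : ℕ → Set (Set Ω)
  | 0 => {Set.univ}
  | k + 1 => {B | ∃ A ∈ F.atoms k, B ∈ F.children k A ∧ B ≠ star k A}

/-- The union of the members of the collection `nonLargest` that appear at level `k`. -/
def nonLargestUnion (k : ℕ) : Set Ω := ⋃₀ F.nonLargestAt star k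

variable {star}

lemma mem_nonLargest_iff : B ∈ F.nonLargest star ↔ ∃ k, B ∈ F.nonLargestAt star k := by
  constructor
  · rintro (h | ⟨n, h⟩)
    · exact ⟨0, h⟩
    · exact ⟨n + 1, h⟩
  · rintro ⟨_ | n, h⟩
    · exact Or.inl h
    · exact Or.inr ⟨n, h⟩

lemma nonLargestAt_subset : F.nonLargestAt star k ⊆ F.atoms k := by
  rcases k with _ | k
  · exact (F.atoms_zero).ge
  · rintro B ⟨A, _, hB, _⟩
    exact hB.1

lemma inter_nonLargestUnion_of_mem (hI : I ∈ F.nonLargestAt star n) :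
    I ∩ F.nonLargestUnion star n = I :=
  Set.inter_eq_left.2 (Set.subset_sUnion_of_mem hI)

lemma eq_of_mem_children_of_mem_children (hA : A ∈ F.atoms n) (hI : I ∈ F.atoms n)
    (h1 : B ∈ F.children n A) (h2 : B ∈ F.children n I) : A = I := by
  obtain ⟨ω, hω⟩ := F.nonempty_of_mem_atoms h1.1
  exact F.eq_of_mem_of_mem hA hI (h1.2 hω) (h2.2 hω)

lemma mem_nonLargestAt_of_ne (hA : A ∈ F.atoms n) (hB : B ∈ F.children n A) (h : B ≠ star n A) :
    B ∈ F.nonLargestAt star (n + 1) :=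
  ⟨A, hA, hB, h⟩

variable (hstar : F.IsLargestChildSelection star)
include hstar

lemma star_inter_nonLargestUnion (hI : I ∈ F.atoms n) :
    star n I ∩ F.nonLargestUnion star (n + 1) = ∅ := by
  refine Set.eq_empty_of_forall_notMem fun ω hω => ?_
  obtain ⟨hω, J, ⟨A, hA, hJ, hne⟩, hωJ⟩ := hω
  have hs := (hstar n I hI).1
  obtain rfl := F.eq_of_mem_of_mem hs.1 hJ.1 hω hωJ
  exact hne (by rw [F.eq_of_mem_children_of_mem_children hI hA hs hJ])

lemma level_unique (hk : J ∈ F.nonLargestAt star k) (hl : J ∈ F.nonLargestAt star l) : k = l := by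
  wlog hkl : k < l generalizing k l
  · rcases lt_trichotomy k l with h | h | h
    · exact this hk hl h
    · exact h
    · exact (this hl hk h).symm
  obtain _ | l := l
  · omega
  obtain ⟨A, hA, hJ, hne⟩ := hl
  obtain ⟨ω, hω⟩ := F.nonempty_of_mem_atoms hJ.1
  obtain rfl : J = A := hJ.2.antisymm
    (F.subset_of_mem_of_mem (Nat.lt_succ_iff.1 hkl) (F.nonLargestAt_subset hk) hA hω (hJ.2 hω))
  have hs := (hstar l J hA).1
  obtain ⟨ω', hω'⟩ := F.nonempty_of_mem_atoms hs.1
  exact absurd (F.eq_of_mem_of_mem hJ.1 hs.1 (hs.2 hω') hω') hne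

omit hstar

lemma measure_inter_nonLargestUnion (hI : I ∈ F.atoms n) (hnk : n ≤ k) :
    P (I ∩ F.nonLargestUnion star k) =
      ∑' J : {J : Set Ω // J ∈ F.nonLargestAt star k ∧ J ⊆ I}, P J.1 := by
  have h : I ∩ F.nonLargestUnion star k = ⋃ J ∈ {J | J ∈ F.nonLargestAt star k ∧ J ⊆ I}, J := by
    ext ω
    simp only [Set.mem_inter_iff, Set.mem_iUnion, nonLargestUnion, Set.mem_sUnion,
      Set.mem_ofPred_eq, exists_prop]
    constructor
    · rintro ⟨hω, J, hJ, hωJ⟩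
      exact ⟨J, ⟨hJ, F.subset_of_mem_of_mem hnk hI (F.nonLargestAt_subset hJ) hω hωJ⟩, hωJ⟩
    · rintro ⟨J, ⟨hJ, hJI⟩, hωJ⟩
      exact ⟨hJI hωJ, J, hJ, hωJ⟩
  rw [h]
  exact measure_biUnion ((F.countable_atoms k).mono fun _ hJ => F.nonLargestAt_subset hJ.1)
    ((F.pairwiseDisjoint_atoms k).subset fun _ hJ => F.nonLargestAt_subset hJ.1)
    fun J hJ => F.measurableSet_of_mem_atoms (F.nonLargestAt_subset hJ.1)

lemma exists_mem_nonLargestAt_add (hI : I ∈ F.nonLargestAt star n) (hJ : J ∈ F.nonLargest star)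
    (hJI : J ⊆ I) : ∃ k, J ∈ F.nonLargestAt star (n + k) := by
  obtain ⟨k, hk⟩ := F.mem_nonLargest_iff.1 hJ
  rcases le_total n k with h | h
  · exact ⟨k - n, by rwa [Nat.add_sub_cancel' h]⟩
  · have hJatom := F.nonLargestAt_subset hk
    obtain ⟨ω, hω⟩ := F.nonempty_of_mem_atoms hJatom
    obtain rfl : J = I :=
      hJI.antisymm (F.subset_of_mem_of_mem h hJatom (F.nonLargestAt_subset hI) hω (hJI hω))
    exact ⟨0, hI⟩

include hstar

lemma tsum_nonLargest_eq (hI : I ∈ F.nonLargestAt star n) :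
    ∑' J : {J : Set Ω // J ∈ F.nonLargest star ∧ J ⊆ I}, P J.1 =
      ∑' k, P (I ∩ F.nonLargestUnion star (n + k)) := by
  let forget : (Σ k : ℕ, {J : Set Ω // J ∈ F.nonLargestAt star (n + k) ∧ J ⊆ I}) →
      {J : Set Ω // J ∈ F.nonLargest star ∧ J ⊆ I} :=
    fun J => ⟨J.2.1, F.mem_nonLargest_iff.2 ⟨_, J.2.2.1⟩, J.2.2.2⟩
  have hforget : forget.Bijective := by
    constructor
    · rintro ⟨k, J, hJ, hJI⟩ ⟨k', J', hJ', hJI'⟩ h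
      obtain rfl : J = J' := congrArg Subtype.val h
      obtain rfl : k = k' := Nat.add_left_cancel (F.level_unique hstar hJ hJ')
      rfl
    · rintro ⟨J, hJ, hJI⟩
      obtain ⟨k, hk⟩ := F.exists_mem_nonLargestAt_add hI hJ hJI
      exact ⟨⟨k, J, hk, hJI⟩, rfl⟩
  rw [← (Equiv.ofBijective forget hforget).tsum_eq, ENNReal.tsum_sigma']
  exact tsum_congr fun k =>
    (F.measure_inter_nonLargestUnion (F.nonLargestAt_subset hI) (Nat.le_add_right n k)).symm

variable [IsFiniteMeasure P]

lemma tsum_le_carlesonConstant_mul (hI : I ∈ F.nonLargestAt star n) :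
    ∑' k, P (I ∩ F.nonLargestUnion star (n + k)) ≤
      carlesonConstant P (F.nonLargest star) * P I := by
  have h0 := (F.measure_atoms_pos n I (F.nonLargestAt_subset hI)).ne'
  rw [← F.tsum_nonLargest_eq hstar hI, mul_comm, ← ENNReal.inv_mul_le_iff h0 (measure_ne_top P I)]
  exact le_iSup₂ (f := fun I (_ : I ∈ F.nonLargest star) => (P I)⁻¹ *
    ∑' J : {J : Set Ω // J ∈ F.nonLargest star ∧ J ⊆ I}, P J.1) I (F.mem_nonLargest_iff.2 ⟨n, hI⟩)

lemma sum_le_carlesonConstant_mul (L : ℕ) (hI : I ∈ F.atoms n) :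
    ∑ k ∈ Finset.range L, P (I ∩ F.nonLargestUnion star (n + 1 + k)) ≤
      carlesonConstant P (F.nonLargest star) * P I := by
  induction L generalizing n I with
  | zero => simp
  | succ L ih =>
    simp only [F.measure_inter_eq_tsum_children hI]
    rw [F.measure_eq_tsum_children hI, ← ENNReal.tsum_mul_left,
      ← Summable.tsum_finsetSum fun _ _ => ENNReal.summable]
    refine ENNReal.tsum_le_tsum fun B => ?_
    by_cases hB : B.1 = star n I
    · rw [Finset.sum_range_succ', add_zero, hB, F.star_inter_nonLargestUnion hstar hI,
        measure_empty, add_zero, ← hB]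
      simpa only [Nat.add_assoc, Nat.add_comm 1] using ih B.2.1
    · exact (ENNReal.sum_le_tsum _).trans
        (F.tsum_le_carlesonConstant_mul hstar (F.mem_nonLargestAt_of_ne hI B.2 hB))

omit hstar [IsFiniteMeasure P]

variable (star) in
/-- The total measure of the members of `nonLargest` that are proper descendants of the atom `I`
of level `n`. -/
noncomputable def descendantMass (n : ℕ) (I : Set Ω) : ℝ≥0∞ :=
  ∑' k, P (I ∩ F.nonLargestUnion star (n + 1 + k))

include hstar

lemma descendantMass_le [IsFiniteMeasure P] (hI : I ∈ F.atoms n) :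
    F.descendantMass star n I ≤ carlesonConstant P (F.nonLargest star) * P I :=
  ENNReal.tsum_le_of_sum_range_le fun L => F.sum_le_carlesonConstant_mul hstar L hI

lemma measure_inter_nonLargestUnion_succ (hI : I ∈ F.atoms n) :
    P (I ∩ F.nonLargestUnion star (n + 1)) = P (I \ star n I) := by
  congr 1
  ext ω
  constructor
  · rintro ⟨h1, h2⟩
    refine ⟨h1, fun h => ?_⟩
    exact (F.star_inter_nonLargestUnion hstar hI).le ⟨h, h2⟩
  · rintro ⟨h1, h2⟩
    refine ⟨h1, F.atomAt (n + 1) ω, F.mem_nonLargestAt_of_ne hI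
      (F.atomAt_succ_mem_children hI h1) fun h => h2 ?_, F.mem_atomAt _ _⟩
    rw [← h]
    exact F.mem_atomAt _ _

lemma descendantMass_eq (hI : I ∈ F.atoms n) : F.descendantMass star n I =
    P (I \ star n I) + ∑' B : F.children n I, F.descendantMass star (n + 1) B.1 := by
  rw [descendantMass, tsum_eq_zero_add' ENNReal.summable, add_zero,
    F.measure_inter_nonLargestUnion_succ hstar hI]
  congr 1
  simp only [F.measure_inter_eq_tsum_children hI, descendantMass]
  rw [ENNReal.tsum_comm]
  simp only [Nat.add_assoc, Nat.add_comm 1]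

end NonLargest

end AtomicFiltration

section OneStep

variable {Ω : Type*} [MeasurableSpace Ω] {μ : Measure Ω} {X : Type*} [NormedAddCommGroup X]
  {p : ℝ} {c : ℝ≥0} {A S : Set Ω} {g : Ω → X} {z : X} {w : Ω → ℝ≥0∞}

lemma setLIntegral_mul_enorm_rpow_le (hp1 : 1 ≤ p) (hp2 : p ≤ 2) (hc : 0 < c) (hc1 : c ≤ 1)
    (hg : AEStronglyMeasurable g μ) (hw : ∀ ω, w ω ≤ 2) (T : Set Ω) (x : X) :
    ∫⁻ ω in T, w ω * ‖g ω‖ₑ ^ p ∂μ ≤ (∫⁻ ω in T, w ω ∂μ) * ‖x‖ₑ ^ p +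
      (2 * c * μ T * ‖x‖ₑ ^ p + 4 * (c⁻¹ : ℝ≥0) * ∫⁻ ω in T, ‖g ω - x‖ₑ ^ p ∂μ) := by
  have hx : ‖x‖ₑ ^ p ≠ ∞ := ENNReal.rpow_ne_top_of_nonneg (by linarith) enorm_ne_top
  have hmeas : AEMeasurable (fun ω => ‖g ω - x‖ₑ ^ p) (μ.restrict T) :=
    ((hg.sub aestronglyMeasurable_const).enorm.pow_const p).restrict
  have hmeas' : AEMeasurable (fun ω => 2 * c * ‖x‖ₑ ^ p + 4 * (c⁻¹ : ℝ≥0) * ‖g ω - x‖ₑ ^ p)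
      (μ.restrict T) := aemeasurable_const.add (hmeas.const_mul _)
  have hpoint : ∀ ω, w ω * ‖g ω‖ₑ ^ p ≤ w ω * ‖x‖ₑ ^ p +
      (2 * c * ‖x‖ₑ ^ p + 4 * (c⁻¹ : ℝ≥0) * ‖g ω - x‖ₑ ^ p) := fun ω =>
    calc w ω * ‖g ω‖ₑ ^ p
        ≤ w ω * ((1 + c) * ‖x‖ₑ ^ p + 2 * (c⁻¹ : ℝ≥0) * ‖g ω - x‖ₑ ^ p) := by
          gcongr
          simpa using enorm_add_rpow_le hp1 hp2 hc hc1 x (g ω - x)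
      _ = w ω * ‖x‖ₑ ^ p + w ω * (c * ‖x‖ₑ ^ p + 2 * (c⁻¹ : ℝ≥0) * ‖g ω - x‖ₑ ^ p) := by ring
      _ ≤ w ω * ‖x‖ₑ ^ p + 2 * (c * ‖x‖ₑ ^ p + 2 * (c⁻¹ : ℝ≥0) * ‖g ω - x‖ₑ ^ p) := by
          gcongr
          exact hw ω
      _ = _ := by ring
  calc ∫⁻ ω in T, w ω * ‖g ω‖ₑ ^ p ∂μ
      ≤ ∫⁻ ω in T, (w ω * ‖x‖ₑ ^ p +
          (2 * c * ‖x‖ₑ ^ p + 4 * (c⁻¹ : ℝ≥0) * ‖g ω - x‖ₑ ^ p)) ∂μ := lintegral_mono hpoint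
    _ = _ := by
        rw [lintegral_add_right' _ hmeas', lintegral_mul_const' _ _ hx,
          lintegral_add_left measurable_const,
          lintegral_const_mul'' _ hmeas, setLIntegral_const, mul_right_comm]

variable [NormedSpace ℝ X] [CompleteSpace X] [IsFiniteMeasure μ]

-- The deviation from the average has mean zero on `A`: its integrals over `S` and `A \ S` cancel.
lemma measure_mul_enorm_sub_setAverage_le (hS : MeasurableSet S) (hSA : S ⊆ A)
    (hg : Integrable g μ) (hz : ∀ ω ∈ S, g ω = z) :
    μ S * ‖z - ⨍ ω in A, g ω ∂μ‖ₑ ≤ ∫⁻ ω in A \ S, ‖g ω - ⨍ ω in A, g ω ∂μ‖ₑ ∂μ := by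
  set x := ⨍ ω in A, g ω ∂μ
  have hdev : Integrable (fun ω => g ω - x) μ := hg.sub (integrable_const x)
  have hS_eq : ∫ ω in S, (g ω - x) ∂μ = μ.real S • (z - x) := by
    rw [← setIntegral_const]
    exact setIntegral_congr_fun hS fun ω hω => by simp only [hz ω hω]
  have hcancel : ∫ ω in A \ S, (g ω - x) ∂μ = -(μ.real S • (z - x)) := by
    rw [setIntegral_sdiff hS hdev.integrableOn hSA, integral_sub_average, hS_eq, zero_sub]
  calc μ S * ‖z - x‖ₑ = ‖∫ ω in A \ S, (g ω - x) ∂μ‖ₑ := by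
        rw [hcancel, enorm_neg, enorm_smul, Real.enorm_eq_ofReal measureReal_nonneg,
          ofReal_measureReal]
    _ ≤ _ := enorm_integral_le_lintegral_enorm _

lemma measure_mul_enorm_rpow_le (hp1 : 1 < p) (hp2 : p ≤ 2) (hc : 0 < c) (hc1 : c ≤ 1)
    (hS : MeasurableSet S) (hSA : S ⊆ A) (hS0 : μ S ≠ 0) (hg : Integrable g μ)
    (hz : ∀ ω ∈ S, g ω = z) :
    μ S * ‖z‖ₑ ^ p ≤ (μ S + c * μ (A \ S)) * ‖⨍ ω in A, g ω ∂μ‖ₑ ^ p +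
      2 * (c⁻¹ : ℝ≥0) * ∫⁻ ω in A, ‖g ω - ⨍ ω in A, g ω ∂μ‖ₑ ^ p ∂μ := by
  have hp0 : 0 ≤ p := by linarith
  have hp1' : 0 ≤ p - 1 := by linarith
  have hmean := measure_mul_enorm_sub_setAverage_le hS hSA hg hz
  set x := ⨍ ω in A, g ω ∂μ
  set D := ∫⁻ ω in A, ‖g ω - x‖ₑ ^ p ∂μ
  have hc' : (2 * (c⁻¹ : ℝ≥0) : ℝ≥0∞) ≠ 0 :=
    mul_ne_zero two_ne_zero (ENNReal.coe_ne_zero.2 (inv_pos.2 hc).ne')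
  rcases eq_or_ne D ∞ with hDtop | hDtop
  · simp [hDtop, ENNReal.mul_top hc']
  have h₁ : (μ S * ‖z - x‖ₑ) ^ p ≤ D * μ (A \ S) ^ (p - 1) :=
    calc (μ S * ‖z - x‖ₑ) ^ p ≤ (∫⁻ ω in A \ S, ‖g ω - x‖ₑ ∂μ) ^ p := by gcongr
      _ ≤ (∫⁻ ω in A \ S, ‖g ω - x‖ₑ ^ p ∂μ) * μ (A \ S) ^ (p - 1) := by
          simpa using lintegral_rpow_le_lintegral_rpow_mul_measure_univ hp1.le
            (hg.sub (integrable_const x)).aestronglyMeasurable.restrict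
      _ ≤ _ := by
          gcongr
          exact lintegral_mono_set Set.sdiff_subset
  have h₂ : μ S * ‖z - x‖ₑ ^ p ≤ D :=
    calc μ S * ‖z - x‖ₑ ^ p = ∫⁻ ω in S, ‖g ω - x‖ₑ ^ p ∂μ := by
          rw [mul_comm, ← setLIntegral_const]
          exact setLIntegral_congr_fun hS fun ω hω => by simp only [hz ω hω]
      _ ≤ D := lintegral_mono_set hSA
  have hz_le : ‖z‖ₑ ≤ ‖x‖ₑ + ‖z - x‖ₑ := by simpa using enorm_add_le x (z - x)
  refine (by gcongr : μ S * ‖z‖ₑ ^ p ≤ μ S * (‖x‖ₑ + ‖z - x‖ₑ) ^ p).trans ?_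
  clear_value D
  lift D to ℝ≥0 using hDtop
  lift μ S to ℝ≥0 using measure_ne_top μ S with a
  lift μ (A \ S) to ℝ≥0 using measure_ne_top μ (A \ S) with b
  simp only [enorm_eq_nnnorm, ← ENNReal.coe_add, ← ENNReal.coe_mul,
    ← ENNReal.coe_rpow_of_nonneg _ hp0, ← ENNReal.coe_rpow_of_nonneg _ hp1', ENNReal.coe_le_coe]
    at h₁ h₂ ⊢
  exact_mod_cast mul_add_rpow_le_of_mul_rpow_le hp1 hp2 hc hc1
    (pos_iff_ne_zero.2 (by exact_mod_cast hS0)) h₁ h₂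

lemma setLIntegral_mul_enorm_rpow_le_setAverage (hp1 : 1 < p) (hp2 : p ≤ 2) (hc : 0 < c)
    (hc1 : c ≤ 1) (hS : MeasurableSet S) (hSA : S ⊆ A) (hS0 : μ S ≠ 0) (hg : Integrable g μ)
    (hz : ∀ ω ∈ S, g ω = z) (hw : ∀ ω, w ω ≤ 2) {v : ℝ≥0∞} (hwS : ∀ ω ∈ S, w ω = v) :
    ∫⁻ ω in A, w ω * ‖g ω‖ₑ ^ p ∂μ ≤
      (∫⁻ ω in A, w ω ∂μ + 4 * c * μ (A \ S)) * ‖⨍ ω in A, g ω ∂μ‖ₑ ^ p +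
        8 * (c⁻¹ : ℝ≥0) * ∫⁻ ω in A, ‖g ω - ⨍ ω in A, g ω ∂μ‖ₑ ^ p ∂μ := by
  have hlargest := measure_mul_enorm_rpow_le hp1 hp2 hc hc1 hS hSA hS0 hg hz
  have hrest := setLIntegral_mul_enorm_rpow_le hp1.le hp2 hc hc1 hg.aestronglyMeasurable hw (A \ S)
    (⨍ ω in A, g ω ∂μ)
  set x := ⨍ ω in A, g ω ∂μ
  set D := ∫⁻ ω in A, ‖g ω - x‖ₑ ^ p ∂μ
  have hsplit : ∀ h : Ω → ℝ≥0∞, ∫⁻ ω in A, h ω ∂μ =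
      ∫⁻ ω in S, h ω ∂μ + ∫⁻ ω in A \ S, h ω ∂μ := fun h => by
    rw [← lintegral_inter_add_sdiff h A hS, Set.inter_eq_right.2 hSA]
  have hwS_int : ∫⁻ ω in S, w ω ∂μ = v * μ S := by
    rw [setLIntegral_congr_fun hS hwS, setLIntegral_const]
  have hwS_le : v * (c * μ (A \ S) * ‖x‖ₑ ^ p + 2 * (c⁻¹ : ℝ≥0) * D) ≤
      2 * (c * μ (A \ S) * ‖x‖ₑ ^ p + 2 * (c⁻¹ : ℝ≥0) * D) := by
    obtain ⟨ω₀, hω₀⟩ := nonempty_of_measure_ne_zero hS0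
    gcongr
    exact hwS ω₀ hω₀ ▸ hw ω₀
  calc ∫⁻ ω in A, w ω * ‖g ω‖ₑ ^ p ∂μ
      = v * (μ S * ‖z‖ₑ ^ p) + ∫⁻ ω in A \ S, w ω * ‖g ω‖ₑ ^ p ∂μ := by
        rw [hsplit, setLIntegral_congr_fun (g := fun _ => v * ‖z‖ₑ ^ p) hS
          fun ω hω => by simp only [hwS ω hω, hz ω hω], setLIntegral_const, mul_assoc,
          mul_comm (‖z‖ₑ ^ p)]
    _ ≤ v * ((μ S + c * μ (A \ S)) * ‖x‖ₑ ^ p + 2 * (c⁻¹ : ℝ≥0) * D) +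
        ((∫⁻ ω in A \ S, w ω ∂μ) * ‖x‖ₑ ^ p +
          (2 * c * μ (A \ S) * ‖x‖ₑ ^ p + 4 * (c⁻¹ : ℝ≥0) * D)) := by
        gcongr
        refine hrest.trans ?_
        gcongr
        exact lintegral_mono_set Set.sdiff_subset
    _ = v * (c * μ (A \ S) * ‖x‖ₑ ^ p + 2 * (c⁻¹ : ℝ≥0) * D) +
        ((∫⁻ ω in A, w ω ∂μ) * ‖x‖ₑ ^ p +
          (2 * c * μ (A \ S) * ‖x‖ₑ ^ p + 4 * (c⁻¹ : ℝ≥0) * D)) := by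
        rw [hsplit w, hwS_int]
        ring
    _ ≤ _ := by
        refine (add_le_add_left hwS_le _).trans_eq ?_
        ring

end OneStep

namespace AtomicFiltration

section Weight

variable {Ω : Type*} [m : MeasurableSpace Ω] {P : Measure Ω} (F : AtomicFiltration P)
  {star : ℕ → Set Ω → Set Ω} {n : ℕ} {A : Set Ω}

variable (star) in
/-- The weight of an atom: an affine function of its relative mass of nonlargest descendants. It is
the density of the potential by which a finite Carleson constant yields the upper estimate. -/
noncomputable def weight (c : ℝ≥0) (n : ℕ) (A : Set Ω) : ℝ≥0∞ :=
  1 + 4 * c * ((P A)⁻¹ * F.descendantMass star n A)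

variable [IsFiniteMeasure P]

lemma measure_mul_weight (c : ℝ≥0) (hA : A ∈ F.atoms n) :
    P A * F.weight star c n A = P A + 4 * c * F.descendantMass star n A := by
  rw [weight, mul_add, mul_one, mul_left_comm, ← mul_assoc (P A),
    ENNReal.mul_inv_cancel (F.measure_atoms_pos n A hA).ne' (measure_ne_top P A), one_mul]

variable (hstar : F.IsLargestChildSelection star)
include hstar

lemma weight_le_two {c : ℝ≥0} (hc : 4 * c * carlesonConstant P (F.nonLargest star) ≤ 1)
    (hA : A ∈ F.atoms n) : F.weight star c n A ≤ 2 := by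
  rw [weight, ← one_add_one_eq_two]
  gcongr
  refine le_trans ?_ hc
  gcongr
  rw [ENNReal.inv_mul_le_iff (F.measure_atoms_pos n A hA).ne' (measure_ne_top P A), mul_comm]
  exact F.descendantMass_le hstar hA

lemma setLIntegral_weight (c : ℝ≥0) (hA : A ∈ F.atoms n) :
    (∫⁻ ω in A, F.weight star c (n + 1) (F.atomAt (n + 1) ω) ∂P) + 4 * c * P (A \ star n A) =
      P A * F.weight star c n A := by
  have hchild : ∀ B : F.children n A,
      ∫⁻ ω in B.1, F.weight star c (n + 1) (F.atomAt (n + 1) ω) ∂P =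
        P B.1 + 4 * c * F.descendantMass star (n + 1) B.1 := by
    intro B
    rw [← F.measure_mul_weight c B.2.1, mul_comm, ← setLIntegral_const]
    exact setLIntegral_congr_fun (F.measurableSet_of_mem_atoms B.2.1) fun ω hω => by
      simp only [F.atomAt_eq B.2.1 hω]
  rw [F.setLIntegral_eq_tsum_children hA, F.measure_mul_weight c hA, F.descendantMass_eq hstar hA,
    tsum_congr hchild, ENNReal.tsum_add, ENNReal.tsum_mul_left, ← F.measure_eq_tsum_children hA]
  ring

theorem isPotential_weight {X : Type*} [NormedAddCommGroup X] [NormedSpace ℝ X] [CompleteSpace X]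
    {p : ℝ} (hp1 : 1 < p) (hp2 : p ≤ 2) {c : ℝ≥0} (hc0 : 0 < c) (hc1 : c ≤ 1)
    (hc : 4 * c * carlesonConstant P (F.nonLargest star) ≤ 1) :
    F.IsPotential p (8 * c⁻¹) (fun n A (x : X) => F.weight star c n A * ‖x‖ₑ ^ p) where
  enorm_rpow_le _ _ _ _ := le_mul_of_one_le_left' le_self_add
  root_le x := by
    gcongr
    refine (F.weight_le_two hstar hc F.univ_mem_atoms_zero).trans ?_
    norm_cast
    calc (2 : ℝ≥0) ≤ 8 * 1 := by norm_num
      _ ≤ 8 * c⁻¹ := by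
          gcongr
          exact (one_le_inv₀ hc0).2 hc1
  step_le n A hA g hg hgm := by
    have hS := (hstar n A hA).1
    obtain ⟨ω₀, hω₀⟩ := F.nonempty_of_mem_atoms hS.1
    rw [← mul_assoc, ← F.setLIntegral_weight hstar c hA]
    refine (setLIntegral_mul_enorm_rpow_le_setAverage hp1 hp2 hc0 hc1
      (F.measurableSet_of_mem_atoms hS.1) hS.2 (F.measure_atoms_pos _ _ hS.1).ne'
      (hg.integrable (by simpa using hp1.le))
      (fun ω hω => F.eq_of_stronglyMeasurable hgm hS.1 hω₀ hω)
      (fun ω => F.weight_le_two hstar hc (F.atomAt_mem (n + 1) ω))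
      (fun ω hω => by rw [F.atomAt_eq hS.1 hω])).trans_eq ?_
    push_cast
    rfl

end Weight

theorem estimateForAll_of_carlesonConstant_lt_top {Ω : Type*} [MeasurableSpace Ω] {P : Measure Ω}
    [IsProbabilityMeasure P] {F : AtomicFiltration P} {star : ℕ → Set Ω → Set Ω}
    (hstar : F.IsLargestChildSelection star) {p : ℝ} (hp1 : 1 < p) (hp2 : p ≤ 2)
    (hfin : carlesonConstant P (F.nonLargest star) < ∞) : EstimateForAll F p := by
  lift carlesonConstant P (F.nonLargest star) to ℝ≥0 using hfin.ne with Λ hΛ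
  set c : ℝ≥0 := (4 * (Λ + 1))⁻¹ with hc_def
  have hc0 : 0 < c := by positivity
  have hc1 : c ≤ 1 := inv_le_one_of_one_le₀ <|
    calc (1 : ℝ≥0) ≤ 4 * 1 := by norm_num
      _ ≤ 4 * (Λ + 1) := by gcongr; exact le_add_self
  have hc : 4 * c * carlesonConstant P (F.nonLargest star) ≤ 1 := by
    rw [← hΛ]
    norm_cast
    calc 4 * c * Λ ≤ 4 * c * (Λ + 1) := by gcongr; exact le_self_add
      _ = 1 := by rw [hc_def]; field_simp
  exact ⟨(8 * c⁻¹) ^ (1 / p), by positivity, fun X _ _ _ =>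
    (F.isPotential_weight hstar hp1 hp2 hc0 hc1 hc).upperEstimate hp1.le⟩

end AtomicFiltration

namespace AtomicFiltration

section Exits

variable {Ω : Type*} [m : MeasurableSpace Ω] {P : Measure Ω} (F : AtomicFiltration P)
  (star : ℕ → Set Ω → Set Ω)

/-- The exits of an atom `A` of level `n`, as pairs of a level and an atom of that level: the
nonlargest children of the members of the chain `A`, `A*`, `A**`, ... of selected children. -/
inductive IsExit : ℕ → Set Ω → ℕ × Set Ω → Prop
  | child {n : ℕ} {A B : Set Ω} (hB : B ∈ F.children n A) (hne : B ≠ star n A) :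
      IsExit n A (n + 1, B)
  | later {n : ℕ} {A : Set Ω} {e : ℕ × Set Ω} (he : IsExit (n + 1) (star n A) e) : IsExit n A e

/-- The measure of the `i`-th generation of exits of an atom. -/
noncomputable def exitMass : ℕ → ℕ → Set Ω → ℝ≥0∞
  | 0, _, A => P A
  | i + 1, n, A => ∑' e : {e : ℕ × Set Ω // F.IsExit star n A e}, exitMass i e.1.1 e.1.2

/-- An atom is rich of depth `N` if exits that are rich of depth `N - 1` fill it up to the
proportion `θ`. -/
def IsRich (θ : ℝ≥0) : ℕ → ℕ → Set Ω → Prop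
  | 0, _, _ => True
  | N + 1, n, A => ∃ T : Finset (ℕ × Set Ω),
      (∀ e ∈ T, F.IsExit star n A e ∧ IsRich θ N e.1 e.2) ∧ θ * P A ≤ ∑ e ∈ T, P e.2

variable {F star} {n : ℕ} {A B : Set Ω} {e e' : ℕ × Set Ω}

lemma isExit_iff : F.IsExit star n A e ↔
    (∃ B ∈ F.children n A, B ≠ star n A ∧ e = (n + 1, B)) ∨ F.IsExit star (n + 1) (star n A) e := by
  constructor
  · rintro (⟨hB, hne⟩ | he)
    · exact Or.inl ⟨_, hB, hne, rfl⟩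
    · exact Or.inr he
  · rintro (⟨B, hB, hne, rfl⟩ | he)
    · exact .child hB hne
    · exact .later he

lemma IsExit.mem_atoms (he : F.IsExit star n A e) : e.2 ∈ F.atoms e.1 := by
  induction he with
  | child hB _ => exact hB.1
  | later _ ih => exact ih

lemma IsExit.lt_level (he : F.IsExit star n A e) : n < e.1 := by
  induction he with
  | child _ _ => exact Nat.lt_succ_self _
  | later _ ih => exact (Nat.lt_succ_self _).trans ih

lemma exitMass_succ_eq (i n : ℕ) (A : Set Ω) : F.exitMass star (i + 1) n A =
    ∑' B : {B : Set Ω // B ∈ F.children n A ∧ B ≠ star n A}, F.exitMass star i (n + 1) B.1 +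
      F.exitMass star (i + 1) (n + 1) (star n A) := by
  have h : {e | F.IsExit star n A e} =
      (fun B => (n + 1, B)) '' {B | B ∈ F.children n A ∧ B ≠ star n A} ∪
        {e | F.IsExit star (n + 1) (star n A) e} := by
    ext e
    constructor
    · intro he
      rcases isExit_iff.1 he with ⟨B, hB, hne, rfl⟩ | h
      · exact Or.inl ⟨B, ⟨hB, hne⟩, rfl⟩
      · exact Or.inr h
    · rintro (⟨B, ⟨hB, hne⟩, rfl⟩ | h)
      · exact .child hB hne
      · exact .later h
  have hd : Disjoint ((fun B => (n + 1, B)) '' {B | B ∈ F.children n A ∧ B ≠ star n A})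
        {e | F.IsExit star (n + 1) (star n A) e} := by
    rw [Set.disjoint_left]
    rintro _ ⟨B, _, rfl⟩ he
    exact absurd he.lt_level (lt_irrefl _)
  change ∑' e : {e | F.IsExit star n A e}, (fun e : ℕ × Set Ω => F.exitMass star i e.1 e.2) e.1 = _
  rw [h, ENNReal.summable.tsum_union_disjoint
    (f := fun e : ℕ × Set Ω => F.exitMass star i e.1 e.2) hd ENNReal.summable]
  congr 1
  rw [tsum_image (fun e : ℕ × Set Ω => F.exitMass star i e.1 e.2)
    (Function.Injective.injOn fun B C h => (Prod.ext_iff.1 h).2)]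
  rfl

section Star

variable (hstar : F.IsLargestChildSelection star)
include hstar

lemma IsExit.subset (he : F.IsExit star n A e) (hA : A ∈ F.atoms n) : e.2 ⊆ A := by
  induction he with
  | child hB _ => exact hB.2
  | later _ ih =>
    have hs := (hstar _ _ hA).1
    exact (ih hs.1).trans hs.2

lemma IsExit.disjoint_of_ne_star (he : F.IsExit star (n + 1) (star n A) e) (hA : A ∈ F.atoms n)
    (hB : B ∈ F.children n A) (hne : B ≠ star n A) : Disjoint B e.2 :=
  have hs := (hstar n A hA).1
  (F.pairwiseDisjoint_atoms (n + 1) hB.1 hs.1 hne).mono_right (he.subset hstar hs.1)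

lemma IsExit.disjoint (he : F.IsExit star n A e) (he' : F.IsExit star n A e') (hA : A ∈ F.atoms n)
    (hne : e ≠ e') : Disjoint e.2 e'.2 := by
  induction he with
  | @child n A B hB hB' =>
    rcases isExit_iff.1 he' with ⟨C, hC, _, rfl⟩ | h
    · exact F.pairwiseDisjoint_atoms (n + 1) hB.1 hC.1 fun h => hne (by rw [h])
    · exact h.disjoint_of_ne_star hstar hA hB hB'
  | @later n A e he ih =>
    rcases isExit_iff.1 he' with ⟨C, hC, hC', rfl⟩ | h
    · exact (he.disjoint_of_ne_star hstar hA hC hC').symm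
    · exact ih h (hstar n A hA).1.1 hne

lemma tsum_children_eq (hA : A ∈ F.atoms n) (g : Set Ω → ℝ≥0∞) :
    ∑' B : F.children n A, g B.1 =
      ∑' B : {B : Set Ω // B ∈ F.children n A ∧ B ≠ star n A}, g B.1 + g (star n A) := by
  have h : F.children n A = {B | B ∈ F.children n A ∧ B ≠ star n A} ∪ {star n A} := by
    ext B
    constructor
    · intro hB
      by_cases h : B = star n A
      · exact Or.inr h
      · exact Or.inl ⟨hB, h⟩
    · rintro (h | h)
      · exact h.1
      · rw [Set.mem_singleton_iff.1 h]; exact (hstar n A hA).1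
  conv_lhs => rw [h]
  rw [ENNReal.summable.tsum_union_disjoint (f := g)
    (Set.disjoint_singleton_right.2 fun h => h.2 rfl) ENNReal.summable, tsum_singleton (star n A) g]
  rfl

lemma tsum_exit_le (hA : A ∈ F.atoms n) :
    ∑' e : {e : ℕ × Set Ω // F.IsExit star n A e}, P e.1.2 ≤ P A := by
  refine (tsum_meas_le_meas_iUnion_of_disjoint P
    (fun e : {e : ℕ × Set Ω // F.IsExit star n A e} =>
      F.measurableSet_of_mem_atoms e.2.mem_atoms)
    fun e e' hne => e.2.disjoint hstar e'.2 hA fun h => hne (Subtype.ext h)).trans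
    (measure_mono (Set.iUnion_subset fun e => e.2.subset hstar hA))

lemma exitMass_le (i : ℕ) (hA : A ∈ F.atoms n) : F.exitMass star i n A ≤ P A := by
  induction i generalizing n A with
  | zero => exact le_rfl
  | succ i ih =>
    exact (ENNReal.tsum_le_tsum fun e => ih e.2.mem_atoms).trans (tsum_exit_le hstar hA)

omit hstar in
open Classical in
lemma tsum_isRich_exit_le {θ : ℝ≥0} {i : ℕ} (hnot : ¬ F.IsRich star θ (i + 1) n A) :
    ∑' e : {e : ℕ × Set Ω // F.IsExit star n A e},
      (if F.IsRich star θ i e.1.1 e.1.2 then P e.1.2 else 0) ≤ θ * P A := by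
  rw [ENNReal.tsum_eq_iSup_sum]
  refine iSup_le fun s => ?_
  by_contra hlt
  refine hnot ⟨(s.filter fun e => F.IsRich star θ i e.1.1 e.1.2).map
    (Function.Embedding.subtype _), fun e he => ?_, ?_⟩
  · simp only [Finset.mem_map, Finset.mem_filter] at he
    obtain ⟨e', ⟨_, hrich⟩, rfl⟩ := he
    exact ⟨e'.2, hrich⟩
  · rw [Finset.sum_map, Finset.sum_filter]
    exact (not_le.1 hlt).le

lemma exists_exitMass_le_of_not_isRich {θ : ℝ≥0} (hθ : θ < 1) (i : ℕ) : ∃ η : ℝ≥0, η < 1 ∧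
    ∀ n, ∀ A ∈ F.atoms n, ¬ F.IsRich star θ i n A → F.exitMass star i n A ≤ η * P A := by
  classical
  induction i with
  | zero => exact ⟨0, one_pos, fun n A _ h => absurd trivial h⟩
  | succ i ih =>
    obtain ⟨η, hη, ih⟩ := ih
    refine ⟨η + (1 - η) * θ, ?_, fun n A hA hnot => ?_⟩
    · calc η + (1 - η) * θ < η + (1 - η) * 1 := by
            gcongr
            exact tsub_pos_of_lt hη
        _ = 1 := by rw [mul_one, add_tsub_cancel_of_le hη.le]
    have hone : (η : ℝ≥0∞) + (1 - η : ℝ≥0) = 1 := by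
      norm_cast
      exact add_tsub_cancel_of_le hη.le
    calc F.exitMass star (i + 1) n A
        ≤ ∑' e : {e : ℕ × Set Ω // F.IsExit star n A e}, (η * P e.1.2 + (1 - η : ℝ≥0) *
            (if F.IsRich star θ i e.1.1 e.1.2 then P e.1.2 else 0)) := by
          refine ENNReal.tsum_le_tsum fun e => ?_
          have hmem := e.2.mem_atoms
          split_ifs with he
          · rw [← add_mul, hone, one_mul]
            exact exitMass_le hstar i hmem
          · rw [mul_zero, add_zero]
            exact ih _ _ hmem he
      _ = η * ∑' e : {e : ℕ × Set Ω // F.IsExit star n A e}, P e.1.2 + (1 - η : ℝ≥0) *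
            ∑' e : {e : ℕ × Set Ω // F.IsExit star n A e},
              (if F.IsRich star θ i e.1.1 e.1.2 then P e.1.2 else 0) := by
          rw [ENNReal.tsum_add, ENNReal.tsum_mul_left, ENNReal.tsum_mul_left]
      _ ≤ η * P A + (1 - η : ℝ≥0) * (θ * P A) := by
          gcongr
          · exact tsum_exit_le hstar hA
          · exact tsum_isRich_exit_le hnot
      _ = _ := by push_cast; ring

variable [IsFiniteMeasure P]

lemma measure_add_sum_le_sum_exitMass (L : ℕ) (hA : A ∈ F.atoms n) :
    P A + ∑ k ∈ Finset.range L, P (A ∩ F.nonLargestUnion star (n + 1 + k)) ≤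
      ∑ i ∈ Finset.range (L + 1), F.exitMass star i n A := by
  induction L generalizing n A with
  | zero => simp [exitMass]
  | succ L ih =>
    have hs := (hstar n A hA).1
    have hstep : ∀ B, ∑ k ∈ Finset.range (L + 1), P (B ∩ F.nonLargestUnion star (n + 1 + k)) =
        P (B ∩ F.nonLargestUnion star (n + 1)) +
          ∑ k ∈ Finset.range L, P (B ∩ F.nonLargestUnion star (n + 1 + 1 + k)) := by
      intro B
      rw [Finset.sum_range_succ', add_zero, add_comm]
      simp only [Nat.add_assoc, Nat.add_comm 1]
    rw [Finset.sum_range_succ' _ (L + 1), add_comm]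
    refine add_le_add ?_ le_rfl
    calc ∑ k ∈ Finset.range (L + 1), P (A ∩ F.nonLargestUnion star (n + 1 + k))
        = ∑' B : F.children n A,
            ∑ k ∈ Finset.range (L + 1), P (B.1 ∩ F.nonLargestUnion star (n + 1 + k)) := by
          simp only [F.measure_inter_eq_tsum_children hA]
          rw [Summable.tsum_finsetSum fun _ _ => ENNReal.summable]
      _ = ∑' B : {B : Set Ω // B ∈ F.children n A ∧ B ≠ star n A},
            ∑ k ∈ Finset.range (L + 1), P (B.1 ∩ F.nonLargestUnion star (n + 1 + k)) +
          ∑ k ∈ Finset.range (L + 1), P (star n A ∩ F.nonLargestUnion star (n + 1 + k)) :=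
          tsum_children_eq hstar hA fun B =>
            ∑ k ∈ Finset.range (L + 1), P (B ∩ F.nonLargestUnion star (n + 1 + k))
      _ ≤ ∑' B : {B : Set Ω // B ∈ F.children n A ∧ B ≠ star n A},
            ∑ i ∈ Finset.range (L + 1), F.exitMass star i (n + 1) B.1 +
          ∑ i ∈ Finset.range (L + 1), F.exitMass star (i + 1) (n + 1) (star n A) := by
          refine add_le_add (ENNReal.tsum_le_tsum fun B => ?_) ?_
          · rw [hstep, F.inter_nonLargestUnion_of_mem (F.mem_nonLargestAt_of_ne hA B.2.1 B.2.2)]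
            exact ih B.2.1.1
          · rw [hstep, F.star_inter_nonLargestUnion hstar hA, measure_empty, zero_add,
              Finset.sum_range_succ]
            have h := ih hs.1
            rw [Finset.sum_range_succ', add_comm] at h
            exact (ENNReal.le_of_add_le_add_right (measure_ne_top P (star n A)) h).trans le_self_add
      _ = ∑ i ∈ Finset.range (L + 1), F.exitMass star (i + 1) n A := by
          rw [Summable.tsum_finsetSum fun _ _ => ENNReal.summable, ← Finset.sum_add_distrib]
          exact Finset.sum_congr rfl fun i _ => (exitMass_succ_eq i n A).symm

lemma carlesonConstant_le_of_sum_exitMass_le {K : ℝ≥0∞}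
    (hK : ∀ L n, ∀ A ∈ F.atoms n, ∑ i ∈ Finset.range L, F.exitMass star i n A ≤ K * P A) :
    carlesonConstant P (F.nonLargest star) ≤ K := by
  refine iSup₂_le fun I hI => ?_
  obtain ⟨n, hIn⟩ := F.mem_nonLargest_iff.1 hI
  have hIa := F.nonLargestAt_subset hIn
  rw [ENNReal.inv_mul_le_iff (F.measure_atoms_pos n I hIa).ne' (measure_ne_top P I), mul_comm,
    F.tsum_nonLargest_eq hstar hIn, tsum_eq_zero_add' ENNReal.summable, add_zero,
    F.inter_nonLargestUnion_of_mem hIn, ENNReal.tsum_eq_iSup_nat, ENNReal.add_iSup]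
  refine iSup_le fun L => ?_
  have hL := (measure_add_sum_le_sum_exitMass hstar L hIa).trans (hK (L + 1) n I hIa)
  simpa only [Nat.add_assoc, Nat.add_comm 1] using hL

omit hstar [IsFiniteMeasure P] in
lemma exitMass_add_le {η : ℝ≥0} {N : ℕ}
    (hN : ∀ n, ∀ A ∈ F.atoms n, F.exitMass star N n A ≤ η * P A) (i : ℕ) (hA : A ∈ F.atoms n) :
    F.exitMass star (i + N) n A ≤ η * F.exitMass star i n A := by
  induction i generalizing n A with
  | zero =>
    rw [zero_add]
    exact hN n A hA
  | succ i ih =>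
    rw [Nat.succ_add, exitMass, exitMass, ← ENNReal.tsum_mul_left]
    exact ENNReal.tsum_le_tsum fun e => ih e.2.mem_atoms

lemma sum_exitMass_le {η : ℝ≥0} (hη : η < 1) {N : ℕ}
    (hN : ∀ n, ∀ A ∈ F.atoms n, F.exitMass star N n A ≤ η * P A) (L : ℕ) (hA : A ∈ F.atoms n) :
    ∑ i ∈ Finset.range L, F.exitMass star i n A ≤ (N / (1 - η) : ℝ≥0) * P A := by
  set s := ∑ i ∈ Finset.range L, F.exitMass star i n A with hs
  have hs_top : s ≠ ∞ := ENNReal.sum_ne_top.2 fun i _ =>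
    ((exitMass_le hstar i hA).trans_lt (measure_lt_top P A)).ne
  have hs_le : s ≤ N * P A + η * s := by
    calc s ≤ ∑ i ∈ Finset.range (N + L), F.exitMass star i n A :=
          Finset.sum_le_sum_of_subset (Finset.range_mono (Nat.le_add_left L N))
      _ = ∑ i ∈ Finset.range N, F.exitMass star i n A +
          ∑ i ∈ Finset.range L, F.exitMass star (N + i) n A := Finset.sum_range_add _ _ _
      _ ≤ ∑ _ ∈ Finset.range N, P A + ∑ i ∈ Finset.range L, η * F.exitMass star i n A := by
          refine add_le_add (Finset.sum_le_sum fun _ _ => exitMass_le hstar _ hA)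
            (Finset.sum_le_sum fun i _ => ?_)
          rw [add_comm]
          exact exitMass_add_le hN i hA
      _ = N * P A + η * s := by simp [← Finset.mul_sum, hs]
  lift s to ℝ≥0 using hs_top with s
  lift P A to ℝ≥0 using measure_ne_top P A with a
  norm_cast at hs_le ⊢
  have hη' : 0 < 1 - η := tsub_pos_of_lt hη
  rw [div_mul_eq_mul_div, le_div_iff₀ hη', mul_comm, tsub_mul, one_mul]
  exact tsub_le_iff_right.2 hs_le

theorem exists_isRich (hinf : carlesonConstant P (F.nonLargest star) = ∞) {θ : ℝ≥0} (hθ : θ < 1)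
    (N : ℕ) : ∃ n, ∃ A ∈ F.atoms n, F.IsRich star θ N n A := by
  by_contra! hnot
  obtain ⟨η, hη, hN⟩ := exists_exitMass_le_of_not_isRich (F := F) hstar hθ N
  have hle := carlesonConstant_le_of_sum_exitMass_le hstar fun L n A hA =>
    sum_exitMass_le hstar hη (fun n A hA => hN n A hA (hnot n A hA)) L hA
  exact ENNReal.coe_ne_top (top_le_iff.1 (hinf.ge.trans hle))

end Star

end Exits

end AtomicFiltration

lemma exists_subset_le_sum_le_two_mul {ι : Type*} (s : Finset ι) (f : ι → ℝ≥0∞) (a : ℝ≥0∞)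
    (hf : ∀ i ∈ s, f i ≤ a) (hs : a ≤ ∑ i ∈ s, f i) :
    ∃ t ⊆ s, a ≤ ∑ i ∈ t, f i ∧ ∑ i ∈ t, f i ≤ 2 * a := by
  classical
  induction s using Finset.induction_on with
  | empty => exact ⟨∅, subset_rfl, hs, by simp⟩
  | insert i s hi ih =>
    by_cases h : a ≤ ∑ i ∈ s, f i
    · obtain ⟨t, ht, h1⟩ := ih (fun j hj => hf j (Finset.mem_insert_of_mem hj)) h
      exact ⟨t, ht.trans (Finset.subset_insert i s), h1⟩
    · refine ⟨insert i s, subset_rfl, hs, ?_⟩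
      rw [Finset.sum_insert hi, two_mul]
      exact add_le_add (hf i (Finset.mem_insert_self i s)) (not_le.1 h).le

namespace AtomicFiltration

section Energy

variable {Ω : Type*} [m : MeasurableSpace Ω] {P : Measure Ω} [IsFiniteMeasure P]
  (F : AtomicFiltration P) {X : Type*} [NormedAddCommGroup X] [NormedSpace ℝ X] [CompleteSpace X]
variable {n k l : ℕ} {A J : Set Ω} {ω : Ω} {f s : Ω → X} {p : ℝ}

lemma condExp_eq_zero_of_level_le (hJ : J ∈ F.atoms l) (hf : Integrable f P)
    (hsupp : ∀ ω ∉ J, f ω = 0) (h0 : ∫ ω, f ω ∂P = 0) (hkl : k ≤ l) (ω : Ω) :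
    (P[f | F.seq k]) ω = 0 := by
  refine F.condExp_eq_zero hf (F.atomAt_mem k ω) (F.mem_atomAt k ω) ?_
  rcases F.subset_or_disjoint hkl (F.atomAt_mem k ω) hJ with h | h
  · rw [setIntegral_eq_integral_of_forall_compl_eq_zero fun x hx => hsupp x fun hxJ => hx (h hxJ)]
    exact h0
  · refine setIntegral_eq_zero_of_forall_eq_zero fun x hx => hsupp x fun hxJ => ?_
    exact Set.disjoint_left.1 h hxJ hx

lemma condExp_eq_zero_of_notMem (hJ : J ∈ F.atoms l) (hf : Integrable f P)
    (hsupp : ∀ ω ∉ J, f ω = 0) (hlk : l ≤ k) (hω : ω ∉ J) : (P[f | F.seq k]) ω = 0 := by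
  refine F.condExp_eq_const hf (F.atomAt_mem k ω) (F.mem_atomAt k ω) fun x hx =>
    hsupp x fun hxJ => ?_
  exact hω (F.subset_of_mem_of_mem hlk hJ (F.atomAt_mem k ω) hxJ hx (F.mem_atomAt k ω))

-- From level `l` on only `f` moves inside `J`; before level `l` and outside `J` only `s` moves.
lemma energy_add_le (hJ : J ∈ F.atoms l) (hs : Integrable s P) {z : X}
    (hsJ : ∀ ω ∈ J, s ω = z) (hf : Integrable f P) (hsupp : ∀ ω ∉ J, f ω = 0)
    (h0 : ∫ ω, f ω ∂P = 0) : F.energy p (s + f) ≤ F.energy p s + F.energy p f := by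
  rw [energy, energy, energy, ← ENNReal.tsum_add]
  refine ENNReal.tsum_le_tsum fun k => ?_
  have hmeas : Measurable fun ω => ‖(P[s | F.seq (k + 1)]) ω - (P[s | F.seq k]) ω‖ₑ ^ p :=
    (((stronglyMeasurable_condExp.mono (F.le' _)).sub
      (stronglyMeasurable_condExp.mono (F.le' _))).enorm).pow_const p
  rw [← lintegral_add_left hmeas]
  refine lintegral_mono fun ω => ?_
  simp only [F.condExp_add_apply hs hf]
  by_cases h : l ≤ k ∧ ω ∈ J
  · have hconst : ∀ j, l ≤ j → (P[s | F.seq j]) ω = z := fun j hj =>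
      F.condExp_eq_const hs (F.atomAt_mem j ω) (F.mem_atomAt j ω) fun x hx => hsJ x
        (F.subset_of_mem_of_mem hj hJ (F.atomAt_mem j ω) h.2 (F.mem_atomAt j ω) hx)
    rw [hconst k h.1, hconst (k + 1) (h.1.trans k.le_succ), add_sub_add_left_eq_sub]
    exact le_add_self
  · have hzero : (P[f | F.seq k]) ω = 0 ∧ (P[f | F.seq (k + 1)]) ω = 0 := by
      rcases lt_or_ge k l with hk | hk
      · exact ⟨F.condExp_eq_zero_of_level_le hJ hf hsupp h0 hk.le ω,
          F.condExp_eq_zero_of_level_le hJ hf hsupp h0 hk ω⟩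
      · have hω : ω ∉ J := fun hω => h ⟨hk, hω⟩
        exact ⟨F.condExp_eq_zero_of_notMem hJ hf hsupp hk hω,
          F.condExp_eq_zero_of_notMem hJ hf hsupp (hk.trans k.le_succ) hω⟩
    rw [hzero.1, hzero.2, add_zero, add_zero]
    exact le_self_add

lemma energy_add_sum_le (T : Finset (ℕ × Set Ω)) (f : ℕ × Set Ω → Ω → X)
    (hT : ∀ e ∈ T, e.2 ∈ F.atoms e.1) (hd : (T : Set (ℕ × Set Ω)).PairwiseDisjoint Prod.snd)
    (hs : Integrable s P) (hsT : ∀ e ∈ T, ∃ z, ∀ ω ∈ e.2, s ω = z)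
    (hf : ∀ e ∈ T, Integrable (f e) P) (hsupp : ∀ e ∈ T, ∀ ω ∉ e.2, f e ω = 0)
    (h0 : ∀ e ∈ T, ∫ ω, f e ω ∂P = 0) :
    F.energy p (s + ∑ e ∈ T, f e) ≤ F.energy p s + ∑ e ∈ T, F.energy p (f e) := by
  classical
  induction T using Finset.induction_on with
  | empty => simp
  | insert e T he ih =>
    rw [Finset.sum_insert he, Finset.sum_insert he, add_comm (f e), ← add_assoc]
    have hmem : ∀ e' ∈ T, e' ∈ insert e T := fun e' => Finset.mem_insert_of_mem
    have hself := Finset.mem_insert_self e T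
    obtain ⟨z, hz⟩ := hsT e hself
    refine (F.energy_add_le (hT e hself) (z := z)
      (hs.add (integrable_finsetSum' _ fun e' he' => hf e' (hmem e' he'))) ?_ (hf e hself)
      (hsupp e hself) (h0 e hself)).trans ?_
    · intro ω hω
      rw [Pi.add_apply, Finset.sum_apply, hz ω hω, Finset.sum_eq_zero, add_zero]
      intro e' he'
      refine hsupp e' (hmem e' he') ω fun hω' => ?_
      have hne : e' ≠ e := fun h => he (h ▸ he')
      exact Set.disjoint_left.1 (hd (by exact_mod_cast hmem e' he') (by exact_mod_cast hself) hne)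
        hω' hω
    · rw [add_comm (F.energy p (f e)), ← add_assoc]
      gcongr
      exact ih (fun e' he' => hT e' (hmem e' he')) (hd.subset (by exact_mod_cast hmem))
        (fun e' he' => hsT e' (hmem e' he')) (fun e' he' => hf e' (hmem e' he'))
        (fun e' he' => hsupp e' (hmem e' he')) fun e' he' => h0 e' (hmem e' he')

lemma energy_le_of_const_on_children (hp : 0 < p) (hA : A ∈ F.atoms n) (hf : Integrable f P)
    (hsupp : ∀ ω ∉ A, f ω = 0) (h0 : ∫ ω, f ω ∂P = 0)
    (hconst : ∀ B ∈ F.children n A, ∃ z, ∀ ω ∈ B, f ω = z) :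
    F.energy p f ≤ ∫⁻ ω, ‖f ω‖ₑ ^ p ∂P := by
  have hlow : ∀ k ≤ n, ∀ ω, (P[f | F.seq k]) ω = 0 := fun k hk ω =>
    F.condExp_eq_zero_of_level_le hA hf hsupp h0 hk ω
  have hhigh : ∀ k, n < k → ∀ ω, (P[f | F.seq k]) ω = f ω := by
    intro k hk ω
    by_cases hω : ω ∈ A
    · obtain ⟨z, hz⟩ := hconst _ (F.atomAt_succ_mem_children hA hω)
      rw [hz ω (F.mem_atomAt _ ω)]
      exact F.condExp_eq_const hf (F.atomAt_mem k ω) (F.mem_atomAt k ω) fun x hx =>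
        hz x (F.atomAt_subset hk ω hx)
    · rw [hsupp ω hω]
      exact F.condExp_eq_zero_of_notMem hA hf hsupp hk.le hω
  rw [energy, tsum_eq_single n]
  · simp [hlow n le_rfl, hhigh (n + 1) n.lt_succ_self]
  · intro k hk
    rcases lt_or_gt_of_ne hk with h | h
    · simp [hlow k h.le, hlow (k + 1) h, hp]
    · simp [hhigh k h, hhigh (k + 1) (h.trans k.lt_succ_self), hp]

lemma energy_smul_const_le (hp : 0 < p) {h : Ω → ℝ} (hh : Integrable h P) (y : X) :
    F.energy p (fun ω => h ω • y) ≤ ‖y‖ₑ ^ p * F.energy p h := by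
  have hcond : ∀ k ω, (P[fun ω => h ω • y | F.seq k]) ω = (P[h | F.seq k]) ω • y := by
    intro k ω
    rw [F.condExp_eq_setAverage (hh.smul_const y) (F.atomAt_mem k ω) (F.mem_atomAt k ω),
      F.condExp_eq_setAverage hh (F.atomAt_mem k ω) (F.mem_atomAt k ω), setAverage_eq,
      setAverage_eq, integral_smul_const, smul_assoc]
  simp only [energy, hcond, ← sub_smul]
  rw [← ENNReal.tsum_mul_left]
  refine ENNReal.tsum_le_tsum fun k => ?_
  rw [← lintegral_const_mul' _ _ (ENNReal.rpow_ne_top_of_nonneg hp.le enorm_ne_top)]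
  refine lintegral_mono fun ω => ?_
  rw [enorm_smul, ENNReal.mul_rpow_of_nonneg _ _ hp.le, mul_comm]

end Energy

section Cut

variable {Ω : Type*} [m : MeasurableSpace Ω] {P : Measure Ω} (F : AtomicFiltration P)
  (star : ℕ → Set Ω → Set Ω)

/-- A cut of an atom `A`: a union of children of a member of the chain `A`, `A*`, `A**`, ... -/
inductive IsCut : ℕ → Set Ω → Set Ω → Prop
  | children {n : ℕ} {A : Set Ω} {C : Set (Set Ω)} (hC : C ⊆ F.children n A) : IsCut n A (⋃₀ C)
  | later {n : ℕ} {A U : Set Ω} (hU : IsCut (n + 1) (star n A) U) : IsCut n A U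

/-- The `j`-th member of the chain `A`, `A*`, `A**`, ... -/
def starChain : ℕ → ℕ → Set Ω → Set Ω
  | 0, _, A => A
  | j + 1, n, A => starChain j (n + 1) (star n A)

variable {F star} {n : ℕ} {A U : Set Ω} {e : ℕ × Set Ω}

lemma subset_or_disjoint_sUnion_children {C : Set (Set Ω)} (hC : C ⊆ F.children n A) {B : Set Ω}
    (hB : B ∈ F.atoms (n + 1)) : B ⊆ ⋃₀ C ∨ Disjoint B (⋃₀ C) := by
  by_cases h : B ∈ C
  · exact Or.inl (Set.subset_sUnion_of_mem h)
  · exact Or.inr (Set.disjoint_sUnion_right.2 fun B' hB' =>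
      F.pairwiseDisjoint_atoms (n + 1) hB (hC hB').1 fun h' => h (h' ▸ hB'))

lemma IsCut.measurableSet (hU : F.IsCut star n A U) : MeasurableSet U := by
  induction hU with
  | children hC =>
    exact MeasurableSet.sUnion ((F.children_countable _ _).mono hC)
      fun B hB => F.measurableSet_of_mem_atoms (hC hB).1
  | later _ ih => exact ih

variable (hstar : F.IsLargestChildSelection star)
include hstar

lemma IsCut.subset (hU : F.IsCut star n A U) (hA : A ∈ F.atoms n) : U ⊆ A := by
  induction hU with
  | children hC => exact Set.sUnion_subset fun B hB => (hC hB).2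
  | later _ ih =>
    have hs := (hstar _ _ hA).1
    exact (ih hs.1).trans hs.2

lemma IsCut.subset_or_disjoint (hU : F.IsCut star n A U) (hA : A ∈ F.atoms n)
    (he : F.IsExit star n A e) : e.2 ⊆ U ∨ Disjoint e.2 U := by
  induction hU with
  | @children n A C hC =>
    have hs := (hstar n A hA).1
    rcases isExit_iff.1 he with ⟨B, hB, _, rfl⟩ | h
    · exact subset_or_disjoint_sUnion_children hC hB.1
    · have hsub := h.subset hstar hs.1
      exact (subset_or_disjoint_sUnion_children hC hs.1).imp hsub.trans fun h => h.mono_left hsub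
  | @later n A U hU ih =>
    have hs := (hstar n A hA).1
    rcases isExit_iff.1 he with ⟨B, hB, hne, rfl⟩ | h
    · exact Or.inr ((F.pairwiseDisjoint_atoms (n + 1) hB.1 hs.1 hne).mono_right
        (hU.subset hstar hs.1))
    · exact ih hs.1 h

lemma starChain_subset (j : ℕ) (hA : A ∈ F.atoms n) : starChain star j n A ⊆ A := by
  induction j generalizing n A with
  | zero => exact subset_rfl
  | succ j ih =>
    have hs := (hstar n A hA).1
    exact (ih hs.1).trans hs.2

lemma IsExit.disjoint_starChain (he : F.IsExit star n A e) (hA : A ∈ F.atoms n) {j : ℕ}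
    (hj : e.1 ≤ n + j) : Disjoint e.2 (starChain star j n A) := by
  induction he generalizing j with
  | @child n A B hB hne =>
    have hs := (hstar n A hA).1
    obtain _ | j := j
    · simp at hj
    · exact (F.pairwiseDisjoint_atoms (n + 1) hB.1 hs.1 hne).mono_right
        (starChain_subset hstar j hs.1)
  | @later n A e he ih =>
    have hlt := he.lt_level
    obtain _ | j := j
    · omega
    · exact ih (hstar n A hA).1.1 (by omega)

omit hstar in
lemma exists_isCut_children {a : ℝ≥0∞} (hA : A ∈ F.atoms n)
    (hsmall : ∀ B ∈ F.children n A, P B ≤ a) (haA : a < P A) :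
    ∃ U, F.IsCut star n A U ∧ a ≤ P U ∧ P U ≤ 2 * a := by
  rw [F.measure_eq_tsum_children hA, ENNReal.tsum_eq_iSup_sum] at haA
  obtain ⟨s, hs⟩ := lt_iSup_iff.1 haA
  obtain ⟨t, _, hle, hge⟩ := exists_subset_le_sum_le_two_mul s (fun B => P B.1) a
    (fun B _ => hsmall B.1 B.2) hs.le
  have hmeas : P (⋃₀ (Subtype.val '' (t : Set (F.children n A)))) = ∑ B ∈ t, P B.1 := by
    rw [Set.sUnion_image]
    exact measure_biUnion_finset (fun B _ C _ hne => F.children_pairwiseDisjoint n A B.2 C.2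
      fun h => hne (Subtype.ext h)) fun B _ => F.measurableSet_of_mem_atoms B.2.1
  refine ⟨_, .children (C := Subtype.val '' (t : Set (F.children n A))) ?_, ?_⟩
  · rintro _ ⟨B, _, rfl⟩
    exact B.2
  · rw [hmeas]
    exact ⟨hle, hge⟩

-- Along the chain, either some member has measure in `[a, 2a]`, or the measure jumps from above
-- `2a` to below `a`, so that all children of a member larger than `2a` are smaller than `a`.
lemma exists_isCut_of_starChain {a : ℝ≥0∞} (j : ℕ) (hA : A ∈ F.atoms n) (hA2 : 2 * a < P A)
    (hj : P (starChain star j n A) ≤ 2 * a) :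
    ∃ U, F.IsCut star n A U ∧ a ≤ P U ∧ P U ≤ 2 * a := by
  induction j generalizing n A with
  | zero => exact absurd hA2 (not_lt.2 hj)
  | succ j ih =>
    obtain ⟨hs, hmax⟩ := hstar n A hA
    rcases lt_or_ge (2 * a) (P (star n A)) with hlarge | hle
    · obtain ⟨U, hU, hmeas⟩ := ih hs.1 hlarge hj
      exact ⟨U, .later hU, hmeas⟩
    rcases le_or_gt a (P (star n A)) with hge | hsmall
    · refine ⟨⋃₀ {star n A}, .children (Set.singleton_subset_iff.2 hs), ?_⟩
      simpa using ⟨hge, hle⟩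
    · refine exists_isCut_children hA (fun B hB => (hmax B hB).trans hsmall.le)
        (lt_of_le_of_lt ?_ hA2)
      rw [two_mul]
      exact le_self_add

lemma measure_starChain_add_sum_le (hA : A ∈ F.atoms n) {T : Finset (ℕ × Set Ω)}
    (hT : ∀ e ∈ T, F.IsExit star n A e) :
    P (starChain star (T.sup Prod.fst) n A) + ∑ e ∈ T, P e.2 ≤ P A := by
  have hmeas : ∀ e ∈ T, MeasurableSet e.2 := fun e he =>
    F.measurableSet_of_mem_atoms (hT e he).mem_atoms
  rw [← measure_biUnion_finset (f := Prod.snd)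
    (fun e he e' he' hne => (hT e he).disjoint hstar (hT e' he') hA hne) hmeas, ← measure_union]
  · exact measure_mono (Set.union_subset (starChain_subset hstar _ hA)
      (Set.iUnion₂_subset fun e he => (hT e he).subset hstar hA))
  · refine Set.disjoint_iUnion₂_right.2 fun e he => ?_
    exact ((hT e he).disjoint_starChain hstar hA
      ((Finset.le_sup (f := Prod.fst) he).trans (Nat.le_add_left _ _))).symm
  · exact Finset.measurableSet_biUnion _ hmeas

lemma exists_isCut [IsFiniteMeasure P] (hA : A ∈ F.atoms n) {T : Finset (ℕ × Set Ω)}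
    (hT : ∀ e ∈ T, F.IsExit star n A e) (hmass : P A ≤ 3 * ∑ e ∈ T, P e.2) :
    ∃ U, F.IsCut star n A U ∧ P A ≤ 3 * P U ∧ 3 * P U ≤ 2 * P A := by
  obtain ⟨a, ha⟩ : ∃ a, P A = 3 * a := ⟨P A / 3, (ENNReal.mul_div_cancel (by simp) (by simp)).symm⟩
  have ha_top : a ≠ ∞ := by
    rintro rfl
    exact measure_ne_top P A (by simp [ha])
  have ha0 : a ≠ 0 := by
    rintro rfl
    exact (F.measure_atoms_pos n A hA).ne' (by simp [ha])
  have hTa : a ≤ ∑ e ∈ T, P e.2 :=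
    (ENNReal.mul_le_mul_iff_right (by simp) (by simp)).1 (ha ▸ hmass)
  have hchain : P (starChain star (T.sup Prod.fst) n A) ≤ 2 * a := by
    refine ENNReal.le_of_add_le_add_right ha_top ?_
    calc _ ≤ P (starChain star (T.sup Prod.fst) n A) + ∑ e ∈ T, P e.2 := by gcongr
      _ ≤ P A := measure_starChain_add_sum_le hstar hA hT
      _ = 2 * a + a := by rw [ha]; ring
  have hlt : 2 * a < P A := by
    rw [ha]
    exact (ENNReal.mul_lt_mul_iff_left ha0 ha_top).2 (by norm_num)
  obtain ⟨U, hU, hle, hge⟩ := exists_isCut_of_starChain hstar _ hA hlt hchain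
  refine ⟨U, hU, ?_, ?_⟩
  · rw [ha]; gcongr
  · rw [ha, mul_left_comm]; gcongr

end Cut

section CutFunction

variable {Ω : Type*} [m : MeasurableSpace Ω] (P : Measure Ω)

/-- The mean zero function `1_U - (P U / P A) 1_A` attached to a subset `U` of `A`; for a cut `U` it
plays the role of a Rademacher function on `A`. -/
noncomputable def cutFunction (A U : Set Ω) (ω : Ω) : ℝ :=
  U.indicator (fun _ => 1) ω - P.real U / P.real A * A.indicator (fun _ => 1) ω

variable {P} {A S U : Set Ω} {ω : Ω}

lemma cutFunction_of_mem (hUA : U ⊆ A) (hω : ω ∈ U) :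
    cutFunction P A U ω = 1 - P.real U / P.real A := by
  simp [cutFunction, hω, hUA hω]

lemma cutFunction_of_notMem (hA : ω ∈ A) (hω : ω ∉ U) :
    cutFunction P A U ω = -(P.real U / P.real A) := by
  simp [cutFunction, hω, hA]

lemma cutFunction_eq_zero (hUA : U ⊆ A) (hω : ω ∉ A) : cutFunction P A U ω = 0 := by
  have hU : ω ∉ U := fun h => hω (hUA h)
  simp [cutFunction, hω, hU]

lemma measurable_cutFunction (hA : MeasurableSet A) (hU : MeasurableSet U) :
    Measurable (cutFunction P A U) :=
  (measurable_const.indicator hU).sub ((measurable_const.indicator hA).const_mul _)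

lemma cutFunction_eq_smul_add (hS : P.real S ≠ 0) : cutFunction P A U =
    (fun ω => cutFunction P A S ω • (P.real U / P.real S)) + cutFunction P S U := by
  ext ω
  simp only [cutFunction, Pi.add_apply, smul_eq_mul]
  field

variable [IsFiniteMeasure P]

lemma abs_cutFunction_le (hUA : U ⊆ A) (ω : Ω) : |cutFunction P A U ω| ≤ 1 := by
  have h0 : 0 ≤ P.real U / P.real A := by positivity
  have h1 : P.real U / P.real A ≤ 1 := div_le_one_of_le₀ (measureReal_mono hUA) (by positivity)
  by_cases hA : ω ∈ A
  · by_cases hU : ω ∈ U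
    · rw [cutFunction_of_mem hUA hU, abs_le]
      constructor <;> linarith
    · rw [cutFunction_of_notMem hA hU, abs_le]
      constructor <;> linarith
  · simp [cutFunction_eq_zero hUA hA]

lemma integrable_cutFunction (hA : MeasurableSet A) (hU : MeasurableSet U) :
    Integrable (cutFunction P A U) P :=
  ((integrable_const 1).indicator hU).sub (((integrable_const 1).indicator hA).const_mul _)

lemma integral_cutFunction (hA : MeasurableSet A) (hU : MeasurableSet U) (hA0 : P.real A ≠ 0) :
    ∫ ω, cutFunction P A U ω ∂P = 0 := by
  unfold cutFunction
  rw [integral_sub ((integrable_const 1).indicator hU)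
    (((integrable_const 1).indicator hA).const_mul _), integral_const_mul,
    integral_indicator_const _ hU, integral_indicator_const _ hA]
  simp [hA0]

lemma lintegral_enorm_cutFunction_rpow_le {p : ℝ} (hp : 1 ≤ p) (hA : MeasurableSet A)
    (hU : MeasurableSet U) (hUA : U ⊆ A) (hA0 : P.real A ≠ 0) :
    ∫⁻ ω, ‖cutFunction P A U ω‖ₑ ^ p ∂P ≤ 2 * P (A \ U) := by
  have hA_pos : 0 < P.real A := measureReal_nonneg.lt_of_ne' hA0
  have hratio : 1 - P.real U / P.real A = P.real (A \ U) / P.real A := by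
    rw [measureReal_sdiff hUA hU, sub_div, div_self hA0]
  have hbound : ∀ ω, ‖cutFunction P A U ω‖ₑ ^ p ≤
      U.indicator (fun _ => ENNReal.ofReal (P.real (A \ U) / P.real A)) ω +
        (A \ U).indicator (fun _ => 1) ω := by
    intro ω
    have hle_one : ‖cutFunction P A U ω‖ₑ ≤ 1 := by
      rw [Real.enorm_eq_ofReal_abs]
      exact ENNReal.ofReal_le_one.2 (abs_cutFunction_le hUA ω)
    by_cases hωU : ω ∈ U
    · refine (ENNReal.rpow_le_self_of_le_one hle_one hp).trans ?_
      rw [cutFunction_of_mem hUA hωU, hratio, Real.enorm_of_nonneg (by positivity)]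
      simp [hωU]
    · by_cases hωA : ω ∈ A
      · simpa [hωU, hωA] using ENNReal.rpow_le_one hle_one (zero_le_one.trans hp)
      · simp [cutFunction_eq_zero hUA hωA, zero_lt_one.trans_le hp]
  refine (lintegral_mono hbound).trans ?_
  rw [lintegral_add_left (measurable_const.indicator hU), lintegral_indicator_const hU,
    lintegral_indicator_const (hA.diff hU), one_mul, two_mul]
  gcongr
  rw [← ofReal_measureReal (μ := P) (s := U), ← ofReal_measureReal (μ := P) (s := A \ U),
    ← ENNReal.ofReal_mul (by positivity), div_mul_eq_mul_div]
  refine ENNReal.ofReal_le_ofReal (div_le_of_le_mul₀ hA_pos.le measureReal_nonneg ?_)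
  gcongr
  exact measure_ne_top P A

variable {F : AtomicFiltration P} {star : ℕ → Set Ω → Set Ω} {n : ℕ} {p : ℝ}

lemma energy_cutFunction_sUnion_le (hp : 1 ≤ p) (hA : A ∈ F.atoms n) {C : Set (Set Ω)}
    (hC : C ⊆ F.children n A) :
    F.energy p (cutFunction P A (⋃₀ C)) ≤ 2 * P (A \ ⋃₀ C) := by
  have hAm := F.measurableSet_of_mem_atoms hA
  have hCm : MeasurableSet (⋃₀ C) := MeasurableSet.sUnion ((F.children_countable n A).mono hC)
    fun B hB => F.measurableSet_of_mem_atoms (hC hB).1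
  have hCA : ⋃₀ C ⊆ A := Set.sUnion_subset fun B hB => (hC hB).2
  have hA0 := (F.measureReal_pos hA).ne'
  refine (F.energy_le_of_const_on_children (zero_lt_one.trans_le hp) hA
    (integrable_cutFunction hAm hCm) (fun ω hω => cutFunction_eq_zero hCA hω)
    (integral_cutFunction hAm hCm hA0) fun B hB => ?_).trans
    (lintegral_enorm_cutFunction_rpow_le hp hAm hCm hCA hA0)
  rcases subset_or_disjoint_sUnion_children hC hB.1 with h | h
  · exact ⟨_, fun ω hω => cutFunction_of_mem hCA (h hω)⟩
  · exact ⟨_, fun ω hω => cutFunction_of_notMem (hB.2 hω) (Set.disjoint_left.1 h hω)⟩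

lemma energy_cutFunction_smul_star_le (hp : 1 ≤ p) (hstar : F.IsLargestChildSelection star)
    (hA : A ∈ F.atoms n) {b : ℝ} (hb : |b| ≤ 1) :
    F.energy p (fun ω => cutFunction P A (star n A) ω • b) ≤ 2 * P (A \ star n A) := by
  have hs := (hstar n A hA).1
  have hb1 : ‖b‖ₑ ^ p ≤ 1 := by
    refine ENNReal.rpow_le_one ?_ (zero_le_one.trans hp)
    rw [Real.enorm_eq_ofReal_abs]
    exact ENNReal.ofReal_le_one.2 hb
  have hstar_energy := energy_cutFunction_sUnion_le hp hA (Set.singleton_subset_iff.2 hs)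
  rw [Set.sUnion_singleton] at hstar_energy
  calc _ ≤ ‖b‖ₑ ^ p * F.energy p (cutFunction P A (star n A)) :=
        F.energy_smul_const_le (zero_lt_one.trans_le hp) (integrable_cutFunction
          (F.measurableSet_of_mem_atoms hA) (F.measurableSet_of_mem_atoms hs.1)) b
    _ ≤ 1 * (2 * P (A \ star n A)) := by gcongr
    _ = _ := one_mul _

-- A cut beyond `A*` is reached in two steps: first from `A` to `A*`, then inside `A*`.
lemma IsCut.energy_le (hp : 1 ≤ p) (hstar : F.IsLargestChildSelection star)
    (hU : F.IsCut star n A U) (hA : A ∈ F.atoms n) :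
    F.energy p (cutFunction P A U) ≤ 2 * P A := by
  induction hU with
  | children hC =>
    refine (energy_cutFunction_sUnion_le hp hA hC).trans ?_
    gcongr
    exact Set.sdiff_subset
  | @later n A U hU ih =>
    have hs := (hstar n A hA).1
    have hAm := F.measurableSet_of_mem_atoms hA
    have hSm := F.measurableSet_of_mem_atoms hs.1
    have hUS := hU.subset hstar hs.1
    have hS0 := (F.measureReal_pos hs.1).ne'
    have hb : |P.real U / P.real (star n A)| ≤ 1 := by
      rw [abs_of_nonneg (by positivity)]
      exact div_le_one_of_le₀ (measureReal_mono hUS) measureReal_nonneg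
    rw [cutFunction_eq_smul_add hS0]
    calc _ ≤ F.energy p (fun ω => cutFunction P A (star n A) ω •
            (P.real U / P.real (star n A))) + F.energy p (cutFunction P (star n A) U) :=
          F.energy_add_le hs.1 ((integrable_cutFunction hAm hSm).smul_const _)
            (fun ω hω => by rw [cutFunction_of_mem hs.2 hω])
            (integrable_cutFunction hSm hU.measurableSet)
            (fun ω hω => cutFunction_eq_zero hUS hω)
            (integral_cutFunction hSm hU.measurableSet hS0)
      _ ≤ 2 * P (A \ star n A) + 2 * P (star n A) := by
          gcongr
          · exact energy_cutFunction_smul_star_le hp hstar hA hb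
          · exact ih hs.1
      _ = 2 * P A := by
          rw [← mul_add, ← measure_sdiff_add_inter A hSm, Set.inter_eq_right.2 hs.2]

end CutFunction

end AtomicFiltration

/-- A finite dyadic martingale with values in `X` and mean zero, as a binary tree of increments. -/
inductive DyadicTree (X : Type*)
  | leaf : DyadicTree X
  | node (y : X) (l r : DyadicTree X) : DyadicTree X

namespace DyadicTree

/-- The number of steps of a dyadic martingale. -/
def depth {X : Type*} : DyadicTree X → ℕ
  | leaf => 0
  | node _ l r => max l.depth r.depth + 1

variable {X : Type*} [NormedAddCommGroup X]

/-- The `p`-th moment of the dyadic martingale started at `x`, minus `κ` times the sum of the `p`-th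
moments of its increments. -/
noncomputable def val (p κ : ℝ) : DyadicTree X → X → ℝ
  | leaf, x => ‖x‖ ^ p
  | node y l r, x => (l.val p κ (x + y) + r.val p κ (x - y)) / 2 - κ * ‖y‖ ^ p

variable {p κ : ℝ}

lemma exists_val_le (hp : 0 ≤ p) (hκ : 0 ≤ κ) (t : DyadicTree X) (R : ℝ) :
    ∃ b, 0 ≤ b ∧ ∀ x : X, ‖x‖ ≤ R → t.val p κ x ≤ b := by
  induction t generalizing R with
  | leaf =>
    refine ⟨|R| ^ p, by positivity, fun x hx => ?_⟩
    exact Real.rpow_le_rpow (norm_nonneg x) (hx.trans (le_abs_self R)) hp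
  | node y l r hl hr =>
    obtain ⟨b, hb0, hb⟩ := hl (R + ‖y‖)
    obtain ⟨c, hc0, hc⟩ := hr (R + ‖y‖)
    refine ⟨(b + c) / 2, by positivity, fun x hx => ?_⟩
    have h1 := hb (x + y) ((norm_add_le x y).trans (by linarith))
    have h2 := hc (x - y) ((norm_sub_le x y).trans (by linarith))
    have h3 : 0 ≤ κ * ‖y‖ ^ p := by positivity
    rw [val]
    linarith

variable [NormedSpace ℝ X]

lemma convexOn_val (hp : 1 ≤ p) (t : DyadicTree X) : ConvexOn ℝ Set.univ (t.val p κ) := by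
  induction t with
  | leaf =>
    refine ⟨convex_univ, fun x _ y _ a b ha hb hab => ?_⟩
    calc ‖a • x + b • y‖ ^ p ≤ (a • ‖x‖ + b • ‖y‖) ^ p := by
          gcongr
          exact convexOn_univ_norm.2 (Set.mem_univ x) (Set.mem_univ y) ha hb hab
      _ ≤ a • ‖x‖ ^ p + b • ‖y‖ ^ p :=
          (convexOn_rpow hp).2 (norm_nonneg x) (norm_nonneg y) ha hb hab
  | node y l r hl hr =>
    have hsum : ConvexOn ℝ Set.univ
        ((l.val p κ ∘ fun x => x + y) + r.val p κ ∘ fun x => x + -y) :=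
      (hl.translate_left y).add (hr.translate_left (-y))
    refine ((hsum.smul (c := 1 / 2) (by norm_num)).add_const (-(κ * ‖y‖ ^ p))).congr fun x _ => ?_
    simp only [val, Pi.add_apply, Function.comp_apply, smul_eq_mul, ← sub_eq_add_neg]
    ring

end DyadicTree

-- The points `x ± y` lie on the segment between the two points on the right, and the midpoint of
-- `x ± y` is the `q`-weighted mean of these.
lemma half_add_le_of_convexOn {X : Type*} [AddCommGroup X] [Module ℝ X] {g : X → ℝ}
    (hg : ConvexOn ℝ Set.univ g) (x y : X) {q : ℝ} (hq : q ∈ Set.Icc (1 / 3) (2 / 3)) :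
    (g (x + y) + g (x - y)) / 2 ≤
      q * g (x + (1 - q) • (3 : ℝ) • y) + (1 - q) * g (x + (-q) • (3 : ℝ) • y) := by
  obtain ⟨hq1, hq2⟩ := hq
  have key : ∀ a b : ℝ, 0 ≤ a → 0 ≤ b → a + b = 1 →
      g (a • (x + (1 - q) • (3 : ℝ) • y) + b • (x + (-q) • (3 : ℝ) • y)) ≤
        a * g (x + (1 - q) • (3 : ℝ) • y) + b * g (x + (-q) • (3 : ℝ) • y) :=
    fun a b ha hb hab => hg.2 (Set.mem_univ _) (Set.mem_univ _) ha hb hab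
  have hadd := key (q + 1 / 3) (2 / 3 - q) (by linarith) (by linarith) (by ring)
  have hsub := key (q - 1 / 3) (4 / 3 - q) (by linarith) (by linarith) (by ring)
  have eadd : (q + 1 / 3) • (x + (1 - q) • (3 : ℝ) • y) + (2 / 3 - q) • (x + (-q) • (3 : ℝ) • y) =
      x + y := by module
  have esub : (q - 1 / 3) • (x + (1 - q) • (3 : ℝ) • y) + (4 / 3 - q) • (x + (-q) • (3 : ℝ) • y) =
      x - y := by module
  rw [eadd] at hadd
  rw [esub] at hsub
  linarith

section Integrals

variable {Ω ι : Type*} [m : MeasurableSpace Ω] {P : Measure Ω} {A : Set Ω} {T : Finset ι}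
  {B : ι → Set Ω} {g : Ω → ℝ}

lemma sum_setIntegral_le_setIntegral (hA : MeasurableSet A) (hB : ∀ i ∈ T, MeasurableSet (B i))
    (hd : (T : Set ι).PairwiseDisjoint B) (hBA : ∀ i ∈ T, B i ⊆ A) (hg : IntegrableOn g A P)
    (h0 : ∀ ω ∈ A, 0 ≤ g ω) : ∑ i ∈ T, ∫ ω in B i, g ω ∂P ≤ ∫ ω in A, g ω ∂P := by
  rw [← integral_biUnion_finset T hB hd fun i hi => hg.mono_set (hBA i hi)]
  exact setIntegral_mono_set hg ((ae_restrict_iff' hA).2 (ae_of_all _ h0))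
    (Set.iUnion₂_subset hBA).eventuallyLE

lemma setIntegral_sub_le_sum_setIntegral [IsFiniteMeasure P] (hA : MeasurableSet A)
    (hB : ∀ i ∈ T, MeasurableSet (B i)) (hd : (T : Set ι).PairwiseDisjoint B)
    (hBA : ∀ i ∈ T, B i ⊆ A) (hg : IntegrableOn g A P) {b : ℝ} (hb : ∀ ω ∈ A, g ω ≤ b) :
    ∫ ω in A, g ω ∂P - b * (P.real A - ∑ i ∈ T, P.real (B i)) ≤
      ∑ i ∈ T, ∫ ω in B i, g ω ∂P := by
  have hconst : ∀ S : Set Ω, IntegrableOn (fun _ => b) S P := fun S => integrableOn_const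
  have h := sum_setIntegral_le_setIntegral (g := fun ω => b - g ω) hA hB hd hBA
    ((hconst A).sub hg) fun ω hω => sub_nonneg.2 (hb ω hω)
  have hsplit : ∀ S ⊆ A, ∫ ω in S, (b - g ω) ∂P = b * P.real S - ∫ ω in S, g ω ∂P :=
    fun S hS => by
      rw [integral_sub (hconst S) (hg.mono_set hS), setIntegral_const, smul_eq_mul, mul_comm]
  rw [hsplit A subset_rfl, Finset.sum_congr rfl fun i hi => hsplit (B i) (hBA i hi),
    Finset.sum_sub_distrib, ← Finset.mul_sum] at h
  linarith

lemma integrable_norm_add_rpow {X : Type*} [NormedAddCommGroup X] [IsFiniteMeasure P] {p : ℝ}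
    (hp : 0 ≤ p) {f : Ω → X} (hf : StronglyMeasurable f) {b : ℝ} (hb : ∀ ω, ‖f ω‖ ≤ b) (x : X) :
    Integrable (fun ω => ‖x + f ω‖ ^ p) P := by
  refine Integrable.of_bound (C := (‖x‖ + b) ^ p)
    ((stronglyMeasurable_const.add hf).norm.measurable.pow_const p).aestronglyMeasurable
    (ae_of_all _ fun ω => ?_)
  rw [Real.norm_of_nonneg (by positivity)]
  gcongr
  exact (norm_add_le _ _).trans (by gcongr; exact hb ω)

end Integrals

section MeanZero

variable {Ω : Type*} [m : MeasurableSpace Ω] {P : Measure Ω} {A B : Set Ω}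
  {X : Type*} [NormedAddCommGroup X] [NormedSpace ℝ X] {f g : Ω → X}

/-- A bounded measurable function of mean zero that vanishes off `A`. -/
structure IsMeanZeroOn (P : Measure Ω) (A : Set Ω) (f : Ω → X) : Prop where
  stronglyMeasurable : StronglyMeasurable f
  bounded : ∃ b, ∀ ω, ‖f ω‖ ≤ b
  eq_zero : ∀ ω ∉ A, f ω = 0
  integral_eq_zero : ∫ ω, f ω ∂P = 0

lemma isMeanZeroOn_zero : IsMeanZeroOn P A (0 : Ω → X) :=
  ⟨stronglyMeasurable_zero, ⟨0, by simp⟩, by simp, by simp⟩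

lemma IsMeanZeroOn.mono (hf : IsMeanZeroOn P A f) (hAB : A ⊆ B) : IsMeanZeroOn P B f where
  __ := hf
  eq_zero ω hω := hf.eq_zero ω fun h => hω (hAB h)

variable [IsFiniteMeasure P]

lemma IsMeanZeroOn.integrable (hf : IsMeanZeroOn P A f) : Integrable f P :=
  have ⟨b, hb⟩ := hf.bounded
  .of_bound hf.stronglyMeasurable.aestronglyMeasurable b (ae_of_all _ hb)

lemma IsMeanZeroOn.add (hf : IsMeanZeroOn P A f) (hg : IsMeanZeroOn P A g) :
    IsMeanZeroOn P A (f + g) where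
  stronglyMeasurable := hf.stronglyMeasurable.add hg.stronglyMeasurable
  bounded :=
    have ⟨b, hb⟩ := hf.bounded
    have ⟨c, hc⟩ := hg.bounded
    ⟨b + c, fun ω => (norm_add_le _ _).trans (add_le_add (hb ω) (hc ω))⟩
  eq_zero ω hω := by rw [Pi.add_apply, hf.eq_zero ω hω, hg.eq_zero ω hω, add_zero]
  integral_eq_zero := by
    rw [integral_add' hf.integrable hg.integrable, hf.integral_eq_zero, hg.integral_eq_zero,
      add_zero]

lemma isMeanZeroOn_sum {ι : Type*} {T : Finset ι} {f : ι → Ω → X}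
    (hf : ∀ i ∈ T, IsMeanZeroOn P A (f i)) : IsMeanZeroOn P A (∑ i ∈ T, f i) :=
  Finset.sum_induction f _ (fun _ _ => IsMeanZeroOn.add) isMeanZeroOn_zero hf

lemma isMeanZeroOn_cutFunction_smul [CompleteSpace X] {U : Set Ω} (hA : MeasurableSet A)
    (hU : MeasurableSet U) (hUA : U ⊆ A) (hA0 : P.real A ≠ 0) (y : X) :
    IsMeanZeroOn P A fun ω => AtomicFiltration.cutFunction P A U ω • y where
  stronglyMeasurable :=
    (AtomicFiltration.measurable_cutFunction hA hU).stronglyMeasurable.smul_const y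
  bounded := by
    refine ⟨‖y‖, fun ω => ?_⟩
    rw [norm_smul]
    exact mul_le_of_le_one_left (norm_nonneg y) (AtomicFiltration.abs_cutFunction_le hUA ω)
  eq_zero ω hω := by rw [AtomicFiltration.cutFunction_eq_zero hUA hω, zero_smul]
  integral_eq_zero := by
    rw [integral_smul_const, AtomicFiltration.integral_cutFunction hA hU hA0, zero_smul]

end MeanZero

lemma enorm_rpow_eq_ofReal {X : Type*} [SeminormedAddCommGroup X] (x : X) {p : ℝ} (hp : 0 ≤ p) :
    ‖x‖ₑ ^ p = ENNReal.ofReal (‖x‖ ^ p) := by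
  rw [← ofReal_norm, ENNReal.ofReal_rpow_of_nonneg (norm_nonneg x) hp]

namespace AtomicFiltration

section Realizes

variable {Ω : Type*} [m : MeasurableSpace Ω] {P : Measure Ω} {F : AtomicFiltration P}
  {X : Type*} [NormedAddCommGroup X] [NormedSpace ℝ X] {p κ v w ε : ℝ} {A : Set Ω} {x : X}
  {f : Ω → X}

/-- A bounded mean zero function on the atom `A`, with energy at most `ε`, for which the `p`-th
moment of `x + f` over `A` exceeds `κ ε + v`. -/
structure Realizes (F : AtomicFiltration P) (p κ : ℝ) (A : Set Ω) (x : X) (v : ℝ) (f : Ω → X)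
    (ε : ℝ) : Prop extends IsMeanZeroOn P A f where
  nonneg : 0 ≤ ε
  energy_le : F.energy p f ≤ ENNReal.ofReal ε
  le : κ * ε + v ≤ ∫ ω in A, ‖x + f ω‖ ^ p ∂P

lemma Realizes.mono (h : F.Realizes p κ A x v f ε) (hw : w ≤ v) : F.Realizes p κ A x w f ε where
  __ := h
  le := le_trans (by linarith) h.le

lemma realizes_zero (hp : 0 < p) (x : X) :
    F.Realizes p κ A x (‖x‖ ^ p * P.real A) (0 : Ω → X) 0 where
  __ := isMeanZeroOn_zero
  nonneg := le_rfl
  energy_le := by simp [energy, condExp_zero, hp]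
  le := by simp [mul_comm]

variable [IsFiniteMeasure P] [CompleteSpace X]

-- Beyond the exits `T` the function `s` makes no move, so the `f e` can be run there independently.
lemma Realizes.add_sum {n : ℕ} {s : Ω → X} {T : Finset (ℕ × Set Ω)} {z : ℕ × Set Ω → X}
    {g : ℕ × Set Ω → Ω → X} {η u : ℕ × Set Ω → ℝ} (hp : 0 ≤ p) (hA : A ∈ F.atoms n)
    (hs : IsMeanZeroOn P A s) (hε : 0 ≤ ε) (hsε : F.energy p s ≤ ENNReal.ofReal ε)
    (hT : ∀ e ∈ T, e.2 ∈ F.atoms e.1) (hTA : ∀ e ∈ T, e.2 ⊆ A)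
    (hd : (T : Set (ℕ × Set Ω)).PairwiseDisjoint Prod.snd)
    (hsz : ∀ e ∈ T, ∀ ω ∈ e.2, s ω = z e)
    (hg : ∀ e ∈ T, F.Realizes p κ e.2 (x + z e) (u e) (g e) (η e)) :
    F.Realizes p κ A x (∑ e ∈ T, u e - κ * ε) (s + ∑ e ∈ T, g e) (ε + ∑ e ∈ T, η e) where
  __ := hs.add (isMeanZeroOn_sum fun e he => (hg e he).toIsMeanZeroOn.mono (hTA e he))
  nonneg := add_nonneg hε (Finset.sum_nonneg fun e he => (hg e he).nonneg)
  energy_le := by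
    have hη : ∀ e ∈ T, 0 ≤ η e := fun e he => (hg e he).nonneg
    rw [ENNReal.ofReal_add hε (Finset.sum_nonneg hη), ENNReal.ofReal_sum_of_nonneg hη]
    exact (F.energy_add_sum_le T g hT hd hs.integrable (fun e he => ⟨z e, hsz e he⟩)
      (fun e he => (hg e he).integrable) (fun e he => (hg e he).eq_zero)
      fun e he => (hg e he).integral_eq_zero).trans
      (add_le_add hsε (Finset.sum_le_sum fun e he => (hg e he).energy_le))
  le := by
    have hsum := hs.add (isMeanZeroOn_sum fun e he => (hg e he).toIsMeanZeroOn.mono (hTA e he))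
    obtain ⟨b, hb⟩ := hsum.bounded
    have hTm : ∀ e ∈ T, MeasurableSet e.2 := fun e he => F.measurableSet_of_mem_atoms (hT e he)
    have hval : ∀ e ∈ T, ∀ ω ∈ e.2, x + (s + ∑ e ∈ T, g e) ω = x + z e + g e ω := by
      intro e he ω hω
      rw [Pi.add_apply, Finset.sum_apply, hsz e he ω hω, Finset.sum_eq_single_of_mem e he,
        add_assoc]
      exact fun e' he' hne => (hg e' he').eq_zero ω fun hω' =>
        Set.disjoint_left.1 (hd he' he hne) hω' hω
    calc κ * (ε + ∑ e ∈ T, η e) + (∑ e ∈ T, u e - κ * ε)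
        = ∑ e ∈ T, (κ * η e + u e) := by rw [Finset.sum_add_distrib, ← Finset.mul_sum]; ring
      _ ≤ ∑ e ∈ T, ∫ ω in e.2, ‖x + (s + ∑ e ∈ T, g e) ω‖ ^ p ∂P :=
          Finset.sum_le_sum fun e he => (hg e he).le.trans_eq <|
            setIntegral_congr_fun (hTm e he) fun ω hω => by rw [hval e he ω hω]
      _ ≤ ∫ ω in A, ‖x + (s + ∑ e ∈ T, g e) ω‖ ^ p ∂P :=
          sum_setIntegral_le_setIntegral (F.measurableSet_of_mem_atoms hA) hTm hd hTA
            (integrable_norm_add_rpow hp hsum.stronglyMeasurable hb x).integrableOn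
            fun ω _ => by positivity

end Realizes

end AtomicFiltration

namespace AtomicFiltration

section Rich

variable {Ω : Type*} [m : MeasurableSpace Ω] {P : Measure Ω} {F : AtomicFiltration P}
  {star : ℕ → Set Ω → Set Ω} {n : ℕ} {A U : Set Ω}

lemma IsRich.of_succ {θ : ℝ≥0} {N : ℕ} (h : F.IsRich star θ (N + 1) n A) :
    F.IsRich star θ N n A := by
  induction N generalizing n A with
  | zero => trivial
  | succ N ih =>
    obtain ⟨T, hT, hmass⟩ := h
    exact ⟨T, fun e he => ⟨(hT e he).1, ih (hT e he).2⟩, hmass⟩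

lemma IsRich.mono_depth {θ : ℝ≥0} {M N : ℕ} (hMN : M ≤ N) (h : F.IsRich star θ N n A) :
    F.IsRich star θ M n A := by
  induction hMN with
  | refl => exact h
  | step _ ih => exact ih h.of_succ

lemma IsRich.mono {θ θ' : ℝ≥0} (hθ : θ ≤ θ') {N : ℕ} (h : F.IsRich star θ' N n A) :
    F.IsRich star θ N n A := by
  induction N generalizing n A with
  | zero => trivial
  | succ N ih =>
    obtain ⟨T, hT, hmass⟩ := h
    exact ⟨T, fun e he => ⟨(hT e he).1, ih (hT e he).2⟩, le_trans (by gcongr) hmass⟩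

lemma pairwiseDisjoint_of_isExit (hstar : F.IsLargestChildSelection star) (hA : A ∈ F.atoms n)
    {T : Finset (ℕ × Set Ω)} (hT : ∀ e ∈ T, F.IsExit star n A e) :
    (T : Set (ℕ × Set Ω)).PairwiseDisjoint Prod.snd :=
  fun e he e' he' hne => (hT e he).disjoint hstar (hT e' he') hA hne

variable [IsFiniteMeasure P]

lemma exists_isCut_ratio_mem_Icc (hstar : F.IsLargestChildSelection star) (hA : A ∈ F.atoms n)
    {T : Finset (ℕ × Set Ω)} (hT : ∀ e ∈ T, F.IsExit star n A e) {θ : ℝ≥0} (hθ : 1 / 3 ≤ θ)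
    (hmass : θ * P A ≤ ∑ e ∈ T, P e.2) :
    ∃ U, F.IsCut star n A U ∧ P.real U / P.real A ∈ Set.Icc (1 / 3) (2 / 3) := by
  have hthird : P A ≤ 3 * ∑ e ∈ T, P e.2 :=
    calc P A = ((3 * (1 / 3) : ℝ≥0) : ℝ≥0∞) * P A := by norm_num
      _ ≤ ((3 * θ : ℝ≥0) : ℝ≥0∞) * P A := by gcongr
      _ = 3 * (θ * P A) := by rw [ENNReal.coe_mul, mul_assoc]; rfl
      _ ≤ 3 * ∑ e ∈ T, P e.2 := by gcongr
  obtain ⟨U, hU, hle, hge⟩ := exists_isCut hstar hA hT hthird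
  have hle' : P.real A ≤ 3 * P.real U := by
    simpa [Measure.real] using ENNReal.toReal_mono (by finiteness) hle
  have hge' : 3 * P.real U ≤ 2 * P.real A := by
    simpa [Measure.real] using ENNReal.toReal_mono (by finiteness) hge
  have hApos := F.measureReal_pos hA
  refine ⟨U, hU, ?_, ?_⟩
  · rw [div_le_div_iff₀ (by norm_num) hApos]
    linarith
  · rw [div_le_div_iff₀ hApos (by norm_num)]
    linarith

lemma IsCut.exists_cutFunction_eq (hstar : F.IsLargestChildSelection star)
    (hU : F.IsCut star n A U) (hA : A ∈ F.atoms n) {e : ℕ × Set Ω} (he : F.IsExit star n A e) :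
    ∃ z, |z| ≤ 1 ∧ ∀ ω ∈ e.2, cutFunction P A U ω = z := by
  have hUA := hU.subset hstar hA
  obtain ⟨ω₀, hω₀⟩ := F.nonempty_of_mem_atoms he.mem_atoms
  refine ⟨cutFunction P A U ω₀, abs_cutFunction_le hUA ω₀, fun ω hω => ?_⟩
  rcases hU.subset_or_disjoint hstar hA he with h | h
  · rw [cutFunction_of_mem hUA (h hω), cutFunction_of_mem hUA (h hω₀)]
  · have heA := he.subset hstar hA
    rw [cutFunction_of_notMem (heA hω) (Set.disjoint_left.1 h hω),
      cutFunction_of_notMem (heA hω₀) (Set.disjoint_left.1 h hω₀)]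

lemma sum_measureReal_exit_mem_Icc (hstar : F.IsLargestChildSelection star) (hA : A ∈ F.atoms n)
    {T : Finset (ℕ × Set Ω)} (hT : ∀ e ∈ T, F.IsExit star n A e) {θ : ℝ≥0}
    (hmass : θ * P A ≤ ∑ e ∈ T, P e.2) :
    ∑ e ∈ T, P.real e.2 ∈ Set.Icc (θ * P.real A) (P.real A) := by
  constructor
  · have h := ENNReal.toReal_mono (ENNReal.sum_ne_top.2 fun e _ => measure_ne_top P e.2) hmass
    rwa [ENNReal.toReal_mul, ENNReal.toReal_sum fun e _ => measure_ne_top P e.2] at h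
  · rw [← measureReal_biUnion_finset (pairwiseDisjoint_of_isExit hstar hA hT) fun e he =>
      F.measurableSet_of_mem_atoms (hT e he).mem_atoms]
    exact measureReal_mono (Set.iUnion₂_subset fun e he => (hT e he).subset hstar hA)

lemma setIntegral_comp_cutFunction (hA : MeasurableSet A) (hU : MeasurableSet U) (hUA : U ⊆ A)
    (hA0 : P.real A ≠ 0) (h : ℝ → ℝ) :
    IntegrableOn (fun ω => h (cutFunction P A U ω)) A P ∧
      ∫ ω in A, h (cutFunction P A U ω) ∂P =
        (P.real U / P.real A * h (1 - P.real U / P.real A) +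
          (1 - P.real U / P.real A) * h (-(P.real U / P.real A))) * P.real A := by
  set q := P.real U / P.real A with hq
  have hqA : P.real U = q * P.real A := (div_mul_cancel₀ _ hA0).symm
  have hdiff : MeasurableSet (A \ U) := hA.diff hU
  have hin : Set.EqOn (fun ω => h (cutFunction P A U ω)) (fun _ => h (1 - q)) U := fun ω hω => by
    simp only [cutFunction_of_mem hUA hω, hq]
  have hout : Set.EqOn (fun ω => h (cutFunction P A U ω)) (fun _ => h (-q)) (A \ U) :=
    fun ω hω => by simp only [cutFunction_of_notMem hω.1 hω.2, hq]
  have hint_in := (integrableOn_const (μ := P)).congr_fun hin.symm hU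
  have hint_out := (integrableOn_const (μ := P)).congr_fun hout.symm hdiff
  have hunion : U ∪ A \ U = A := Set.union_sdiff_cancel hUA
  have hint := hint_in.union hint_out
  rw [hunion] at hint
  refine ⟨hint, ?_⟩
  calc ∫ ω in A, h (cutFunction P A U ω) ∂P
      = ∫ ω in U ∪ A \ U, h (cutFunction P A U ω) ∂P := by rw [hunion]
    _ = P.real U * h (1 - q) + P.real (A \ U) * h (-q) := by
        rw [setIntegral_union Set.disjoint_sdiff_right hdiff hint_in hint_out,
          setIntegral_congr_fun hU hin, setIntegral_congr_fun hdiff hout, setIntegral_const,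
          setIntegral_const, smul_eq_mul, smul_eq_mul]
    _ = (q * h (1 - q) + (1 - q) * h (-q)) * P.real A := by
        rw [measureReal_sdiff hUA hU, hqA]
        ring

lemma half_add_sub_mul_le_sum {X : Type*} [AddCommGroup X] [Module ℝ X]
    (hstar : F.IsLargestChildSelection star) (hA : A ∈ F.atoms n) (hU : F.IsCut star n A U)
    (hq : P.real U / P.real A ∈ Set.Icc (1 / 3) (2 / 3)) {T : Finset (ℕ × Set Ω)}
    (hT : ∀ e ∈ T, F.IsExit star n A e) {θ : ℝ≥0} (hmass : θ * P A ≤ ∑ e ∈ T, P e.2)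
    {z : ℕ × Set Ω → ℝ} (hz : ∀ e ∈ T, ∀ ω ∈ e.2, cutFunction P A U ω = z e) {ψ : X → ℝ}
    (hψ : ConvexOn ℝ Set.univ ψ) {b δ : ℝ} (hb : 0 ≤ b) (hδ : 0 ≤ δ)
    (hθb : (1 - (θ : ℝ)) * b ≤ δ) {x y : X}
    (hψb : ∀ c : ℝ, |c| ≤ 1 → ψ (x + c • (3 : ℝ) • y) ≤ b) :
    ((ψ (x + y) + ψ (x - y)) / 2 - 2 * δ) * P.real A ≤
      ∑ e ∈ T, (ψ (x + z e • (3 : ℝ) • y) - δ) * P.real e.2 := by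
  have hAm := F.measurableSet_of_mem_atoms hA
  have hUA := hU.subset hstar hA
  have hTm : ∀ e ∈ T, MeasurableSet e.2 := fun e he =>
    F.measurableSet_of_mem_atoms (hT e he).mem_atoms
  obtain ⟨hS, hSA⟩ := sum_measureReal_exit_mem_Icc hstar hA hT hmass
  set S := ∑ e ∈ T, P.real e.2
  set g : Ω → ℝ := fun ω => ψ (x + cutFunction P A U ω • (3 : ℝ) • y)
  obtain ⟨hg, hgA⟩ := setIntegral_comp_cutFunction (P := P) hAm hU.measurableSet hUA
    (F.measureReal_pos hA).ne' fun c => ψ (x + c • (3 : ℝ) • y)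
  have hfirst : (ψ (x + y) + ψ (x - y)) / 2 * P.real A ≤ ∫ ω in A, g ω ∂P := by
    rw [hgA]
    gcongr
    exact half_add_le_of_convexOn hψ x y hq
  have hlost : b * (P.real A - S) ≤ δ * P.real A :=
    calc b * (P.real A - S) ≤ b * (P.real A - θ * P.real A) := by gcongr
      _ = (1 - (θ : ℝ)) * b * P.real A := by ring
      _ ≤ δ * P.real A := by gcongr
  have hrest : ∫ ω in A, g ω ∂P - b * (P.real A - S) ≤ ∑ e ∈ T, ∫ ω in e.2, g ω ∂P :=
    setIntegral_sub_le_sum_setIntegral hAm hTm (pairwiseDisjoint_of_isExit hstar hA hT)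
      (fun e he => (hT e he).subset hstar hA) hg fun ω _ => hψb _ (abs_cutFunction_le hUA ω)
  have hexit : ∑ e ∈ T, ∫ ω in e.2, g ω ∂P =
      ∑ e ∈ T, (ψ (x + z e • (3 : ℝ) • y) - δ) * P.real e.2 + δ * S := by
    rw [Finset.mul_sum, ← Finset.sum_add_distrib]
    refine Finset.sum_congr rfl fun e he => ?_
    have hge : Set.EqOn g (fun _ => ψ (x + z e • (3 : ℝ) • y)) e.2 := fun ω hω => by
      simp only [g, hz e he ω hω]
    rw [setIntegral_congr_fun (hTm e he) hge, setIntegral_const, smul_eq_mul]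
    ring
  have hδS : δ * S ≤ δ * P.real A := by gcongr
  linarith

end Rich

lemma exists_one_sub_mul_le {b δ : ℝ} (hb : 0 ≤ b) (hδ : 0 < δ) :
    ∃ θ₀ : ℝ≥0, θ₀ < 1 ∧ ∀ θ ≥ θ₀, (1 - (θ : ℝ)) * b ≤ δ := by
  refine ⟨(1 - δ / (b + 1)).toNNReal, ?_, fun θ hθ => ?_⟩
  · rw [Real.toNNReal_lt_one]
    have : 0 < δ / (b + 1) := by positivity
    linarith
  · have hle : 1 - (θ : ℝ) ≤ δ / (b + 1) := by
      have := Real.toNNReal_le_iff_le_coe.1 hθ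
      linarith
    calc (1 - (θ : ℝ)) * b ≤ δ / (b + 1) * b := by gcongr
      _ ≤ δ / (b + 1) * (b + 1) := by gcongr; linarith
      _ = δ := by field_simp

section Realize

variable {Ω : Type*} [m : MeasurableSpace Ω] {P : Measure Ω} {F : AtomicFiltration P}
  {star : ℕ → Set Ω → Set Ω} {n : ℕ} {A : Set Ω} {X : Type*} [NormedAddCommGroup X]
  [NormedSpace ℝ X] {p κ : ℝ}

lemma IsRich.exists_realizes_max {l r : DyadicTree X} {R δ κ' : ℝ} {θ θl θr : ℝ≥0}
    (hθl : θl ≤ θ) (hθr : θr ≤ θ)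
    (hl : ∀ n, ∀ A ∈ F.atoms n, F.IsRich star θl l.depth n A → ∀ x : X, ‖x‖ ≤ R →
      ∃ f ε, F.Realizes p κ A x ((l.val p κ' x - δ) * P.real A) f ε)
    (hr : ∀ n, ∀ A ∈ F.atoms n, F.IsRich star θr r.depth n A → ∀ x : X, ‖x‖ ≤ R →
      ∃ f ε, F.Realizes p κ A x ((r.val p κ' x - δ) * P.real A) f ε)
    (hA : A ∈ F.atoms n) (hrich : F.IsRich star θ (max l.depth r.depth) n A) {x : X}
    (hx : ‖x‖ ≤ R) :
    ∃ f ε, F.Realizes p κ A x ((max (l.val p κ' x) (r.val p κ' x) - δ) * P.real A) f ε := by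
  rcases le_total (l.val p κ' x) (r.val p κ' x) with h | h
  · rw [max_eq_right h]
    exact hr n A hA ((hrich.mono hθr).mono_depth (le_max_right _ _)) x hx
  · rw [max_eq_left h]
    exact hl n A hA ((hrich.mono hθl).mono_depth (le_max_left _ _)) x hx

lemma norm_add_rpow_le {X : Type*} [SeminormedAddCommGroup X] (hp1 : 1 ≤ p) (hp2 : p ≤ 2)
    (x y : X) : ‖x + y‖ ^ p ≤ 2 * ‖x‖ ^ p + 2 * ‖y‖ ^ p := by
  have h : ‖x + y‖₊ ^ p ≤ 2 * ‖x‖₊ ^ p + 2 * ‖y‖₊ ^ p :=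
    calc ‖x + y‖₊ ^ p ≤ (‖x‖₊ + ‖y‖₊) ^ p :=
          NNReal.rpow_le_rpow (nnnorm_add_le x y) (by linarith)
      _ ≤ (1 + 1) * ‖x‖₊ ^ p + 2 * 1 ^ (1 - p) * ‖y‖₊ ^ p :=
          add_rpow_le_one_add_mul_rpow hp1 hp2 one_pos le_rfl _ _
      _ = 2 * ‖x‖₊ ^ p + 2 * ‖y‖₊ ^ p := by rw [NNReal.one_rpow, mul_one, one_add_one_eq_two]
  exact_mod_cast h

variable [IsFiniteMeasure P]

lemma setIntegral_norm_add_rpow_le (hp1 : 1 ≤ p) (hp2 : p ≤ 2) {f : Ω → X}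
    (hf : IsMeanZeroOn P A f) (x : X) :
    ∫ ω in A, ‖x + f ω‖ ^ p ∂P ≤ 2 * ‖x‖ ^ p * P.real A + 2 * ∫ ω, ‖f ω‖ ^ p ∂P := by
  have hp0 : 0 ≤ p := by linarith
  obtain ⟨b, hb⟩ := hf.bounded
  have hint := integrable_norm_add_rpow (P := P) hp0 hf.stronglyMeasurable hb
  have hint0 : Integrable (fun ω => ‖f ω‖ ^ p) P := by simpa using hint 0
  calc ∫ ω in A, ‖x + f ω‖ ^ p ∂P ≤ ∫ ω in A, (2 * ‖x‖ ^ p + 2 * ‖f ω‖ ^ p) ∂P :=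
        setIntegral_mono (hint x).integrableOn
          ((integrable_const _).add (hint0.const_mul 2)).integrableOn
          fun ω => norm_add_rpow_le hp1 hp2 x (f ω)
    _ = 2 * ‖x‖ ^ p * P.real A + 2 * ∫ ω in A, ‖f ω‖ ^ p ∂P := by
        rw [integral_add (integrable_const _).integrableOn (hint0.const_mul 2).integrableOn,
          setIntegral_const, integral_const_mul, smul_eq_mul, mul_comm]
    _ ≤ 2 * ‖x‖ ^ p * P.real A + 2 * ∫ ω, ‖f ω‖ ^ p ∂P := by
        have := setIntegral_le_integral (s := A) hint0 (ae_of_all _ fun ω => by positivity)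
        linarith

variable [CompleteSpace X]

lemma energy_cutFunction_smul_le (hp1 : 1 ≤ p) (hp2 : p ≤ 2)
    (hstar : F.IsLargestChildSelection star) (hA : A ∈ F.atoms n) {U : Set Ω}
    (hU : F.IsCut star n A U) (y : X) :
    F.energy p (fun ω => cutFunction P A U ω • (3 : ℝ) • y) ≤
      ENNReal.ofReal (18 * ‖y‖ ^ p * P.real A) := by
  have hp0 : 0 < p := by linarith
  have hcut : Integrable (cutFunction P A U) P :=
    integrable_cutFunction (F.measurableSet_of_mem_atoms hA) hU.measurableSet
  have hpow : ‖(3 : ℝ) • y‖ ^ p ≤ 9 * ‖y‖ ^ p := by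
    rw [norm_smul, Real.mul_rpow (by positivity) (by positivity), Real.norm_ofNat]
    gcongr
    calc (3 : ℝ) ^ p ≤ 3 ^ (2 : ℝ) := Real.rpow_le_rpow_of_exponent_le (by norm_num) hp2
      _ = 9 := by norm_num
  calc F.energy p (fun ω => cutFunction P A U ω • (3 : ℝ) • y)
      ≤ ‖(3 : ℝ) • y‖ₑ ^ p * F.energy p (cutFunction P A U) := F.energy_smul_const_le hp0 hcut _
    _ ≤ ENNReal.ofReal (9 * ‖y‖ ^ p) * (2 * P A) := by
        rw [enorm_rpow_eq_ofReal _ hp0.le]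
        gcongr
        exact hU.energy_le hp1 hstar hA
    _ = ENNReal.ofReal (18 * ‖y‖ ^ p * P.real A) := by
        rw [← ofReal_measureReal, ← ENNReal.ofReal_ofNat 2, ← ENNReal.ofReal_mul (by positivity),
          ← ENNReal.ofReal_mul (by positivity)]
        ring_nf

-- One step of a dyadic martingale: a cut function imitates the first increment, and on the exits,
-- which fill `A` up to the proportion `1 - θ`, the continuation is already realized.
lemma exists_realizes_of_exits (hp1 : 1 ≤ p) (hp2 : p ≤ 2) (hstar : F.IsLargestChildSelection star)
    (hA : A ∈ F.atoms n) {T : Finset (ℕ × Set Ω)} (hT : ∀ e ∈ T, F.IsExit star n A e) {θ : ℝ≥0}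
    (hθ : 1 / 3 ≤ θ) (hmass : θ * P A ≤ ∑ e ∈ T, P e.2) {ψ : X → ℝ}
    (hψ : ConvexOn ℝ Set.univ ψ) {b δ : ℝ} (hb : 0 ≤ b) (hδ : 0 ≤ δ)
    (hθb : (1 - (θ : ℝ)) * b ≤ δ) {x y : X} (hψb : ∀ c : ℝ, |c| ≤ 1 → ψ (x + c • (3 : ℝ) • y) ≤ b)
    (hreal : ∀ e ∈ T, ∀ c : ℝ, |c| ≤ 1 → ∃ f ε, F.Realizes p κ e.2 (x + c • (3 : ℝ) • y)
      ((ψ (x + c • (3 : ℝ) • y) - δ) * P.real e.2) f ε) :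
    ∃ f ε, F.Realizes p κ A x
      (((ψ (x + y) + ψ (x - y)) / 2 - 18 * κ * ‖y‖ ^ p - 2 * δ) * P.real A) f ε := by
  obtain ⟨U, hU, hq⟩ := exists_isCut_ratio_mem_Icc hstar hA hT hθ hmass
  choose! z hz1 hz using fun e he => hU.exists_cutFunction_eq hstar hA (hT e he)
  choose! f ε hf using fun e he => hreal e he (z e) (hz1 e he)
  have hstep : IsMeanZeroOn P A fun ω => cutFunction P A U ω • (3 : ℝ) • y :=
    isMeanZeroOn_cutFunction_smul (F.measurableSet_of_mem_atoms hA) hU.measurableSet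
      (hU.subset hstar hA) (F.measureReal_pos hA).ne' _
  have hglue := Realizes.add_sum (by linarith) hA hstep (by positivity)
    (energy_cutFunction_smul_le hp1 hp2 hstar hA hU y) (fun e he => (hT e he).mem_atoms)
    (fun e he => (hT e he).subset hstar hA) (pairwiseDisjoint_of_isExit hstar hA hT)
    (fun e he ω hω => by rw [hz e he ω hω]) hf
  have hsum := half_add_sub_mul_le_sum hstar hA hU hq hT hmass hz hψ hb hδ hθb hψb
  exact ⟨_, _, hglue.mono (by linarith)⟩

theorem exists_realizes (hp1 : 1 ≤ p) (hp2 : p ≤ 2) (hκ : 0 ≤ κ)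
    (hstar : F.IsLargestChildSelection star) (t : DyadicTree X) (R : ℝ) {δ : ℝ} (hδ : 0 < δ) :
    ∃ θ : ℝ≥0, θ < 1 ∧ ∀ n, ∀ A ∈ F.atoms n, F.IsRich star θ t.depth n A → ∀ x : X, ‖x‖ ≤ R →
      ∃ f ε, F.Realizes p κ A x ((t.val p (18 * κ) x - δ) * P.real A) f ε := by
  have hp0 : 0 < p := by linarith
  induction t generalizing R δ with
  | leaf =>
    refine ⟨0, one_pos, fun n A _ _ x _ => ⟨0, 0, (realizes_zero hp0 x).mono ?_⟩⟩
    rw [DyadicTree.val]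
    gcongr
    linarith
  | node y l r hl hr =>
    obtain ⟨θl, hθl, hl⟩ := hl (R + 3 * ‖y‖) (half_pos hδ)
    obtain ⟨θr, hθr, hr⟩ := hr (R + 3 * ‖y‖) (half_pos hδ)
    obtain ⟨bl, hbl0, hbl⟩ := l.exists_val_le (κ := 18 * κ) hp0.le (by positivity) (R + 3 * ‖y‖)
    obtain ⟨br, _, hbr⟩ := r.exists_val_le (κ := 18 * κ) hp0.le (by positivity) (R + 3 * ‖y‖)
    have hb0 : 0 ≤ max bl br := le_max_of_le_left hbl0
    obtain ⟨θ₀, hθ₀, hθb⟩ := exists_one_sub_mul_le hb0 (half_pos hδ)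
    set θ : ℝ≥0 := max (max θl θr) (max θ₀ (1 / 3)) with hθ
    have hθ1 : θ < 1 :=
      max_lt (max_lt hθl hθr) (max_lt hθ₀ (by rw [div_lt_one (by norm_num)]; norm_num))
    refine ⟨θ, hθ1, fun n A hA ⟨T, hT, hmass⟩ x hx => ?_⟩
    have hball : ∀ c : ℝ, |c| ≤ 1 → ‖x + c • (3 : ℝ) • y‖ ≤ R + 3 * ‖y‖ := fun c hc => by
      refine (norm_add_le _ _).trans (add_le_add hx ?_)
      rw [norm_smul, norm_smul, Real.norm_ofNat]
      exact mul_le_of_le_one_left (by positivity) hc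
    obtain ⟨f, ε, hf⟩ := exists_realizes_of_exits hp1 hp2 hstar hA (fun e he => (hT e he).1)
      (by simp [hθ]) hmass ((l.convexOn_val hp1).sup (r.convexOn_val hp1)) hb0 (half_pos hδ).le
      (hθb θ (by simp [hθ])) (fun c hc => max_le_max (hbl _ (hball c hc)) (hbr _ (hball c hc)))
      fun e he c hc => IsRich.exists_realizes_max (θ := θ) (by simp [hθ]) (by simp [hθ]) hl hr
        (hT e he).1.mem_atoms (hT e he).2 (hball c hc)
    refine ⟨f, ε, hf.mono (mul_le_mul_of_nonneg_right ?_ measureReal_nonneg)⟩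
    have hadd := le_max_left (l.val p (18 * κ) (x + y)) (r.val p (18 * κ) (x + y))
    have hsub := le_max_right (l.val p (18 * κ) (x - y)) (r.val p (18 * κ) (x - y))
    simp only [DyadicTree.val, Pi.sup_apply]
    linarith

lemma UpperEstimate.integral_norm_rpow_le {C : ℝ≥0} (hp : 0 < p) (hC : F.UpperEstimate p X C)
    {f : Ω → X} {ε : ℝ} (hf : IsMeanZeroOn P A f) (hε : 0 ≤ ε)
    (hfε : F.energy p f ≤ ENNReal.ofReal ε) : ∫ ω, ‖f ω‖ ^ p ∂P ≤ (C : ℝ) ^ p * ε := by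
  obtain ⟨b, hb⟩ := hf.bounded
  have hint : Integrable (fun ω => ‖f ω‖ ^ p) P := by
    simpa using integrable_norm_add_rpow hp.le hf.stronglyMeasurable hb 0
  have hmem : MemLp f (ENNReal.ofReal p) P :=
    MemLp.of_bound hf.stronglyMeasurable.aestronglyMeasurable b (ae_of_all _ hb)
  have h := (F.upperEstimate_iff hp C).1 hC f hmem
  rw [hf.integral_eq_zero, enorm_zero, ENNReal.zero_rpow_of_pos hp, zero_add] at h
  refine (ENNReal.ofReal_le_ofReal_iff (by positivity)).1 ?_
  calc ENNReal.ofReal (∫ ω, ‖f ω‖ ^ p ∂P) = ∫⁻ ω, ‖f ω‖ₑ ^ p ∂P := by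
        rw [ofReal_integral_eq_lintegral_ofReal hint (ae_of_all _ fun ω => by positivity)]
        simp only [enorm_rpow_eq_ofReal _ hp.le]
    _ ≤ C ^ p * ENNReal.ofReal ε := h.trans (by gcongr)
    _ = ENNReal.ofReal ((C : ℝ) ^ p * ε) := by
        rw [ENNReal.ofReal_mul (by positivity), ← ENNReal.ofReal_rpow_of_nonneg C.coe_nonneg hp.le,
          ENNReal.ofReal_coe_nnreal]

theorem val_le_of_upperEstimate (hp1 : 1 ≤ p) (hp2 : p ≤ 2) (hstar : F.IsLargestChildSelection star)
    (hinf : carlesonConstant P (F.nonLargest star) = ∞) {C : ℝ≥0} (hC : F.UpperEstimate p X C)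
    (t : DyadicTree X) (x : X) : t.val p (18 * (2 * (C : ℝ) ^ p)) x ≤ 2 * ‖x‖ ^ p := by
  refine le_of_forall_pos_le_add fun δ hδ => ?_
  obtain ⟨θ, hθ, hrealizes⟩ :=
    exists_realizes (κ := 2 * (C : ℝ) ^ p) hp1 hp2 (by positivity) hstar t ‖x‖ hδ
  obtain ⟨n, A, hA, hrich⟩ := exists_isRich hstar hinf hθ t.depth
  obtain ⟨f, ε, hf⟩ := hrealizes n A hA hrich x le_rfl
  have hnorm := hC.integral_norm_rpow_le (by linarith) hf.toIsMeanZeroOn hf.nonneg hf.energy_le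
  have hupper := setIntegral_norm_add_rpow_le hp1 hp2 hf.toIsMeanZeroOn x
  have hlower := hf.le
  have h : (t.val p (18 * (2 * (C : ℝ) ^ p)) x - δ) * P.real A ≤ 2 * ‖x‖ ^ p * P.real A := by
    linarith
  linarith [le_of_mul_le_mul_right h (F.measureReal_pos hA)]

end Realize

end AtomicFiltration

/-- The largest functional of a dyadic martingale started at `x`: a convex function which carries
the inequality from dyadic to arbitrary martingales. -/
noncomputable def dyadicSup {X : Type*} [NormedAddCommGroup X] (p κ : ℝ) (x : X) : ℝ :=
  ⨆ t : DyadicTree X, t.val p κ x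

section DyadicSup

variable {X : Type*} [NormedAddCommGroup X] {p κ M : ℝ}

instance : Inhabited (DyadicTree X) := ⟨.leaf⟩

lemma integrable_norm_rpow_of_memLp {Ω : Type*} [MeasurableSpace Ω] {μ : Measure Ω} (hp : 0 < p)
    {f : Ω → X} (hf : MemLp f (ENNReal.ofReal p) μ) : Integrable (fun ω => ‖f ω‖ ^ p) μ := by
  simpa [ENNReal.toReal_ofReal hp.le] using
    hf.integrable_norm_rpow (by simpa using hp) ENNReal.ofReal_ne_top

variable (hval : ∀ (t : DyadicTree X) (x : X), t.val p κ x ≤ M * ‖x‖ ^ p)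
include hval

lemma val_le_dyadicSup (t : DyadicTree X) (x : X) : t.val p κ x ≤ dyadicSup p κ x :=
  le_ciSup (f := fun t : DyadicTree X => t.val p κ x)
    ⟨M * ‖x‖ ^ p, Set.forall_mem_range.2 fun t => hval t x⟩ t

lemma norm_rpow_le_dyadicSup (x : X) : ‖x‖ ^ p ≤ dyadicSup p κ x :=
  val_le_dyadicSup hval .leaf x

lemma dyadicSup_nonneg (x : X) : 0 ≤ dyadicSup p κ x :=
  (Real.rpow_nonneg (norm_nonneg x) p).trans (norm_rpow_le_dyadicSup hval x)

lemma dyadicSup_le (x : X) : dyadicSup p κ x ≤ M * ‖x‖ ^ p :=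
  ciSup_le fun t => hval t x

lemma dyadicSup_add_dyadicSup_le (x y : X) :
    dyadicSup p κ (x + y) + dyadicSup p κ (x - y) ≤ 2 * dyadicSup p κ x + 2 * κ * ‖y‖ ^ p := by
  refine ciSup_add_ciSup_le fun t t' => ?_
  have h := val_le_dyadicSup hval (.node y t t') x
  rw [DyadicTree.val] at h
  linarith

variable [NormedSpace ℝ X]

lemma convexOn_dyadicSup (hp : 1 ≤ p) : ConvexOn ℝ Set.univ (dyadicSup p κ : X → ℝ) := by
  refine ⟨convex_univ, fun x _ y _ a b ha hb hab => ciSup_le fun t => ?_⟩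
  calc t.val p κ (a • x + b • y) ≤ a • t.val p κ x + b • t.val p κ y :=
        (t.convexOn_val hp).2 (Set.mem_univ x) (Set.mem_univ y) ha hb hab
    _ ≤ a • dyadicSup p κ x + b • dyadicSup p κ y := by
        gcongr <;> exact val_le_dyadicSup hval t _

lemma continuous_dyadicSup (hp : 1 ≤ p) (hM : 0 ≤ M) : Continuous (dyadicSup p κ : X → ℝ) := by
  have hbdd : ∃ x₀ ∈ (Set.univ : Set X), (𝓝 x₀).IsBoundedUnder (· ≤ ·) (dyadicSup p κ) := by
    refine ⟨0, Set.mem_univ _, M, eventually_map.2 ?_⟩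
    filter_upwards [Metric.ball_mem_nhds (0 : X) one_pos] with x hx
    refine (dyadicSup_le hval x).trans (mul_le_of_le_one_right hM ?_)
    exact Real.rpow_le_one (norm_nonneg x) (mem_ball_zero_iff.1 hx).le (by linarith)
  have htfae := (convexOn_dyadicSup hval hp).continuousOn_tfae isOpen_univ Set.univ_nonempty
  exact continuousOn_univ.1 ((htfae.out 1 3).2 hbdd)

variable {Ω : Type*} [MeasurableSpace Ω] {μ : Measure Ω} {g : Ω → X}

lemma integrable_dyadicSup_comp (hp : 1 ≤ p) (hM : 0 ≤ M) (hg : MemLp g (ENNReal.ofReal p) μ) :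
    Integrable (fun ω => dyadicSup p κ (g ω)) μ := by
  refine ((integrable_norm_rpow_of_memLp (by linarith) hg).const_mul M).mono'
    ((continuous_dyadicSup hval hp hM).comp_aestronglyMeasurable hg.1) (ae_of_all _ fun ω => ?_)
  rw [Real.norm_of_nonneg (dyadicSup_nonneg hval _)]
  exact dyadicSup_le hval (g ω)

variable [CompleteSpace X]

lemma dyadicSup_integral_le [IsProbabilityMeasure μ] (hp : 1 ≤ p) (hM : 0 ≤ M)
    (hg : MemLp g (ENNReal.ofReal p) μ) :
    dyadicSup p κ (∫ ω, g ω ∂μ) ≤ ∫ ω, dyadicSup p κ (g ω) ∂μ :=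
  (convexOn_dyadicSup hval hp).map_integral_le (continuous_dyadicSup hval hp hM).continuousOn
    isClosed_univ (ae_of_all μ fun _ => Set.mem_univ _) (hg.integrable (by simpa using hp))
    (integrable_dyadicSup_comp hval hp hM hg)

-- The two-point inequality at the mean `x` bounds `g` together with its reflection `2 x - g`,
-- and by Jensen's inequality the reflection contributes at least the value at `x`.
lemma integral_dyadicSup_comp_le [IsProbabilityMeasure μ] (hp : 1 ≤ p) (hM : 0 ≤ M)
    (hg : MemLp g (ENNReal.ofReal p) μ) :
    ∫ ω, dyadicSup p κ (g ω) ∂μ ≤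
      dyadicSup p κ (∫ ω, g ω ∂μ) + 2 * κ * ∫ ω, ‖g ω - ∫ ω, g ω ∂μ‖ ^ p ∂μ := by
  have hgi : Integrable g μ := hg.integrable (by simpa using hp)
  set x := ∫ ω, g ω ∂μ with hx
  have hd : MemLp (fun ω => g ω - x) (ENNReal.ofReal p) μ := hg.sub (memLp_const x)
  have hr : MemLp (fun ω => x - (g ω - x)) (ENNReal.ofReal p) μ := (memLp_const x).sub hd
  have hrx : ∫ ω, (x - (g ω - x)) ∂μ = x := by
    have hdi : Integrable (fun ω => g ω - x) μ := hgi.sub (integrable_const x)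
    rw [integral_sub (integrable_const x) hdi, integral_sub hgi (integrable_const x)]
    simp [hx]
  have hjensen := dyadicSup_integral_le hval hp hM hr
  rw [hrx] at hjensen
  have hgS := integrable_dyadicSup_comp hval hp hM hg
  have hrS := integrable_dyadicSup_comp hval hp hM hr
  have hdp := integrable_norm_rpow_of_memLp (by linarith) hd
  have htwo : ∫ ω, dyadicSup p κ (g ω) ∂μ + ∫ ω, dyadicSup p κ (x - (g ω - x)) ∂μ ≤
      2 * dyadicSup p κ x + 2 * κ * ∫ ω, ‖g ω - x‖ ^ p ∂μ :=
    calc _ = ∫ ω, (dyadicSup p κ (g ω) + dyadicSup p κ (x - (g ω - x))) ∂μ :=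
          (integral_add hgS hrS).symm
      _ ≤ ∫ ω, (2 * dyadicSup p κ x + 2 * κ * ‖g ω - x‖ ^ p) ∂μ := by
          refine integral_mono (hgS.add hrS) ((integrable_const _).add (hdp.const_mul _))
            fun ω => ?_
          simpa using dyadicSup_add_dyadicSup_le hval x (g ω - x)
      _ = 2 * dyadicSup p κ x + 2 * κ * ∫ ω, ‖g ω - x‖ ^ p ∂μ := by
          rw [integral_add (integrable_const _) (hdp.const_mul _), integral_const_mul (2 * κ)]
          simp
  linarith

lemma lintegral_dyadicSup_comp_le [IsProbabilityMeasure μ] (hp : 1 ≤ p) (hκ : 0 ≤ κ) (hM : 0 ≤ M)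
    (hg : MemLp g (ENNReal.ofReal p) μ) :
    ∫⁻ ω, ENNReal.ofReal (dyadicSup p κ (g ω)) ∂μ ≤
      ENNReal.ofReal (dyadicSup p κ (∫ ω, g ω ∂μ)) +
        ENNReal.ofReal (2 * κ) * ∫⁻ ω, ‖g ω - ∫ ω, g ω ∂μ‖ₑ ^ p ∂μ := by
  have hp0 : 0 < p := by linarith
  have hd : Integrable (fun ω => ‖g ω - ∫ ω, g ω ∂μ‖ ^ p) μ :=
    integrable_norm_rpow_of_memLp hp0 (hg.sub (memLp_const _))
  simp only [enorm_rpow_eq_ofReal _ hp0.le]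
  rw [← ofReal_integral_eq_lintegral_ofReal (integrable_dyadicSup_comp hval hp hM hg)
      (ae_of_all _ fun _ => dyadicSup_nonneg hval _),
    ← ofReal_integral_eq_lintegral_ofReal hd (ae_of_all _ fun _ => by positivity),
    ← ENNReal.ofReal_mul (by positivity),
    ← ENNReal.ofReal_add (dyadicSup_nonneg hval _) (by positivity)]
  exact ENNReal.ofReal_le_ofReal (integral_dyadicSup_comp_le hval hp hM hg)

lemma setLIntegral_dyadicSup_comp_le [IsFiniteMeasure μ] (hp : 1 ≤ p) (hκ : 0 ≤ κ) (hM : 0 ≤ M)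
    (hg : MemLp g (ENNReal.ofReal p) μ) {A : Set Ω} (hA : μ A ≠ 0) :
    ∫⁻ ω in A, ENNReal.ofReal (dyadicSup p κ (g ω)) ∂μ ≤
      μ A * ENNReal.ofReal (dyadicSup p κ (⨍ ω in A, g ω ∂μ)) +
        ENNReal.ofReal (2 * κ) * ∫⁻ ω in A, ‖g ω - ⨍ ω in A, g ω ∂μ‖ₑ ^ p ∂μ := by
  have hAtop : μ A ≠ ∞ := by finiteness
  have : IsProbabilityMeasure ((μ A)⁻¹ • μ.restrict A) :=
    ProbabilityTheory.cond_isProbabilityMeasure hA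
  rw [← measure_mul_setLAverage _ hAtop, ← measure_mul_setLAverage _ hAtop, mul_left_comm,
    ← mul_add, setLAverage_eq', setLAverage_eq', setAverage_eq']
  gcongr
  exact lintegral_dyadicSup_comp_le hval hp hκ hM
    ((hg.restrict A).smul_measure (ENNReal.inv_ne_top.2 hA))

end DyadicSup

namespace AtomicFiltration

variable {Ω : Type*} [MeasurableSpace Ω] {P : Measure Ω} (F : AtomicFiltration P) {p : ℝ}

lemma isPotential_dyadicSup [IsFiniteMeasure P] {X : Type*} [NormedAddCommGroup X]
    [NormedSpace ℝ X] [CompleteSpace X] (hp : 1 ≤ p) {κ M : ℝ≥0}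
    (hval : ∀ (t : DyadicTree X) (x : X), t.val p κ x ≤ M * ‖x‖ ^ p) :
    F.IsPotential p (M + 2 * κ) fun _ _ (x : X) => ENNReal.ofReal (dyadicSup p κ x) where
  enorm_rpow_le n A _ x := by
    rw [enorm_rpow_eq_ofReal _ (by linarith)]
    exact ENNReal.ofReal_le_ofReal (norm_rpow_le_dyadicSup hval x)
  root_le x := by
    calc ENNReal.ofReal (dyadicSup p κ x) ≤ ENNReal.ofReal (M * ‖x‖ ^ p) :=
          ENNReal.ofReal_le_ofReal (dyadicSup_le hval x)
      _ = M * ‖x‖ₑ ^ p := by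
          rw [ENNReal.ofReal_mul M.coe_nonneg, ENNReal.ofReal_coe_nnreal,
            enorm_rpow_eq_ofReal _ (by linarith)]
      _ ≤ (M + 2 * κ : ℝ≥0) * ‖x‖ₑ ^ p := by
          gcongr
          exact le_self_add
  step_le n A hA g hg _ := by
    refine (setLIntegral_dyadicSup_comp_le hval hp κ.coe_nonneg M.coe_nonneg hg
      (F.measure_atoms_pos n A hA).ne').trans ?_
    gcongr
    rw [ENNReal.ofReal_le_iff_le_toReal ENNReal.coe_ne_top, ENNReal.coe_toReal]
    exact_mod_cast le_add_self

theorem determinesMartingaleType_of_carlesonConstant_eq_top [IsFiniteMeasure P]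
    {star : ℕ → Set Ω → Set Ω} (hstar : F.IsLargestChildSelection star) (hp1 : 1 ≤ p)
    (hp2 : p ≤ 2) (hinf : carlesonConstant P (F.nonLargest star) = ∞) :
    DeterminesMartingaleType F p := by
  rintro X _ _ _ ⟨C, _, hC⟩
  refine ⟨(2 + 2 * (18 * (2 * C ^ p))) ^ (1 / p), by positivity, fun Ω' _ P' _ F' => ?_⟩
  refine (F'.isPotential_dyadicSup hp1 fun t x => ?_).upperEstimate hp1
  simpa using val_le_of_upperEstimate hp1 hp2 hstar hinf hC t x

end AtomicFiltration

lemma measurableSet_generateFrom_classes {Ω : Type*} [Countable Ω] (r : Setoid Ω) {s : Set Ω}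
    (hs : ∀ x ∈ s, ∀ y, r y x → y ∈ s) :
    MeasurableSet[MeasurableSpace.generateFrom r.classes] s := by
  have h : s = ⋃ x ∈ s, {y | r y x} :=
    Set.Subset.antisymm (fun x hx => Set.mem_biUnion hx (r.refl x))
      (Set.iUnion₂_subset fun x hx y hy => hs x hx y hy)
  rw [h]
  exact .biUnion s.to_countable fun x _ =>
    MeasurableSpace.measurableSet_generateFrom (r.mem_classes x)

/-- The filtration of a countable discrete probability space whose `n`-th atoms are the classes of
the `n`-th of a decreasing sequence of equivalence relations. -/
def AtomicFiltration.ofSetoid {Ω : Type*} [Countable Ω] [Nonempty Ω] [MeasurableSpace Ω]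
    [DiscreteMeasurableSpace Ω] {P : Measure Ω} (hP : ∀ ω, P {ω} ≠ 0) (r : ℕ → Setoid Ω)
    (hr : Antitone r) (hr0 : r 0 = ⊤) {N : ℕ} (hrN : r N = ⊥) : AtomicFiltration P where
  seq n := MeasurableSpace.generateFrom (r n).classes
  mono' n k hnk := MeasurableSpace.generateFrom_le <| by
    rintro _ ⟨x, rfl⟩
    exact measurableSet_generateFrom_classes _ fun y hy z hzy => (r n).trans (hr hnk hzy) hy
  le' _ _ _ := .of_discrete
  atoms n := (r n).classes
  countable_atoms n := (Set.countable_range fun y : Ω => {x | r n x y}).mono <| by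
    rintro _ ⟨y, rfl⟩
    exact ⟨y, rfl⟩
  pairwiseDisjoint_atoms n := (r n).isPartition_classes.pairwiseDisjoint
  sUnion_atoms n := (r n).sUnion_classes
  measure_atoms_pos n := by
    rintro _ ⟨x, rfl⟩
    exact (pos_iff_ne_zero.2 (hP x)).trans_le
      (measure_mono (Set.singleton_subset_iff.2 ((r n).refl x)))
  seq_eq_generateFrom _ := rfl
  atoms_zero := by
    have h : ∀ y, {x | r 0 x y} = Set.univ := fun y =>
      Set.eq_univ_of_forall fun x => by
        rw [hr0]
        trivial
    ext s
    simp [Setoid.classes, h]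
  iSup_seq := le_antisymm (iSup_le fun _ _ _ => .of_discrete) <|
    le_iSup_of_le N fun s _ => measurableSet_generateFrom_classes _ fun x hx y hy => by
      rw [hrN] at hy
      exact (hy : y = x) ▸ hx

open ProbabilityTheory in
lemma setIntegral_uniformOn_eq_zero {Ω : Type*} [Finite Ω] [MeasurableSpace Ω]
    [MeasurableSingletonClass Ω] {A : Set Ω} (e : Equiv.Perm Ω) (he : ∀ ω, e ω ∈ A ↔ ω ∈ A)
    {f : Ω → ℝ} (hf : ∀ ω ∈ A, f (e ω) = -f ω) : ∫ ω in A, f ω ∂(uniformOn Set.univ) = 0 := by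
  classical
  have := Fintype.ofFinite Ω
  have hodd : ∀ ω, A.indicator f (e ω) = -A.indicator f ω := fun ω => by
    by_cases hω : ω ∈ A
    · rw [Set.indicator_of_mem hω, Set.indicator_of_mem ((he ω).2 hω), hf ω hω]
    · rw [Set.indicator_of_notMem hω, Set.indicator_of_notMem (mt (he ω).1 hω), neg_zero]
  have hsum : ∑ ω, A.indicator f ω = 0 := by
    have h := Equiv.sum_comp e (A.indicator f)
    simp only [hodd, Finset.sum_neg_distrib] at h
    linarith
  rw [← integral_indicator A.toFinite.measurableSet, integral_fintype .of_finite]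
  simp [measureReal_def, uniformOn_univ, ← Finset.mul_sum, hsum]

/-- The vectors of `N` signs, in an arbitrary universe. -/
abbrev SignVector (N : ℕ) : Type w := ULift.{w} (Fin N → Bool)

namespace SignVector

open ProbabilityTheory

variable {N n : ℕ}

/-- The relation of having the same first `n` signs. -/
def agree (N n : ℕ) : Setoid (SignVector.{w} N) where
  r ω ω' := ∀ i : Fin N, i.1 < n → ω.down i = ω'.down i
  iseqv := ⟨fun _ _ _ => rfl, fun h i hi => (h i hi).symm,
    fun h h' i hi => (h i hi).trans (h' i hi)⟩

/-- The uniform distribution on the vectors of `N` signs. -/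
noncomputable abbrev unif (N : ℕ) : Measure (SignVector.{w} N) := uniformOn Set.univ

lemma unif_singleton_ne_zero (ω : SignVector.{w} N) : unif N {ω} ≠ 0 := by
  rw [Ne, uniformOn_eq_zero_iff Set.finite_univ, Set.univ_inter]
  exact Set.singleton_ne_empty ω

/-- The filtration generated by the successive signs. -/
noncomputable def filtration (N : ℕ) : AtomicFiltration (unif.{w} N) :=
  .ofSetoid unif_singleton_ne_zero (agree N) (fun _ _ hnk _ _ h i hi => h i (hi.trans_le hnk))
    (Setoid.eq_top_iff.2 fun _ _ _ hi => absurd hi (Nat.not_lt_zero _)) (N := N)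
    (eq_bot_iff.2 fun _ _ h => ULift.ext _ _ (funext fun i => h i i.2))

lemma agree_mem_atoms (n : ℕ) (ω : SignVector.{w} N) :
    {ω' | agree N n ω' ω} ∈ (filtration N).atoms n :=
  (agree N n).mem_classes ω

/-- The `k`-th sign. -/
def sign (k : Fin N) (ω : SignVector.{w} N) : ℝ := if ω.down k then 1 else -1

lemma abs_sign (k : Fin N) (ω : SignVector.{w} N) : |sign k ω| = 1 := by
  unfold sign
  split_ifs <;> simp

/-- The map changing the `k`-th sign. -/
def flip (k : Fin N) : Equiv.Perm (SignVector.{w} N) :=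
  Function.Involutive.toPerm (fun ω => ⟨fun i => ω.down i ^^ decide (i = k)⟩) fun ω => by
    ext i
    simp

lemma flip_down (k i : Fin N) (ω : SignVector.{w} N) :
    (flip k ω).down i = (ω.down i ^^ decide (i = k)) :=
  rfl

lemma sign_flip (k : Fin N) (ω : SignVector.{w} N) : sign k (flip k ω) = -sign k ω := by
  cases h : ω.down k <;> simp [sign, flip_down, h]

lemma agree_flip_iff {k : Fin N} (hk : n ≤ k.1) (ω ω' : SignVector.{w} N) :
    agree N n (flip k ω) ω' ↔ agree N n ω ω' := by
  refine forall₂_congr fun i hi => ?_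
  have hik : i ≠ k := fun h => by omega
  simp [flip_down, hik]

lemma setIntegral_sign {k : Fin N} (hk : n ≤ k.1) (ω : SignVector.{w} N) :
    ∫ x in {ω' | agree N n ω' ω}, sign k x ∂(unif N) = 0 :=
  setIntegral_uniformOn_eq_zero (flip k) (fun x => agree_flip_iff hk x ω) fun x _ => sign_flip k x

end SignVector

/-- The space `ℓ¹` in an arbitrary universe. -/
abbrev EllOne : Type v := lp (fun _ : ULift.{v} ℕ => ℝ) 1

namespace EllOne

open SignVector

variable {N : ℕ}

/-- The sum of the first `N` unit vectors of `ℓ¹`, with signs. -/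
noncomputable def signedSum (N : ℕ) (ω : SignVector.{w} N) : EllOne.{v} :=
  ∑ k : Fin N, sign k ω • lp.single 1 (ULift.up k.1) (1 : ℝ)

lemma norm_signedSum (ω : SignVector.{w} N) : ‖(signedSum N ω : EllOne.{v})‖ = N := by
  let e : Fin N ↪ ULift.{v} ℕ := ⟨fun k => ⟨k.1⟩, fun k l h => Fin.ext (congrArg ULift.down h)⟩
  let f : ULift.{v} ℕ → ℝ := fun i => if h : i.down < N then sign ⟨i.down, h⟩ ω else 0
  have hf : ∀ k : Fin N, f (e k) = sign k ω := fun k => dif_pos k.2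
  have hsum : (signedSum N ω : EllOne.{v}) = ∑ i ∈ Finset.univ.map e, lp.single 1 i (f i) := by
    rw [Finset.sum_map]
    refine Finset.sum_congr rfl fun k _ => ?_
    rw [← lp.single_smul, hf, smul_eq_mul, mul_one]
    rfl
  have h := lp.norm_sum_single (p := 1) (E := fun _ : ULift.{v} ℕ => ℝ) (by simp) f
    (Finset.univ.map e)
  rw [← hsum, Finset.sum_map] at h
  simpa [hf, abs_sign] using h

lemma condExp_signedSum (n : ℕ) (ω : SignVector.{w} N) :
    ((unif N)[(signedSum N : SignVector.{w} N → EllOne.{v}) | (filtration N).seq n]) ω =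
      ∑ k : Fin N, if k.1 < n then sign k ω • lp.single 1 (ULift.up k.1) (1 : ℝ) else 0 := by
  have hA := agree_mem_atoms n ω
  rw [(filtration N).condExp_eq_setAverage .of_finite hA ((agree N n).refl ω), setAverage_eq]
  unfold signedSum
  rw [integral_finsetSum _ fun k _ => Integrable.of_finite.integrableOn, Finset.smul_sum]
  refine Finset.sum_congr rfl fun k _ => ?_
  rw [integral_smul_const]
  split_ifs with hk
  · have hsign : Set.EqOn (sign k) (fun _ => sign k ω) {ω' | agree N n ω' ω} := fun x hx => by
      simp only [sign, hx k hk]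
    rw [setIntegral_congr_fun .of_discrete hsign, setIntegral_const, smul_eq_mul, smul_smul,
      inv_mul_cancel_left₀ ((filtration N).measureReal_pos hA).ne']
  · rw [setIntegral_sign (not_lt.1 hk), zero_smul, smul_zero]

lemma enorm_condExp_signedSum_sub (n : ℕ) (ω : SignVector.{w} N) :
    ‖((unif N)[(signedSum N : SignVector.{w} N → EllOne.{v}) | (filtration N).seq (n + 1)]) ω -
      ((unif N)[(signedSum N : SignVector.{w} N → EllOne.{v}) | (filtration N).seq n]) ω‖ₑ =
        if n < N then 1 else 0 := by
  rw [condExp_signedSum, condExp_signedSum, ← Finset.sum_sub_distrib]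
  split_ifs with hn
  · rw [Finset.sum_eq_single_of_mem (⟨n, hn⟩ : Fin N) (Finset.mem_univ _)]
    · simp only [Nat.lt_succ_self, lt_irrefl, if_true, if_false, sub_zero]
      rw [← ofReal_norm, norm_smul, lp.norm_single (by simp), Real.norm_eq_abs, abs_sign]
      simp
    · intro k _ hk
      have hkn : k.1 ≠ n := fun h => hk (Fin.ext h)
      have : k.1 < n + 1 ↔ k.1 < n := by omega
      simp only [this, sub_self]
  · rw [Finset.sum_eq_zero, enorm_zero]
    intro k _
    have : k.1 < n := by omega
    have : k.1 < n + 1 := by omega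
    simp only [*, if_true, sub_self]

lemma integral_signedSum (N : ℕ) : ∫ ω, (signedSum N ω : EllOne.{v}) ∂(unif.{w} N) = 0 := by
  rw [← (filtration N).condExp_zero_eq .of_finite ⟨fun _ => true⟩, condExp_signedSum]
  simp

lemma energy_signedSum {p : ℝ} (hp : 0 < p) (N : ℕ) :
    (filtration.{w} N).energy p (signedSum N : SignVector.{w} N → EllOne.{v}) = N := by
  have hterm : ∀ n : ℕ, ((if n < N then 1 else 0 : ℝ≥0∞)) ^ p = if n < N then 1 else 0 :=
    fun n => by split_ifs <;> simp [hp]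
  simp only [AtomicFiltration.energy, enorm_condExp_signedSum_sub, lintegral_const, measure_univ,
    mul_one, hterm]
  rw [tsum_eq_sum (s := Finset.range N) fun n hn => if_neg (by simpa using hn),
    Finset.sum_congr rfl fun n hn => if_pos (Finset.mem_range.1 hn)]
  simp

lemma natCast_rpow_le_of_upperEstimate {p : ℝ} (hp : 0 < p) {C : ℝ≥0}
    (hC : (filtration.{w} N).UpperEstimate p EllOne.{v} C) : (N : ℝ≥0) ^ p ≤ C ^ p * N := by
  have h := ((filtration.{w} N).upperEstimate_iff hp C).1 hC (signedSum N) .of_discrete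
  have hnorm : ∀ ω : SignVector.{w} N, ‖(signedSum N ω : EllOne.{v})‖ₑ = N := fun ω => by
    rw [← ofReal_norm, norm_signedSum, ENNReal.ofReal_natCast]
  simp only [integral_signedSum, energy_signedSum hp, hnorm, enorm_zero,
    ENNReal.zero_rpow_of_pos hp, zero_add, lintegral_const, measure_univ, mul_one] at h
  rw [← ENNReal.coe_natCast, ← ENNReal.coe_rpow_of_nonneg _ hp.le,
    ← ENNReal.coe_rpow_of_nonneg _ hp.le] at h
  exact_mod_cast h

theorem not_hasMartingaleType {p : ℝ} (hp : 1 < p) : ¬ HasMartingaleType.{w, v} p EllOne.{v} := by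
  rintro ⟨C, _, hC⟩
  have htend := (NNReal.tendsto_rpow_atTop (sub_pos.2 hp)).comp
    (tendsto_natCast_atTop_atTop (R := ℝ≥0))
  obtain ⟨N, hlt, hN⟩ := ((htend.eventually_gt_atTop (C ^ p)).and (eventually_gt_atTop 0)).exists
  have hN0 : (0 : ℝ≥0) < N := by exact_mod_cast hN
  have hle := natCast_rpow_le_of_upperEstimate (by linarith) (hC _ _ (filtration.{w} N))
  rw [Function.comp_apply, NNReal.rpow_sub_one hN0.ne', lt_div_iff₀ hN0] at hlt
  exact hlt.not_ge hle

end EllOne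

theorem theorem1 {Ω : Type u} [MeasurableSpace Ω] (P : Measure Ω)
    [IsProbabilityMeasure P] (F : AtomicFiltration P) (p : ℝ) (hp1 : 1 < p) (hp2 : p ≤ 2) :
    ((EstimateForAll.{v, u} F p ∨ DeterminesMartingaleType.{w, v, u} F p) ∧
      ¬ (EstimateForAll.{v, u} F p ∧ DeterminesMartingaleType.{w, v, u} F p)) ∧
    ∀ star : ℕ → Set Ω → Set Ω, F.IsLargestChildSelection star →
      (EstimateForAll.{v, u} F p ↔ carlesonConstant P (F.nonLargest star) < ∞) ∧
      (DeterminesMartingaleType.{w, v, u} F p ↔ carlesonConstant P (F.nonLargest star) = ∞) := by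
  have hnot : ¬ (EstimateForAll.{v, u} F p ∧ DeterminesMartingaleType.{w, v, u} F p) := by
    rintro ⟨⟨C, hC, ha⟩, hb⟩
    exact EllOne.not_hasMartingaleType hp1 (hb EllOne.{v} ⟨C, hC, ha _⟩)
  have ha : ∀ {star}, F.IsLargestChildSelection star →
      carlesonConstant P (F.nonLargest star) < ∞ → EstimateForAll.{v, u} F p :=
    fun hstar h => F.estimateForAll_of_carlesonConstant_lt_top hstar hp1 hp2 h
  have hb : ∀ {star}, F.IsLargestChildSelection star →
      carlesonConstant P (F.nonLargest star) = ∞ → DeterminesMartingaleType.{w, v, u} F p :=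
    fun hstar h => F.determinesMartingaleType_of_carlesonConstant_eq_top hstar hp1.le hp2 h
  refine ⟨⟨?_, hnot⟩, fun star hstar => ⟨⟨fun h => ?_, ha hstar⟩, fun h => ?_, hb hstar⟩⟩
  · obtain ⟨star, hstar⟩ := F.exists_isLargestChildSelection
    exact (lt_or_eq_of_le le_top).imp (ha hstar) (hb hstar)
  · exact lt_top_iff_ne_top.2 fun htop => hnot ⟨h, hb hstar htop⟩
  · by_contra htop
    exact hnot ⟨ha hstar (lt_top_iff_ne_top.2 htop), h⟩
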